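/- **Interreducibility of MSL($\omega$) satisfiability, HORS model checking and intersection typeability.** Simple types over one base type $\iota$ are generated by $\iota$ and $\to$; terms are well-typed applicative terms (no $\lambda$). *MSL($\omega$).* Let $\Sigma$ be a finite signature of constructors of arbitrary simple types and $\Pi$ a finite set of predicates, all of type $\iota\to o$. Goal formulas are $G,H ::= P\,t \mid G\wedge H\mid \exists x{:}\kappa.\,G\mid \mathsf{true}$, with $t$ a term of type $\iota$ and $\kappa$ any simple type. A definite formula $D$ is a finite set of closed clauses $\forall y.\,G\Rightarrow P\,y$ (with $y:\iota$) and $\forall \vec y.\,G\Rightarrow P\,(c\,\vec y)$ (with $c\in\Sigma$ fully applied to distinct variables). $D\vdash G$, for closed $G$, is derivability by the rules: $D\vdash\mathsf{true}$; from $D\vdash G$ and $D\vdash H$ infer $D\vdash G\wedge H$; from $D\vdash G[t/x]$ infer $D\vdash\exists x.\,G$; from $D\vdash G[\vec s/\vec y]$ infer $D\vdash A[\vec s/\vec y]$ whenever $(\forall\vec y.\,G\Rightarrow A)\in D$, where $t,\vec s$ are closed and well typed. $D\models G$ means that $G$ holds in every model of $D$, in the standard semantics (non-empty domain for $\iota$,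 full function spaces). Consider the following decision problems. 1. *MSL($\omega$) satisfiability, proof-theoretic form*: given $D$ and closed $G$ (existential quantifiers allowed), is $D\not\vdash G$? 2. *Existential-free MSL($\omega$) satisfiability*: given $D$ and closed $G$ without existential quantifiers, is $D\not\models G$, i.e. is $D\wedge(G\Rightarrow\mathsf{false})$ satisfiable? 3. *HORS (safety) model checking*: given a (deterministic) higher-order recursion scheme $\mathcal G$ and a nondeterministic top-down tree automaton $\mathcal B$ with trivial acceptance condition over the terminals of $\mathcal G$, is the value tree of $\mathcal G$ accepted by $\mathcal B$, where the undefined leaf $\bot$ is accepted from every state? 4. *Intersection typeability*: given such $\mathcal G$ and $\mathcal B$, is there an assignment $\Gamma$ of intersection types (strict types $q$, for states $q$ of $\mathcal B$, and $\bigwedge_i\tau_i\to\tau$, refining simple types) to the nonterminals that contains $S:q_0$ for the start symbol $S$ and the initial state $q_0$, and such that for every $F:\bigwedge T_1\to\cdots\to\bigwedge T_n\to q$ in $\Gamma$, with rule $F\,x_1\cdots x_n\to t$, the judgement $\Gamma,x_1{:}\bigwedge T_1,\dots,x_n{:}\bigwedge T_n\vdash t:q$ is derivable? Here a terminal $a$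 has the type $q_1\to\cdots\to q_k\to q$ for each transition $(q,a,q_1\cdots q_k)$ of $\mathcal B$, variables and nonterminals have the types assigned to them, and an application $s\,t$ has type $\tau$ if $s:\sigma\to\tau$ and $t$ has all types of some intersection $\sigma'\le\sigma$ (structural subtyping, trivial on states). Then MSL($\omega$) satisfiability (in either of the forms 1 and 2) reduces to HORS model checking by a polynomial-time many-one reduction; moreover, each of the four problems reduces to each of the others by a polynomial-time many-one reduction, so that they are interreducible. -/

import Mathlib

namespace MSL

/-! ## Simple types and applicative terms -/

/-- Simple types over one base type (the type of individuals, or of trees). -/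
inductive Ty : Type where
  | base : Ty
  | arr : Ty → Ty → Ty

/-- The list of argument types of a type, i.e. `[κ₁, …, κₙ]` for `κ₁ → ⋯ → κₙ → base`. -/
def Ty.args : Ty → List Ty
  | .base => []
  | .arr a b => a :: b.args

/-- Positions of type `τ` in a list of types: typed de Bruijn variables if the list is a type
context, typed symbols if the list is a finite signature. -/
inductive Var : List Ty → Ty → Type where
  | here {Γ : List Ty} {τ : Ty} : Var (τ :: Γ) τ
  | there {Γ : List Ty} {σ τ : Ty} : Var Γ τ → Var (σ :: Γ) τ

/-- Well-typed applicative terms with constants `K` and free variables in `Γ`. -/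
inductive Term (K : Ty → Type) (Γ : List Ty) : Ty → Type where
  | var {τ : Ty} (x : Var Γ τ) : Term K Γ τ
  | cst {τ : Ty} (c : K τ) : Term K Γ τ
  | app {σ τ : Ty} (s : Term K Γ (.arr σ τ)) (t : Term K Γ σ) : Term K Γ τ

/-- A (well-typed, simultaneous) substitution of terms over `Δ` for the variables of `Γ`. -/
abbrev Subst (K : Ty → Type) (Γ Δ : List Ty) : Type :=
  ∀ ⦃τ : Ty⦄, Var Γ τ → Term K Δ τ

def Term.rename {K : Ty → Type} {Γ Δ : List Ty} (r : ∀ ⦃τ : Ty⦄, Var Γ τ → Var Δ τ) :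
    ∀ {τ : Ty}, Term K Γ τ → Term K Δ τ
  | _, .var x => .var (r x)
  | _, .cst c => .cst c
  | _, .app s t => .app (s.rename r) (t.rename r)

def Term.subst {K : Ty → Type} {Γ Δ : List Ty} (θ : Subst K Γ Δ) :
    ∀ {τ : Ty}, Term K Γ τ → Term K Δ τ
  | _, .var x => θ x
  | _, .cst c => .cst c
  | _, .app s t => .app (s.subst θ) (t.subst θ)

/-- The extension of a substitution below a binder. -/
def Subst.lift {K : Ty → Type} {Γ Δ : List Ty} (θ : Subst K Γ Δ) (κ : Ty) :
    Subst K (κ :: Γ) (κ :: Δ)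
  | _, .here => .var .here
  | _, .there x => (θ x).rename (fun _ y => .there y)

/-- The substitution `[t/x]` for the most recently bound variable. -/
def Subst.single {K : Ty → Type} {Γ : List Ty} {κ : Ty} (t : Term K Γ κ) :
    Subst K (κ :: Γ) Γ
  | _, .here => t
  | _, .there x => .var x

/-- `s.apps θ` is the full application `s t₁ ⋯ tₙ` of `s`, where `θ` lists the arguments `tᵢ`. -/
def Term.apps {K : Ty → Type} {Γ : List Ty} :
    ∀ {τ : Ty}, Term K Γ τ → Subst K τ.args Γ → Term K Γ .base
  | .base, s, _ => s
  | .arr _ _, s, θ => (Term.app s (θ .here)).apps (fun _ x => θ (.there x))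

/-! ## The fragment MSL(ω)

Tree constructors have arbitrary simple types, all predicates have type `ι → o`. -/

/-- Goal formulas with free variables in `Γ`, over the constructor signature `Sig` and `n` monadic
predicate symbols. -/
inductive Goal (Sig : List Ty) (n : ℕ) : List Ty → Type where
  | tt {Γ : List Ty} : Goal Sig n Γ
  | atom {Γ : List Ty} (P : Fin n) (t : Term (Var Sig) Γ .base) : Goal Sig n Γ
  | and {Γ : List Ty} (G H : Goal Sig n Γ) : Goal Sig n Γ
  | ex {Γ : List Ty} (κ : Ty) (G : Goal Sig n (κ :: Γ)) : Goal Sig n Γ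

def Goal.subst {Sig : List Ty} {n : ℕ} : ∀ {Γ Δ : List Ty}, Subst (Var Sig) Γ Δ →
    Goal Sig n Γ → Goal Sig n Δ
  | _, _, _, .tt => .tt
  | _, _, θ, .atom P t => .atom P (t.subst θ)
  | _, _, θ, .and G H => .and (G.subst θ) (H.subst θ)
  | _, _, θ, .ex κ G => .ex κ (G.subst (θ.lift κ))

/-- Definite clauses: `∀ y. G ⇒ P y` and `∀ y₁ … yₘ. G ⇒ P (c y₁ ⋯ yₘ)` (shallow, linear heads;
the variables of the body `G` are the variables of the head). -/
inductive Clause (Sig : List Ty) (n : ℕ) : Type where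
  | var (P : Fin n) (body : Goal Sig n [.base]) : Clause Sig n
  | con (P : Fin n) {τ : Ty} (c : Var Sig τ) (body : Goal Sig n τ.args) : Clause Sig n

/-- An instance: the signatures, a definite formula (a finite conjunction of definite clauses), and
a closed goal formula. -/
structure Instance where
  sig : List Ty
  preds : ℕ
  clauses : List (Clause sig preds)
  goal : Goal sig preds []

/-- The proof system: `Provable D G` is `D ⊢ G`, for closed goals `G`. -/
inductive Provable {Sig : List Ty} {n : ℕ} (D : List (Clause Sig n)) : Goal Sig n [] → Prop where
  | tt : Provable D .tt
  | and {G H : Goal Sig n []} : Provable D G → Provable D H → Provable D (.and G H)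
  | ex {κ : Ty} {G : Goal Sig n [κ]} (t : Term (Var Sig) [] κ) :
      Provable D (G.subst (Subst.single t)) → Provable D (.ex κ G)
  | resVar {P : Fin n} {G : Goal Sig n [.base]} (s : Term (Var Sig) [] .base) :
      Clause.var P G ∈ D → Provable D (G.subst (Subst.single s)) → Provable D (.atom P s)
  | resCon {P : Fin n} {τ : Ty} {c : Var Sig τ} {G : Goal Sig n τ.args}
      (θ : Subst (Var Sig) τ.args []) :
      Clause.con P c G ∈ D → Provable D (G.subst θ) →
        Provable D (.atom P ((Term.cst c).apps θ))

/-! ### Standard semantics -/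

/-- Interpretation of types over a domain of individuals, with full function spaces. -/
abbrev Ty.sem (A : Type) : Ty → Type
  | .base => A
  | .arr a b => a.sem A → b.sem A

/-- Assignments of semantic values to the symbols of a signature or the variables of a context. -/
abbrev Env (A : Type) (Γ : List Ty) : Type := ∀ ⦃τ : Ty⦄, Var Γ τ → τ.sem A

def Env.cons {A : Type} {Γ : List Ty} {κ : Ty} (d : κ.sem A) (e : Env A Γ) : Env A (κ :: Γ)
  | _, .here => d
  | _, .there x => e x

/-- The empty assignment. -/
def Env.nil {A : Type} : Env A [] := fun _ x => nomatch x

def Term.eval {A : Type} {Sig Γ : List Ty} (I : Env A Sig) (e : Env A Γ) :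
    ∀ {τ : Ty}, Term (Var Sig) Γ τ → τ.sem A
  | _, .var x => e x
  | _, .cst c => I c
  | _, .app s t => (s.eval I e) (t.eval I e)

def Goal.Holds {A : Type} {Sig : List Ty} {n : ℕ} (I : Env A Sig) (α : Fin n → A → Prop) :
    ∀ {Γ : List Ty}, Env A Γ → Goal Sig n Γ → Prop
  | _, _, .tt => True
  | _, e, .atom P t => α P (t.eval I e)
  | _, e, .and G H => G.Holds I α e ∧ H.Holds I α e
  | _, e, .ex κ G => ∃ d : κ.sem A, G.Holds I α (Env.cons d e)

/-- Full application of a semantic value to semantic arguments. -/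
def semApps {A : Type} : ∀ {τ : Ty}, τ.sem A → Env A τ.args → A
  | .base, f, _ => f
  | .arr _ _, f, e => semApps (f (e .here)) (fun _ x => e (.there x))

def Clause.Holds {A : Type} {Sig : List Ty} {n : ℕ} (I : Env A Sig) (α : Fin n → A → Prop) :
    Clause Sig n → Prop
  | .var P G => ∀ d : A, G.Holds I α (Env.cons (κ := .base) d Env.nil) → α P d
  | .con (τ := τ) P c G => ∀ e : Env A τ.args, G.Holds I α e → α P (semApps (I c) e)

/-- `D ⊨ G`: every model of `D` satisfies `G`. -/
def Entails {Sig : List Ty} {n : ℕ} (D : List (Clause Sig n)) (G : Goal Sig n []) : Prop :=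
  ∀ (A : Type) [Nonempty A] (I : Env A Sig) (α : Fin n → A → Prop),
    (∀ C ∈ D, C.Holds I α) → G.Holds I α Env.nil

def Goal.ExistentialFree {Sig : List Ty} {n : ℕ} : ∀ {Γ : List Ty}, Goal Sig n Γ → Prop
  | _, .tt => True
  | _, .atom _ _ => True
  | _, .and G H => G.ExistentialFree ∧ H.ExistentialFree
  | _, .ex _ _ => False

def Clause.ExistentialFree {Sig : List Ty} {n : ℕ} : Clause Sig n → Prop
  | .var _ G => G.ExistentialFree
  | .con _ _ G => G.ExistentialFree

def Instance.ExistentialFree (X : Instance) : Prop :=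
  (∀ C ∈ X.clauses, C.ExistentialFree) ∧ X.goal.ExistentialFree

/-! ## Higher-order recursion schemes and trivial automata -/

/-- The type `base → ⋯ → base → base` of a terminal of rank `n`. -/
def rankTy : ℕ → Ty
  | 0 => .base
  | n + 1 => .arr .base (rankTy n)

/-- Symbols of a recursion scheme whose terminals have the given ranks and whose nonterminals have
the types `nts`. -/
inductive Symb (ranks : List ℕ) (nts : List Ty) (τ : Ty) : Type where
  | terminal (a : Fin ranks.length) (h : rankTy (ranks.get a) = τ) : Symb ranks nts τ
  | nonterminal (F : Var nts τ) : Symb ranks nts τ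

/-- Higher-order recursion schemes: for every nonterminal `F` one rule `F x₁ ⋯ xₙ → t`, where `t` is
an applicative term of base type over `x₁, …, xₙ`. -/
structure HORS where
  ranks : List ℕ
  nts : List Ty
  start : Var nts .base
  rules : ∀ ⦃τ : Ty⦄, Var nts τ → Term (Symb ranks nts) τ.args .base

/-- Closed terms of base type over the symbols of a recursion scheme. -/
abbrev HORS.Tm (𝒢 : HORS) : Type := Term (Symb 𝒢.ranks 𝒢.nts) [] .base

/-- `F t₁ ⋯ tₙ → t[t₁/x₁, …, tₙ/xₙ]`. -/
inductive HORS.HeadStep (𝒢 : HORS) : 𝒢.Tm → 𝒢.Tm → Prop where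
  | rule {τ : Ty} (F : Var 𝒢.nts τ) (θ : Subst (Symb 𝒢.ranks 𝒢.nts) τ.args []) :
      HeadStep 𝒢 ((Term.cst (.nonterminal F)).apps θ) ((𝒢.rules F).subst θ)

/-- Full application of a term whose type is that of a terminal of rank `n`. -/
def rankApps {K : Ty → Type} {Γ : List Ty} :
    ∀ {n : ℕ}, Term K Γ (rankTy n) → (Fin n → Term K Γ .base) → Term K Γ .base
  | 0, s, _ => s
  | _ + 1, s, f => rankApps (Term.app s (f 0)) (fun i => f i.succ)

/-- The term `a t₀ ⋯ tₙ₋₁` for a terminal `a`. -/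
def HORS.node (𝒢 : HORS) (a : Fin 𝒢.ranks.length) (f : Fin (𝒢.ranks.get a) → 𝒢.Tm) : 𝒢.Tm :=
  rankApps (Term.cst (.terminal a rfl)) f

/-- `𝒢.Label t p a`: the (possibly infinite) tree generated by `t` has at the position `p` a node
labelled with the terminal `a`.  Positions are read from the root, and children are numbered from
`0`.  Positions at which the reduction never exposes a terminal are `⊥`-leaves of the tree. -/
inductive HORS.Label (𝒢 : HORS) : 𝒢.Tm → List ℕ → Fin 𝒢.ranks.length → Prop where
  | root (a : Fin 𝒢.ranks.length) (f : Fin (𝒢.ranks.get a) → 𝒢.Tm) :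
      Label 𝒢 (𝒢.node a f) [] a
  | child {b : Fin 𝒢.ranks.length} {p : List ℕ} (a : Fin 𝒢.ranks.length)
      (f : Fin (𝒢.ranks.get a) → 𝒢.Tm) (i : Fin (𝒢.ranks.get a)) :
      Label 𝒢 (f i) p b → Label 𝒢 (𝒢.node a f) (i.val :: p) b
  | step {s t : 𝒢.Tm} {p : List ℕ} {b : Fin 𝒢.ranks.length} :
      𝒢.HeadStep s t → Label 𝒢 t p b → Label 𝒢 s p b

/-- A transition `(q, a, q₀ ⋯ qₙ₋₁)`, where `n` is the rank of `a`. -/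
structure Transition (ranks : List ℕ) (m : ℕ) where
  state : Fin m
  letter : Fin ranks.length
  succ : Fin (ranks.get letter) → Fin m

/-- A recursion scheme with a (nondeterministic, top-down) tree automaton with trivial acceptance
condition over the terminals of the scheme. -/
structure ModelCheckingInstance where
  hors : HORS
  states : ℕ
  init : Fin states
  trans : List (Transition hors.ranks states)

/-- The value tree of the scheme has a run of the automaton.  As usual, the undefined leaf `⊥` is
accepted from every state; every infinite run is accepting. -/
def ModelCheckingInstance.Accepts (X : ModelCheckingInstance) : Prop :=
  ∃ run : List ℕ → Fin X.states, run [] = X.init ∧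
    ∀ (p : List ℕ) (a : Fin X.hors.ranks.length),
      X.hors.Label (.cst (.nonterminal X.hors.start)) p a →
        ∃ δ ∈ X.trans, δ.state = run p ∧
          ∃ h : δ.letter = a, ∀ i : Fin (X.hors.ranks.get a),
            run (p ++ [i.val]) = δ.succ (h ▸ i)

/-! ## Intersection types -/

/-- Strict intersection types over the states `Q` refining a simple type: states refine the base
type, and `⋀ S → θ` refines `a → b`, where the intersection `⋀ S` is given by the set `S` of its
members.  If `Q` is finite, then so are the types refining a given simple type, so every
intersection is a finite one. -/
abbrev ITy (Q : Type) : Ty → Type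
  | .base => Q
  | .arr a b => Set (ITy Q a) × ITy Q b

/-- Subtyping, contravariant in the argument; `⋀ S ≤ ⋀ T` if every member of `T` has a subtype
in `S`. -/
def ITy.Sub {Q : Type} : ∀ {τ : Ty}, ITy Q τ → ITy Q τ → Prop
  | .base, q, q' => q = q'
  | .arr _ _, (S, θ), (S', θ') => (∀ y ∈ S, ∃ x ∈ S', ITy.Sub x y) ∧ ITy.Sub θ θ'

/-- The argument intersections `⋀ S₁, …, ⋀ Sₙ` of `⋀ S₁ → ⋯ → ⋀ Sₙ → q`. -/
def ITy.params {Q : Type} : ∀ {τ : Ty}, ITy Q τ → ∀ ⦃σ : Ty⦄, Var τ.args σ → Set (ITy Q σ)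
  | .base, _, _, x => nomatch x
  | .arr _ _, (S, _), _, .here => S
  | .arr _ _, (_, θ), _, .there x => ITy.params θ x

/-- The state `q` in `⋀ S₁ → ⋯ → ⋀ Sₙ → q`. -/
def ITy.target {Q : Type} : ∀ {τ : Ty}, ITy Q τ → Q
  | .base, q => q
  | .arr _ _, (_, θ) => ITy.target θ

/-- The type `q₀ → ⋯ → qₙ₋₁ → q`. -/
def ITy.ofTransition {Q : Type} (q : Q) : ∀ {n : ℕ}, (Fin n → Q) → ITy Q (rankTy n)
  | 0, _ => q
  | _ + 1, f => ({f 0}, ITy.ofTransition q (fun i => f i.succ))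

/-- Assignments of intersections to variables or nonterminals. -/
abbrev TyEnv (Q : Type) (Γ : List Ty) : Type := ∀ ⦃τ : Ty⦄, Var Γ τ → Set (ITy Q τ)

/-- The typing judgement `E, e ⊢ t : θ`, with the assignment `E` for the nonterminals and `e` for
the free variables of `t`; the types of the terminals are given by the transitions. -/
inductive ModelCheckingInstance.HasType (X : ModelCheckingInstance)
    (E : TyEnv (Fin X.states) X.hors.nts) {Γ : List Ty} (e : TyEnv (Fin X.states) Γ) :
    ∀ {τ : Ty}, Term (Symb X.hors.ranks X.hors.nts) Γ τ → ITy (Fin X.states) τ → Prop where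
  | var {τ : Ty} {x : Var Γ τ} {θ : ITy (Fin X.states) τ} :
      θ ∈ e x → HasType X E e (.var x) θ
  | nonterminal {τ : Ty} {F : Var X.hors.nts τ} {θ : ITy (Fin X.states) τ} :
      θ ∈ E F → HasType X E e (.cst (.nonterminal F)) θ
  | terminal {τ : Ty} (δ : Transition X.hors.ranks X.states)
      (h : rankTy (X.hors.ranks.get δ.letter) = τ) :
      δ ∈ X.trans →
        HasType X E e (.cst (.terminal δ.letter h)) (h ▸ ITy.ofTransition δ.state δ.succ)
  | app {σ τ : Ty} {s : Term (Symb X.hors.ranks X.hors.nts) Γ (.arr σ τ)}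
      {t : Term (Symb X.hors.ranks X.hors.nts) Γ σ}
      {S : Set (ITy (Fin X.states) σ)} {θ : ITy (Fin X.states) τ}
      (S' : Set (ITy (Fin X.states) σ)) :
      HasType X E e s (S, θ) →
        (∀ x ∈ S', HasType X E e t x) → (∀ y ∈ S, ∃ x ∈ S', ITy.Sub x y) →
          HasType X E e (.app s t) θ

/-- The scheme is typeable: there is an assignment of intersections to the nonterminals that is
consistent (every type assigned to `F` is a type of the right-hand side of the rule for `F`) and
that assigns the initial state to the start symbol. -/
def ModelCheckingInstance.Typeable (X : ModelCheckingInstance) : Prop :=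
  ∃ E : TyEnv (Fin X.states) X.hors.nts,
    (∀ ⦃τ : Ty⦄ (F : Var X.hors.nts τ), ∀ θ ∈ E F,
      X.HasType E (ITy.params θ) (X.hors.rules F) (ITy.target θ)) ∧
    X.init ∈ E X.hors.start

/-! ## Polynomial time

Data are binary trees; programs are the programs of a structured `while`-language on a single
tree-valued store.  Costs charge for copying, so that the size of every value that is computed is
bounded by the cost of its computation. -/

/-- Binary trees, the data on which programs operate. -/
inductive Data : Type where
  | nil : Data
  | cons : Data → Data → Data

def Data.size : Data → ℕ
  | .nil => 1
  | .cons x y => x.size + y.size + 1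

inductive Prog : Type where
  | id : Prog
  | nil : Prog
  | fst : Prog
  | snd : Prog
  | pair (p q : Prog) : Prog
  | seq (p q : Prog) : Prog
  | cond (c p q : Prog) : Prog
  | loop (c p : Prog) : Prog

/-- `Runs p x y t`: the program `p`, started on `x`, terminates with the output `y` and cost `t`.
The tree `nil` is read as false, and every other tree as true; `loop c p` iterates `p` as long as
`c` evaluates to true. -/
inductive Runs : Prog → Data → Data → ℕ → Prop where
  | id (x : Data) : Runs .id x x (x.size + 1)
  | nil (x : Data) : Runs .nil x .nil 1
  | fstNil : Runs .fst .nil .nil 1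
  | fstCons (x y : Data) : Runs .fst (.cons x y) x ((Data.cons x y).size + 1)
  | sndNil : Runs .snd .nil .nil 1
  | sndCons (x y : Data) : Runs .snd (.cons x y) y ((Data.cons x y).size + 1)
  | pair {p q : Prog} {x y z : Data} {t u : ℕ} :
      Runs p x y t → Runs q x z u → Runs (.pair p q) x (.cons y z) (t + u + 1)
  | seq {p q : Prog} {x y z : Data} {t u : ℕ} :
      Runs p x y t → Runs q y z u → Runs (.seq p q) x z (t + u + 1)
  | condTrue {c p q : Prog} {x a b y : Data} {t u : ℕ} :
      Runs c x (.cons a b) t → Runs p x y u → Runs (.cond c p q) x y (t + u + 1)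
  | condFalse {c p q : Prog} {x y : Data} {t u : ℕ} :
      Runs c x .nil t → Runs q x y u → Runs (.cond c p q) x y (t + u + 1)
  | loopStop {c p : Prog} {x : Data} {t : ℕ} :
      Runs c x .nil t → Runs (.loop c p) x x (t + x.size + 1)
  | loopStep {c p : Prog} {x a b y z : Data} {t u v : ℕ} :
      Runs c x (.cons a b) t → Runs p x y u → Runs (.loop c p) y z v →
        Runs (.loop c p) x z (t + u + v + 1)

/-- A decision problem: its instances, their encoding as data, and the set of yes-instances. -/
structure Problem where
  Inst : Type
  enc : Inst → Data
  Yes : Inst → Prop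

/-- Polynomial-time many-one reducibility. -/
def PolyReduces (A B : Problem) : Prop :=
  ∃ f : A.Inst → B.Inst, (∀ X, A.Yes X ↔ B.Yes (f X)) ∧
    ∃ (p : Prog) (b : Polynomial ℕ), ∀ X, ∃ t ≤ b.eval (A.enc X).size,
      Runs p (A.enc X) (B.enc (f X)) t

/-! ### Encodings -/

/-- Numbers are encoded in unary. -/
def encNat : ℕ → Data
  | 0 => .nil
  | n + 1 => .cons .nil (encNat n)

def encList : List Data → Data
  | [] => .nil
  | x :: l => .cons x (encList l)

def encTy : Ty → Data
  | .base => .nil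
  | .arr a b => .cons (encTy a) (encTy b)

/-- The index of a variable or symbol. -/
def Var.index : ∀ {Γ : List Ty} {τ : Ty}, Var Γ τ → ℕ
  | _, _, .here => 0
  | _, _, .there x => x.index + 1

def encTerm {K : Ty → Type} (encK : ∀ ⦃τ : Ty⦄, K τ → Data) {Γ : List Ty} :
    ∀ {τ : Ty}, Term K Γ τ → Data
  | _, .var x => .cons (encNat 0) (encNat x.index)
  | _, .cst c => .cons (encNat 1) (encK c)
  | _, .app s t => .cons (encNat 2) (.cons (encTerm encK s) (encTerm encK t))

def encGoal {Sig : List Ty} {n : ℕ} : ∀ {Γ : List Ty}, Goal Sig n Γ → Data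
  | _, .tt => .cons (encNat 0) .nil
  | _, .atom P t =>
      .cons (encNat 1) (.cons (encNat P) (encTerm (fun _ c => encNat c.index) t))
  | _, .and G H => .cons (encNat 2) (.cons (encGoal G) (encGoal H))
  | _, .ex κ G => .cons (encNat 3) (.cons (encTy κ) (encGoal G))

def encClause {Sig : List Ty} {n : ℕ} : Clause Sig n → Data
  | .var P G => .cons (encNat 0) (.cons (encNat P) (encGoal G))
  | .con P c G =>
      .cons (encNat 1) (.cons (encNat P) (.cons (encNat c.index) (encGoal G)))

def Instance.enc (X : Instance) : Data :=
  .cons (encList (X.sig.map encTy)) (.cons (encNat X.preds)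
    (.cons (encList (X.clauses.map encClause)) (encGoal X.goal)))

def encSymb {ranks : List ℕ} {nts : List Ty} ⦃τ : Ty⦄ : Symb ranks nts τ → Data
  | .terminal a _ => .cons (encNat 0) (encNat a)
  | .nonterminal F => .cons (encNat 1) (encNat F.index)

/-- The list of the values of a function on all positions of a list of types. -/
def tabulate {α : Type} : ∀ Γ : List Ty, (∀ ⦃τ : Ty⦄, Var Γ τ → α) → List α
  | [], _ => []
  | _ :: Γ, f => f .here :: tabulate Γ (fun _ x => f (.there x))

def HORS.enc (𝒢 : HORS) : Data :=
  .cons (encList (𝒢.ranks.map encNat)) (.cons (encList (𝒢.nts.map encTy))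
    (.cons (encNat 𝒢.start.index)
      (encList (tabulate 𝒢.nts (fun _ F => encTerm encSymb (𝒢.rules F))))))

def Transition.enc {ranks : List ℕ} {m : ℕ} (δ : Transition ranks m) : Data :=
  .cons (encNat δ.state) (.cons (encNat δ.letter)
    (encList (List.ofFn (fun i => encNat (δ.succ i)))))

def ModelCheckingInstance.enc (X : ModelCheckingInstance) : Data :=
  .cons X.hors.enc (.cons (encNat X.states) (.cons (encNat X.init)
    (encList (X.trans.map Transition.enc))))

/-! ## The decision problems -/

/-- MSL(ω) satisfiability in its proof-theoretic form: is `G` not provable from `D`?  Existential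
quantifiers (over individuals and over constructor types of every order) are allowed. -/
def mslUnprovability : Problem where
  Inst := Instance
  enc := Instance.enc
  Yes X := ¬ Provable X.clauses X.goal

/-- Satisfiability of existential-free MSL(ω) in the standard semantics: is there a model of `D`
in which `G` is false? -/
def mslSatisfiability : Problem where
  Inst := {X : Instance // X.ExistentialFree}
  enc X := X.1.enc
  Yes X := ¬ Entails X.1.clauses X.1.goal

/-- HORS (safety) model checking. -/
def horsModelChecking : Problem where
  Inst := ModelCheckingInstance
  enc := ModelCheckingInstance.enc
  Yes := ModelCheckingInstance.Accepts

/-- Intersection typeability of recursion schemes. -/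
def intersectionTypeability : Problem where
  Inst := ModelCheckingInstance
  enc := ModelCheckingInstance.enc
  Yes := ModelCheckingInstance.Typeable

end MSL

/-!
All four problems are shown to be equivalent by a cycle of reductions through MSL(ω) unprovability,
HORS model checking, intersection typeability and existential-free MSL(ω) satisfiability.

Model checking and typeability have the same instances and the same answers
(`ModelCheckingInstance.typeable_iff_accepts`), so the identity reduces each to the other. Both are
compared with the absence of a finite rejection: `X.Rejects q t` says that after finitely many
evaluation steps every transition for `q` is refuted on a child of the root of the tree of `t`. By
compactness an automaton with trivial acceptance condition either rejects in this sense or has a run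
(`ModelCheckingInstance.accepts_iff`).

For existential-free formulas, semantic entailment is provability (`entails_iff_provable`), so
satisfiability reduces to unprovability by inclusion. The countermodel for an unprovable goal has
closed terms as its elements, but also full function spaces, in which a closed term of higher type
cannot serve as its own denotation. Each such term is instead represented by a function
(`Represents`, a logical relation), whose value is an additional constant, of which all predicates
are true, as soon as one of its arguments represents no closed term. Additional constants of all
types ensure that a function represents at most one term.

Model checking reduces to existential-free satisfiability because rejection is a least fixed point.
In `ModelCheckingInstance.toMSL` the terminals and nonterminals are constructors. A predicate for
every state `q` expresses that `q` rejects a tree, a further predicate for every transition expresses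
that this transition fails, and the clauses unfold the rules of the scheme and of the automaton. The
formula proves the goal if and only if the initial state rejects the value tree.

Conversely, in `Instance.toModelChecking` a derivation in MSL(ω) becomes a finite rejection by one
automaton. A constructor becomes a nonterminal whose tree lists the bodies of the clauses for this
constructor, each labelled with its predicate; a goal becomes a nonterminal that takes the values of
the free variables as arguments. Divergence (`⊥`) stands for failure. An existential quantifier over
the type `κ` is a disjunction over all closed terms of type `κ`, which are generated by mutually
recursive nonterminals. The enumeration needs the types of partial applications of constructors
only, since every closed term is such an application (`Instance.suffixes_subset_spine`).
The arguments `Provable.rej` and `Instance.RejIn.provable` show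
that goals are provable if and only if their trees are rejected.

Both constructions are carried out on encodings by functions on binary trees. The class `PolyTime` of
polynomial-time functions is closed under composition and under a form of bounded recursion
(`PolyTime.recursion`), in which the values of the recursive calls may only be increased by a
polynomial in the size of the argument.
-/

namespace MSL

/-! ### Substitution and the Herbrand semantics of goals -/

section Terms

variable {K K' : Ty → Type}

/-- The extension of a closed substitution by a term for a new first variable. -/
def Subst.cons {Γ Δ : List Ty} {κ : Ty} (t : Term K Δ κ) (θ : Subst K Γ Δ) :
    Subst K (κ :: Γ) Δ
  | _, .here => t
  | _, .there x => θ x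

/-- The empty substitution. -/
def Subst.nil {Δ : List Ty} : Subst K [] Δ := fun _ x => nomatch x

/-- Composition of substitutions. -/
def Subst.comp {Γ Δ Ξ : List Ty} (σ : Subst K Γ Δ) (θ : Subst K Δ Ξ) : Subst K Γ Ξ :=
  fun _ x => (σ x).subst θ

/-- Two substitutions for the variables of the empty context agree. -/
theorem Subst.nil_unique {Δ : List Ty} (θ θ' : Subst K [] Δ) : θ = θ' := by
  funext τ x; nomatch x

theorem Subst.cons_eta {Γ Δ : List Ty} {κ : Ty} (θ : Subst K (κ :: Γ) Δ) :
    Subst.cons (θ .here) (fun _ x => θ (.there x)) = θ := by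
  funext τ x; cases x <;> rfl

theorem Subst.single_eq_cons {κ : Ty} (t : Term K [] κ) (θ : Subst K [] []) :
    Subst.single t = Subst.cons t θ := by
  funext τ x
  cases x with
  | here => rfl
  | there x => nomatch x

theorem Term.subst_var {Γ : List Ty} {τ : Ty} (t : Term K Γ τ) :
    t.subst (fun _ x => .var x) = t := by
  induction t with
  | var x => rfl
  | cst c => rfl
  | app s t hs ht => simp [Term.subst, hs, ht]

/-- A closed term is not changed by substitution. -/
theorem Term.subst_closed {τ : Ty} (t : Term K [] τ) (θ : Subst K [] []) : t.subst θ = t := by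
  rw [Subst.nil_unique θ (fun _ x => .var x), Term.subst_var]

theorem Term.subst_rename {Γ Δ Ξ : List Ty} (r : ∀ ⦃τ : Ty⦄, Var Γ τ → Var Δ τ)
    (θ : Subst K Δ Ξ) {τ : Ty} (t : Term K Γ τ) :
    (t.rename r).subst θ = t.subst (fun _ x => θ (r x)) := by
  induction t with
  | var x => rfl
  | cst c => rfl
  | app s t hs ht => simp [Term.subst, Term.rename, hs, ht]

theorem Term.rename_subst {Γ Δ Ξ : List Ty} (r : ∀ ⦃τ : Ty⦄, Var Δ τ → Var Ξ τ)
    (θ : Subst K Γ Δ) {τ : Ty} (t : Term K Γ τ) :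
    (t.subst θ).rename r = t.subst (fun _ x => (θ x).rename r) := by
  induction t with
  | var x => rfl
  | cst c => rfl
  | app s t hs ht => simp [Term.subst, Term.rename, hs, ht]

theorem Term.subst_subst {Γ Δ Ξ : List Ty} (σ : Subst K Γ Δ) (θ : Subst K Δ Ξ) {τ : Ty}
    (t : Term K Γ τ) : (t.subst σ).subst θ = t.subst (σ.comp θ) := by
  induction t with
  | var x => rfl
  | cst c => rfl
  | app s t hs ht => simp [Term.subst, hs, ht]

theorem Subst.lift_comp_lift {Γ Δ Ξ : List Ty} (σ : Subst K Γ Δ) (θ : Subst K Δ Ξ) (κ : Ty) :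
    (σ.lift κ).comp (θ.lift κ) = (σ.comp θ).lift κ := by
  funext τ x
  cases x with
  | here => rfl
  | there x => simp [Subst.comp, Subst.lift, Term.subst_rename, Term.rename_subst]

theorem Subst.lift_comp_cons {Γ Δ Ξ : List Ty} (σ : Subst K Γ Δ) (θ : Subst K Δ Ξ) {κ : Ty}
    (t : Term K Ξ κ) : (σ.lift κ).comp (Subst.cons t θ) = Subst.cons t (σ.comp θ) := by
  funext τ x
  cases x with
  | here => rfl
  | there x => simp [Subst.comp, Subst.lift, Term.subst_rename, Subst.cons]

theorem Term.subst_apps {Γ Δ : List Ty} (σ : Subst K Γ Δ) :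
    ∀ {τ : Ty} (s : Term K Γ τ) (θ : Subst K τ.args Γ),
      (s.apps θ).subst σ = (s.subst σ).apps (θ.comp σ)
  | .base, _, _ => rfl
  | .arr _ _, s, θ => Term.subst_apps σ (Term.app s (θ .here)) (fun _ x => θ (.there x))

/-- Replacement of the constants of a term. -/
def Term.mapCst (f : ∀ ⦃τ : Ty⦄, K τ → K' τ) {Γ : List Ty} :
    ∀ {τ : Ty}, Term K Γ τ → Term K' Γ τ
  | _, .var x => .var x
  | _, .cst c => .cst (f c)
  | _, .app s t => .app (s.mapCst f) (t.mapCst f)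

/-- Replacement of the constants in all terms of a substitution. -/
def Subst.mapCst (f : ∀ ⦃τ : Ty⦄, K τ → K' τ) {Γ Δ : List Ty} (θ : Subst K Γ Δ) :
    Subst K' Γ Δ :=
  fun _ x => (θ x).mapCst f

theorem Term.mapCst_subst (f : ∀ ⦃τ : Ty⦄, K τ → K' τ) {Γ Δ : List Ty} (θ : Subst K Γ Δ)
    {τ : Ty} (t : Term K Γ τ) : (t.subst θ).mapCst f = (t.mapCst f).subst (θ.mapCst f) := by
  induction t with
  | var x => rfl
  | cst c => rfl
  | app s t hs ht => simp [Term.subst, Term.mapCst, hs, ht]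

theorem Term.mapCst_apps (f : ∀ ⦃τ : Ty⦄, K τ → K' τ) {Γ : List Ty} :
    ∀ {τ : Ty} (s : Term K Γ τ) (θ : Subst K τ.args Γ),
      (s.apps θ).mapCst f = (s.mapCst f).apps (θ.mapCst f)
  | .base, _, _ => rfl
  | .arr _ _, s, θ => Term.mapCst_apps f (Term.app s (θ .here)) (fun _ x => θ (.there x))

theorem Term.mapCst_leftInverse {f : ∀ ⦃τ : Ty⦄, K τ → K' τ} {g : ∀ ⦃τ : Ty⦄, K' τ → K τ}
    (h : ∀ ⦃τ : Ty⦄ (c : K τ), g (f c) = c) {Γ : List Ty} {τ : Ty} (t : Term K Γ τ) :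
    (t.mapCst f).mapCst g = t := by
  induction t with
  | var x => rfl
  | cst c => simp [Term.mapCst, h]
  | app s t hs ht => simp [Term.mapCst, hs, ht]

/-- A term whose image under a replacement of constants is a full application is a full
application itself. -/
theorem Term.exists_apps_of_mapCst_eq (f : ∀ ⦃τ : Ty⦄, K τ → K' τ) {Γ : List Ty} :
    ∀ {τ : Ty} (s : Term K' Γ τ) (θ : Subst K' τ.args Γ) (t : Term K Γ .base),
      t.mapCst f = s.apps θ → ∃ (s₀ : Term K Γ τ) (θ₀ : Subst K τ.args Γ),
        t = s₀.apps θ₀ ∧ s₀.mapCst f = s ∧ θ₀.mapCst f = θ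
  | .base, s, θ, t, h => ⟨t, Subst.nil, rfl, h, Subst.nil_unique _ _⟩
  | .arr _ _, s, θ, t, h => by
    obtain ⟨s₁, θ₁, rfl, hs, hθ⟩ := Term.exists_apps_of_mapCst_eq f
      (Term.app s (θ .here)) (fun _ x => θ (.there x)) t h
    cases s₁ with
    | var x => simp [Term.mapCst] at hs
    | cst c => simp [Term.mapCst] at hs
    | app s₀ t₀ =>
      simp only [Term.mapCst, Term.app.injEq] at hs
      obtain ⟨rfl, h1, h2⟩ := hs
      cases h1
      refine ⟨s₀, Subst.cons t₀ θ₁, rfl, rfl, ?_⟩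
      rw [← Subst.cons_eta θ, ← hθ, ← eq_of_heq h2]
      funext τ x
      cases x <;> rfl

end Terms

section Goals

variable {Sig : List Ty} {n : ℕ}

theorem Goal.subst_subst {Γ : List Ty} (G : Goal Sig n Γ) :
    ∀ {Δ Ξ : List Ty} (σ : Subst (Var Sig) Γ Δ) (θ : Subst (Var Sig) Δ Ξ),
      (G.subst σ).subst θ = G.subst (σ.comp θ) := by
  induction G with
  | tt => intros; rfl
  | atom P t => intros; simp [Goal.subst, Term.subst_subst]
  | and G H hG hH => intros; simp [Goal.subst, hG, hH]
  | ex κ G hG => intros; simp [Goal.subst, hG, Subst.lift_comp_lift]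

theorem Subst.lift_var {K : Ty → Type} (Γ : List Ty) (κ : Ty) :
    Subst.lift (K := K) (Γ := Γ) (fun _ x => .var x) κ = fun _ x => .var x := by
  funext τ x; cases x <;> rfl

theorem Goal.subst_var {Γ : List Ty} (G : Goal Sig n Γ) : G.subst (fun _ x => .var x) = G := by
  induction G with
  | tt => rfl
  | atom P t => simp [Goal.subst, Term.subst_var]
  | and G H hG hH => simp [Goal.subst, hG, hH]
  | ex κ G hG => simp [Goal.subst, hG, Subst.lift_var]

/-- `G.Sat A θ`: the instance `G θ` holds in the Herbrand interpretation `A`, in which variables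
range over closed terms. -/
def Goal.Sat (A : Fin n → Term (Var Sig) [] .base → Prop) :
    ∀ {Γ : List Ty}, Goal Sig n Γ → Subst (Var Sig) Γ [] → Prop
  | _, .tt, _ => True
  | _, .atom P t, θ => A P (t.subst θ)
  | _, .and G H, θ => G.Sat A θ ∧ H.Sat A θ
  | _, .ex κ G, θ => ∃ t : Term (Var Sig) [] κ, G.Sat A (Subst.cons t θ)

theorem Goal.sat_subst (A : Fin n → Term (Var Sig) [] .base → Prop) {Γ : List Ty}
    (G : Goal Sig n Γ) : ∀ {Δ : List Ty} (σ : Subst (Var Sig) Γ Δ) (θ : Subst (Var Sig) Δ []),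
      (G.subst σ).Sat A θ ↔ G.Sat A (σ.comp θ) := by
  induction G with
  | tt => intros; rfl
  | atom P t => intros; simp [Goal.subst, Goal.Sat, Term.subst_subst]
  | and G H hG hH => intros; simp [Goal.subst, Goal.Sat, hG, hH]
  | ex κ G hG => intros; simp [Goal.subst, Goal.Sat, hG, Subst.lift_comp_cons]

theorem Subst.comp_nil {K : Ty → Type} {Γ : List Ty} (σ : Subst K Γ []) (θ : Subst K [] []) :
    σ.comp θ = σ := by
  funext τ x; exact Term.subst_closed _ _

/-- Provable goals hold in every Herbrand model of the definite formula. -/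
theorem Provable.sat {D : List (Clause Sig n)} (A : Fin n → Term (Var Sig) [] .base → Prop)
    (hvar : ∀ P G, Clause.var P G ∈ D → ∀ s, G.Sat A (Subst.single s) → A P s)
    (hcon : ∀ P τ (c : Var Sig τ) G, Clause.con P c G ∈ D → ∀ θ : Subst (Var Sig) τ.args [],
      G.Sat A θ → A P ((Term.cst c).apps θ))
    {G : Goal Sig n []} (h : Provable D G) : G.Sat A Subst.nil := by
  induction h with
  | tt => trivial
  | and _ _ h1 h2 => exact ⟨h1, h2⟩
  | ex t _ ih =>
    rw [Goal.sat_subst, Subst.comp_nil] at ih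
    exact ⟨t, by rwa [← Subst.single_eq_cons]⟩
  | resVar s hD _ ih =>
    rw [Goal.sat_subst, Subst.comp_nil] at ih
    simpa [Goal.Sat, Term.subst_closed] using hvar _ _ hD s ih
  | resCon θ hD _ ih =>
    rw [Goal.sat_subst, Subst.comp_nil] at ih
    simpa [Goal.Sat, Term.subst_closed] using hcon _ _ _ _ hD θ ih

/-- The provable atoms form a Herbrand interpretation in which only provable goals hold. -/
theorem Goal.Sat.provable {D : List (Clause Sig n)} {Γ : List Ty} {G : Goal Sig n Γ} :
    ∀ {θ : Subst (Var Sig) Γ []}, G.Sat (fun P t => Provable D (.atom P t)) θ →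
      Provable D (G.subst θ) := by
  induction G with
  | tt => intros; exact .tt
  | atom P t => intro θ h; exact h
  | and G H hG hH => intro θ h; exact .and (hG h.1) (hH h.2)
  | ex κ G hG =>
    rintro θ ⟨t, h⟩
    refine .ex t ?_
    rw [Goal.subst_subst, Subst.single_eq_cons t Subst.nil, Subst.lift_comp_cons, Subst.comp_nil]
    exact hG h

end Goals

/-! ### Rejection by a trivial automaton -/

section Rejection

/-- The arguments of a term whose type is that of a terminal of rank `n`. -/
def rankArg {K : Ty → Type} {Γ : List Ty} :
    ∀ {n : ℕ}, Subst K (rankTy n).args Γ → Fin n → Term K Γ .base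
  | _ + 1, θ, ⟨0, _⟩ => θ .here
  | _ + 1, θ, ⟨i + 1, h⟩ => rankArg (fun _ x => θ (.there x)) ⟨i, Nat.lt_of_succ_lt_succ h⟩

/-- The list of arguments of a term whose type is that of a terminal, as a substitution. -/
def rankSubst {K : Ty → Type} {Γ : List Ty} :
    ∀ {n : ℕ}, (Fin n → Term K Γ .base) → Subst K (rankTy n).args Γ
  | 0, _ => fun _ x => nomatch x
  | _ + 1, f => Subst.cons (f 0) (rankSubst (fun i => f i.succ))

theorem rankArg_rankSubst {K : Ty → Type} {Γ : List Ty} :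
    ∀ {n : ℕ} (f : Fin n → Term K Γ .base), rankArg (rankSubst f) = f
  | 0, f => by funext i; exact i.elim0
  | n + 1, f => by
    funext i
    obtain ⟨i, h⟩ := i
    cases i with
    | zero => rfl
    | succ i =>
      exact congrFun (rankArg_rankSubst (fun i => f i.succ)) ⟨i, Nat.lt_of_succ_lt_succ h⟩

theorem rankApps_rankArg {K : Ty → Type} {Γ : List Ty} :
    ∀ {n : ℕ} (s : Term K Γ (rankTy n)) (θ : Subst K (rankTy n).args Γ),
      rankApps s (rankArg θ) = s.apps θ
  | 0, _, _ => rfl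
  | _ + 1, s, θ => rankApps_rankArg (Term.app s (θ .here)) (fun _ x => θ (.there x))

theorem rankApps_eq_apps {K : Ty → Type} {Γ : List Ty} {n : ℕ} (s : Term K Γ (rankTy n))
    (f : Fin n → Term K Γ .base) : rankApps s f = s.apps (rankSubst f) := by
  rw [← rankApps_rankArg, rankArg_rankSubst]

variable (𝒢 : HORS)

/-- One step of the evaluation of the full application of a closed term: the reduct if the head of
the term is a nonterminal, the root label and the subtrees if it is a terminal. -/
def HORS.head : ∀ {τ : Ty}, Term (Symb 𝒢.ranks 𝒢.nts) [] τ →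
    Subst (Symb 𝒢.ranks 𝒢.nts) τ.args [] →
      𝒢.Tm ⊕ (Σ a : Fin 𝒢.ranks.length, Fin (𝒢.ranks.get a) → 𝒢.Tm)
  | _, .cst (.nonterminal F), θ => .inl ((𝒢.rules F).subst θ)
  | _, .cst (.terminal a rfl), θ => .inr ⟨a, rankArg θ⟩
  | _, .app s t, θ => HORS.head s (Subst.cons t θ)

/-- One step of the evaluation of a closed term of base type. -/
def HORS.eval (t : 𝒢.Tm) : 𝒢.Tm ⊕ (Σ a : Fin 𝒢.ranks.length, Fin (𝒢.ranks.get a) → 𝒢.Tm) :=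
  𝒢.head t Subst.nil

theorem HORS.eval_apps : ∀ {τ : Ty} (s : Term (Symb 𝒢.ranks 𝒢.nts) [] τ)
    (θ : Subst (Symb 𝒢.ranks 𝒢.nts) τ.args []), 𝒢.eval (s.apps θ) = 𝒢.head s θ
  | .base, s, θ => by rw [Subst.nil_unique θ Subst.nil]; rfl
  | .arr _ _, s, θ => by
    refine (HORS.eval_apps (Term.app s (θ .here)) (fun _ x => θ (.there x))).trans ?_
    exact congrArg (𝒢.head s) (Subst.cons_eta θ)

theorem HORS.eval_nonterminal {τ : Ty} (F : Var 𝒢.nts τ)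
    (θ : Subst (Symb 𝒢.ranks 𝒢.nts) τ.args []) :
    𝒢.eval ((Term.cst (.nonterminal F)).apps θ) = .inl ((𝒢.rules F).subst θ) := by
  rw [HORS.eval_apps, HORS.head]

theorem HORS.eval_node (a : Fin 𝒢.ranks.length) (f : Fin (𝒢.ranks.get a) → 𝒢.Tm) :
    𝒢.eval (𝒢.node a f) = .inr ⟨a, f⟩ := by
  rw [HORS.node, rankApps_eq_apps, HORS.eval_apps, HORS.head, rankArg_rankSubst]

variable {𝒢}

theorem HORS.HeadStep.eval_eq {s t : 𝒢.Tm} (h : 𝒢.HeadStep s t) : 𝒢.eval s = .inl t := by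
  cases h; exact 𝒢.eval_nonterminal _ _

theorem HORS.headStep_of_head {t' : 𝒢.Tm} : ∀ {τ : Ty} (s : Term (Symb 𝒢.ranks 𝒢.nts) [] τ)
    (θ : Subst (Symb 𝒢.ranks 𝒢.nts) τ.args []), 𝒢.head s θ = .inl t' →
      𝒢.HeadStep (s.apps θ) t'
  | _, .cst (.nonterminal F), θ, h => by
    rw [HORS.head] at h; cases h; exact .rule F θ
  | _, .cst (.terminal a rfl), θ, h => by simp [HORS.head] at h
  | _, .app s t, θ, h => HORS.headStep_of_head s (Subst.cons t θ) (by rwa [HORS.head] at h)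

theorem HORS.headStep_iff {s t : 𝒢.Tm} : 𝒢.HeadStep s t ↔ 𝒢.eval s = .inl t :=
  ⟨HORS.HeadStep.eval_eq, fun h => HORS.headStep_of_head s Subst.nil h⟩

theorem HORS.apps_eq_node_of_head {a : Fin 𝒢.ranks.length} {f : Fin (𝒢.ranks.get a) → 𝒢.Tm} :
    ∀ {τ : Ty} (s : Term (Symb 𝒢.ranks 𝒢.nts) [] τ)
    (θ : Subst (Symb 𝒢.ranks 𝒢.nts) τ.args []), 𝒢.head s θ = .inr ⟨a, f⟩ →
      s.apps θ = 𝒢.node a f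
  | _, .cst (.nonterminal F), θ, h => by simp [HORS.head] at h
  | _, .cst (.terminal a rfl), θ, h => by
    rw [HORS.head] at h; cases h; exact (rankApps_rankArg _ _).symm
  | _, .app s t, θ, h => HORS.apps_eq_node_of_head s (Subst.cons t θ) (by rwa [HORS.head] at h)

theorem HORS.eq_node_iff {t : 𝒢.Tm} {a : Fin 𝒢.ranks.length}
    {f : Fin (𝒢.ranks.get a) → 𝒢.Tm} : t = 𝒢.node a f ↔ 𝒢.eval t = .inr ⟨a, f⟩ :=
  ⟨fun h => h ▸ 𝒢.eval_node a f, fun h => HORS.apps_eq_node_of_head t Subst.nil h⟩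

variable (X : ModelCheckingInstance)

/-- `X.RejectsIn N q t`: within `N` steps of evaluation it becomes evident that the automaton has no
run from the state `q` on the tree generated by `t`. -/
def ModelCheckingInstance.RejectsIn : ℕ → Fin X.states → X.hors.Tm → Prop
  | 0, _, _ => False
  | N + 1, q, t =>
    match X.hors.eval t with
    | .inl t' => RejectsIn N q t'
    | .inr ⟨a, f⟩ => ∀ δ ∈ X.trans, δ.state = q → ∀ h : δ.letter = a,
        ∃ i : Fin (X.hors.ranks.get a), RejectsIn N (δ.succ (h ▸ i)) (f i)

/-- The automaton rejects the tree generated by `t` from the state `q`. -/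
def ModelCheckingInstance.Rejects (q : Fin X.states) (t : X.hors.Tm) : Prop :=
  ∃ N, X.RejectsIn N q t

variable {X}

theorem ModelCheckingInstance.RejectsIn.succ {N : ℕ} : ∀ {q : Fin X.states} {t : X.hors.Tm},
    X.RejectsIn N q t → X.RejectsIn (N + 1) q t := by
  induction N with
  | zero => intro q t h; exact h.elim
  | succ N ih =>
    intro q t h
    rw [ModelCheckingInstance.RejectsIn] at h ⊢
    split at h
    · exact ih h
    · intro δ hδ hq ha
      obtain ⟨i, hi⟩ := h δ hδ hq ha
      exact ⟨i, ih hi⟩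

theorem ModelCheckingInstance.RejectsIn.mono {M N : ℕ} (hMN : M ≤ N) {q : Fin X.states}
    {t : X.hors.Tm} (h : X.RejectsIn M q t) : X.RejectsIn N q t := by
  induction hMN with
  | refl => exact h
  | step _ ih => exact ih.succ

theorem ModelCheckingInstance.rejectsIn_inl {N : ℕ} {q : Fin X.states} {t t' : X.hors.Tm}
    (h : X.hors.eval t = .inl t') : X.RejectsIn (N + 1) q t ↔ X.RejectsIn N q t' := by
  rw [ModelCheckingInstance.RejectsIn, h]

theorem ModelCheckingInstance.rejectsIn_inr {N : ℕ} {q : Fin X.states} {t : X.hors.Tm}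
    {a : Fin X.hors.ranks.length} {f : Fin (X.hors.ranks.get a) → X.hors.Tm}
    (h : X.hors.eval t = .inr ⟨a, f⟩) : X.RejectsIn (N + 1) q t ↔
      ∀ δ ∈ X.trans, δ.state = q → ∀ h : δ.letter = a,
        ∃ i : Fin (X.hors.ranks.get a), X.RejectsIn N (δ.succ (h ▸ i)) (f i) := by
  rw [ModelCheckingInstance.RejectsIn, h]

theorem ModelCheckingInstance.rejects_inl {q : Fin X.states} {t t' : X.hors.Tm}
    (h : X.hors.eval t = .inl t') : X.Rejects q t ↔ X.Rejects q t' := by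
  constructor
  · rintro ⟨N, hN⟩
    cases N with
    | zero => exact hN.elim
    | succ N => exact ⟨N, (rejectsIn_inl h).1 hN⟩
  · rintro ⟨N, hN⟩
    exact ⟨N + 1, (rejectsIn_inl h).2 hN⟩

/-- Since there are only finitely many transitions, the numbers of steps after which they fail have
a common bound. -/
theorem ModelCheckingInstance.rejects_inr {q : Fin X.states} {t : X.hors.Tm}
    {a : Fin X.hors.ranks.length} {f : Fin (X.hors.ranks.get a) → X.hors.Tm}
    (h : X.hors.eval t = .inr ⟨a, f⟩) : X.Rejects q t ↔
      ∀ δ ∈ X.trans, δ.state = q → ∀ h : δ.letter = a,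
        ∃ i : Fin (X.hors.ranks.get a), X.Rejects (δ.succ (h ▸ i)) (f i) := by
  constructor
  · rintro ⟨N, hN⟩ δ hδ hq ha
    cases N with
    | zero => exact hN.elim
    | succ N =>
      obtain ⟨i, hi⟩ := (rejectsIn_inr h).1 hN δ hδ hq ha
      exact ⟨i, N, hi⟩
  · intro H
    have key : ∀ᶠ N in Filter.atTop, ∀ δ ∈ {δ | δ ∈ X.trans}, δ.state = q → ∀ h : δ.letter = a,
        ∃ i : Fin (X.hors.ranks.get a), X.RejectsIn N (δ.succ (h ▸ i)) (f i) := by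
      refine (Filter.eventually_all_finite X.trans.finite_toSet).2 fun δ hδ => ?_
      by_cases hc : δ.state = q ∧ δ.letter = a
      · obtain ⟨hq, ha⟩ := hc
        obtain ⟨i, N, hN⟩ := H δ hδ hq ha
        filter_upwards [Filter.eventually_ge_atTop N] with M hM _ _
        exact ⟨i, hN.mono hM⟩
      · exact Filter.Eventually.of_forall fun N hq ha => (hc ⟨hq, ha⟩).elim
    obtain ⟨N, hN⟩ := key.exists
    exact ⟨N + 1, (rejectsIn_inr h).2 hN⟩

theorem HORS.label_of_eval {𝒢 : HORS} {s t : 𝒢.Tm} (h : 𝒢.eval s = .inl t) {p : List ℕ}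
    {b : Fin 𝒢.ranks.length} (hl : 𝒢.Label t p b) : 𝒢.Label s p b :=
  .step (HORS.headStep_iff.2 h) hl

/-- `X.IsRun q t run`: `run` is a run of the automaton on the tree of `t` from the state `q`. -/
def ModelCheckingInstance.IsRun (X : ModelCheckingInstance) (q : Fin X.states) (t : X.hors.Tm)
    (run : List ℕ → Fin X.states) : Prop :=
  run [] = q ∧ ∀ (p : List ℕ) (a : Fin X.hors.ranks.length), X.hors.Label t p a →
    ∃ δ ∈ X.trans, δ.state = run p ∧
      ∃ h : δ.letter = a, ∀ i : Fin (X.hors.ranks.get a), run (p ++ [i.val]) = δ.succ (h ▸ i)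

theorem ModelCheckingInstance.RejectsIn.not_isRun {N : ℕ} :
    ∀ {q : Fin X.states} {t : X.hors.Tm} {run : List ℕ → Fin X.states},
      X.RejectsIn N q t → ¬ X.IsRun q t run := by
  induction N with
  | zero => intro q t run h; exact h.elim
  | succ N ih =>
    intro q t run h hrun
    rcases ht : X.hors.eval t with t' | ⟨a, f⟩
    · exact ih ((rejectsIn_inl ht).1 h)
        ⟨hrun.1, fun p a hl => hrun.2 p a (HORS.label_of_eval ht hl)⟩
    · have hn := HORS.eq_node_iff.2 ht
      subst hn
      obtain ⟨δ, hδ, hs, ha, hr⟩ := hrun.2 [] a (.root a f)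
      obtain ⟨i, hi⟩ := (rejectsIn_inr ht).1 h δ hδ (hs.trans hrun.1) ha
      refine ih (run := fun p => run (i.val :: p)) hi ⟨hr i, fun p b hl => ?_⟩
      exact hrun.2 (i.val :: p) b (.child a f i hl)

/-- `𝒢.Reaches t x`: the evaluation of `t` exposes the root label and the subtrees `x`. -/
inductive HORS.Reaches (𝒢 : HORS) :
    𝒢.Tm → (Σ a : Fin 𝒢.ranks.length, Fin (𝒢.ranks.get a) → 𝒢.Tm) → Prop where
  | root {t : 𝒢.Tm} {x : Σ a : Fin 𝒢.ranks.length, Fin (𝒢.ranks.get a) → 𝒢.Tm} :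
      𝒢.eval t = .inr x → Reaches 𝒢 t x
  | step {s t : 𝒢.Tm} {x : Σ a : Fin 𝒢.ranks.length, Fin (𝒢.ranks.get a) → 𝒢.Tm} :
      𝒢.eval s = .inl t → Reaches 𝒢 t x → Reaches 𝒢 s x

theorem HORS.reaches_inl {𝒢 : HORS} {s t : 𝒢.Tm} (h : 𝒢.eval s = .inl t) :
    𝒢.Reaches s = 𝒢.Reaches t := by
  funext x
  refine propext ⟨fun hx => ?_, .step h⟩
  cases hx with
  | root h' => rw [h] at h'; cases h'
  | step h' hx => rw [h] at h'; cases h'; exact hx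

theorem HORS.reaches_inr {𝒢 : HORS} {s : 𝒢.Tm}
    {x : Σ a : Fin 𝒢.ranks.length, Fin (𝒢.ranks.get a) → 𝒢.Tm} (h : 𝒢.eval s = .inr x) :
    𝒢.Reaches s = fun y => y = x := by
  funext y
  refine propext ⟨fun hx => ?_, fun hy => hy ▸ .root h⟩
  cases hx with
  | root h' => rw [h] at h'; cases h'; rfl
  | step h' hx => rw [h] at h'; cases h'

theorem ModelCheckingInstance.rejects_of_reaches {q : Fin X.states} {t : X.hors.Tm}
    {a : Fin X.hors.ranks.length} {f : Fin (X.hors.ranks.get a) → X.hors.Tm}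
    (h : X.hors.Reaches t ⟨a, f⟩) : X.Rejects q t ↔
      ∀ δ ∈ X.trans, δ.state = q → ∀ h : δ.letter = a,
        ∃ i : Fin (X.hors.ranks.get a), X.Rejects (δ.succ (h ▸ i)) (f i) := by
  generalize hx : (⟨a, f⟩ : Σ a : Fin X.hors.ranks.length,
    Fin (X.hors.ranks.get a) → X.hors.Tm) = x at h
  induction h with
  | root h => subst hx; exact rejects_inr h
  | step h _ ih => rw [rejects_inl h, ih hx]

open Classical in
/-- A choice of states along the tree with root labels and subtrees in `R` (a set with at most one
element), which follows transitions that avoid rejection as long as there are any. -/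
noncomputable def ModelCheckingInstance.chooseRun (X : ModelCheckingInstance) :
    (List ℕ) → Fin X.states →
      ((Σ a : Fin X.hors.ranks.length, Fin (X.hors.ranks.get a) → X.hors.Tm) → Prop) →
        Fin X.states
  | [], q, _ => q
  | i :: p, q, R =>
    if h : ∃ y : Σ δ : Transition X.hors.ranks X.states,
        Fin (X.hors.ranks.get δ.letter) → X.hors.Tm, y.1 ∈ X.trans ∧ y.1.state = q ∧
          R ⟨y.1.letter, y.2⟩ ∧ ∀ i, ¬ X.Rejects (y.1.succ i) (y.2 i) then
      if hi : i < X.hors.ranks.get h.choose.1.letter then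
        X.chooseRun p (h.choose.1.succ ⟨i, hi⟩) (X.hors.Reaches (h.choose.2 ⟨i, hi⟩))
      else q
    else q

theorem ModelCheckingInstance.exists_transition {q : Fin X.states} {t : X.hors.Tm}
    {a : Fin X.hors.ranks.length} {f : Fin (X.hors.ranks.get a) → X.hors.Tm}
    (h : X.hors.Reaches t ⟨a, f⟩) (hq : ¬ X.Rejects q t) :
    ∃ y : Σ δ : Transition X.hors.ranks X.states,
      Fin (X.hors.ranks.get δ.letter) → X.hors.Tm, y.1 ∈ X.trans ∧ y.1.state = q ∧
        X.hors.Reaches t ⟨y.1.letter, y.2⟩ ∧ ∀ i, ¬ X.Rejects (y.1.succ i) (y.2 i) := by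
  rw [rejects_of_reaches h] at hq
  push Not at hq
  obtain ⟨δ, hδ, hs, rfl, hr⟩ := hq
  exact ⟨⟨δ, f⟩, hδ, hs, h, hr⟩

theorem ModelCheckingInstance.chooseRun_isRun {t : X.hors.Tm} {p : List ℕ}
    {a : Fin X.hors.ranks.length} (hl : X.hors.Label t p a) :
    ∀ {q : Fin X.states}, ¬ X.Rejects q t →
      ∃ δ ∈ X.trans, δ.state = X.chooseRun p q (X.hors.Reaches t) ∧
        ∃ h : δ.letter = a, ∀ i : Fin (X.hors.ranks.get a),
          X.chooseRun (p ++ [i.val]) q (X.hors.Reaches t) = δ.succ (h ▸ i) := by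
  induction hl with
  | root a f =>
    intro q hq
    have hx := X.hors.eval_node a f
    have h := exists_transition (.root hx) hq
    have hs := h.choose_spec
    refine ⟨h.choose.1, hs.1, hs.2.1, ?_⟩
    have hR := (congrFun (HORS.reaches_inr hx) _).mp hs.2.2.1
    have ha : h.choose.1.letter = a := congrArg Sigma.fst hR
    refine ⟨ha, fun i => ?_⟩
    have hi : i.val < X.hors.ranks.get h.choose.1.letter := by rw [ha]; exact i.2
    rw [List.nil_append, chooseRun, dif_pos h, dif_pos hi, chooseRun]
    congr 1
    have gen : ∀ (b : Fin X.hors.ranks.length) (e : b = a)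
        (hi : i.val < X.hors.ranks.get b), (⟨i.val, hi⟩ : Fin (X.hors.ranks.get b)) = e ▸ i := by
      intro b e hi; subst e; rfl
    exact gen _ ha hi
  | @child b p a f i _ ih =>
    intro q hq
    have hx := X.hors.eval_node a f
    have h := exists_transition (.root hx) hq
    have hs := h.choose_spec
    have hR := (congrFun (HORS.reaches_inr hx) _).mp hs.2.2.1
    have ha : h.choose.1.letter = a := congrArg Sigma.fst hR
    have hi : i.val < X.hors.ranks.get h.choose.1.letter := by rw [ha]; exact i.2
    have hc : ∀ p', X.chooseRun (i.val :: p') q (X.hors.Reaches (X.hors.node a f)) =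
        X.chooseRun p' (h.choose.1.succ ⟨i, hi⟩) (X.hors.Reaches (h.choose.2 ⟨i, hi⟩)) := by
      intro p'
      rw [chooseRun, dif_pos h, dif_pos hi]
    have hf : h.choose.2 ⟨i, hi⟩ = f i := by
      have gen : ∀ (y : Σ a : Fin X.hors.ranks.length, Fin (X.hors.ranks.get a) → X.hors.Tm)
          (_ : y = ⟨a, f⟩) (hi : i.val < X.hors.ranks.get y.1), y.2 ⟨i, hi⟩ = f i := by
        rintro _ rfl hi; rfl
      exact gen _ hR hi
    simp only [List.cons_append, hc]
    rw [hf]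
    exact ih (hf ▸ hs.2.2.2 ⟨i, hi⟩)
  | step hst _ ih =>
    intro q hq
    have he := hst.eval_eq
    rw [HORS.reaches_inl he]
    exact ih (by rwa [rejects_inl he] at hq)

/-- The value tree is accepted if and only if it is not rejected from the initial state: rejection
is the least fixed point whose complement is acceptance, and a run is chosen node by node. -/
theorem ModelCheckingInstance.accepts_iff :
    X.Accepts ↔ ¬ X.Rejects X.init (.cst (.nonterminal X.hors.start)) := by
  constructor
  · rintro ⟨run, h⟩ ⟨N, hN⟩
    exact hN.not_isRun h
  · intro h
    exact ⟨fun p => X.chooseRun p X.init (X.hors.Reaches _), rfl, fun p a hl =>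
      chooseRun_isRun hl h⟩

end Rejection

/-! ### Intersection typeability and acceptance -/

section Typing

theorem ITy.Sub.refl {Q : Type} : ∀ {τ : Ty} (θ : ITy Q τ), ITy.Sub θ θ
  | .base, _ => rfl
  | .arr _ _, (_, θ) => ⟨fun y hy => ⟨y, hy, ITy.Sub.refl y⟩, ITy.Sub.refl θ⟩

theorem ITy.Sub.trans {Q : Type} : ∀ {τ : Ty} {θ₁ θ₂ θ₃ : ITy Q τ},
    ITy.Sub θ₁ θ₂ → ITy.Sub θ₂ θ₃ → ITy.Sub θ₁ θ₃
  | .base, _, _, _, h, h' => Eq.trans h h'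
  | .arr _ _, (_, _), (_, _), (_, _), h, h' => by
    refine ⟨fun y hy => ?_, ITy.Sub.trans h.2 h'.2⟩
    obtain ⟨x, hx, hxy⟩ := h.1 y hy
    obtain ⟨z, hz, hzx⟩ := h'.1 x hx
    exact ⟨z, hz, ITy.Sub.trans hzx hxy⟩

variable {X : ModelCheckingInstance} {E : TyEnv (Fin X.states) X.hors.nts}

/-- Substitution of terms that have subtypes of the types assigned to the variables yields a
subtype. -/
theorem ModelCheckingInstance.HasType.subst {Γ Δ : List Ty} {e : TyEnv (Fin X.states) Γ}
    {e' : TyEnv (Fin X.states) Δ} {σ : Subst (Symb X.hors.ranks X.hors.nts) Γ Δ}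
    (hσ : ∀ ⦃τ : Ty⦄ (x : Var Γ τ), ∀ y ∈ e x, ∃ y', ITy.Sub y' y ∧ X.HasType E e' (σ x) y')
    {τ : Ty} {t : Term (Symb X.hors.ranks X.hors.nts) Γ τ} {θ : ITy (Fin X.states) τ}
    (h : X.HasType E e t θ) : ∃ θ', ITy.Sub θ' θ ∧ X.HasType E e' (t.subst σ) θ' := by
  induction h with
  | var hx => exact hσ _ _ hx
  | nonterminal hF => exact ⟨_, ITy.Sub.refl _, .nonterminal hF⟩
  | terminal δ h hδ => exact ⟨_, ITy.Sub.refl _, .terminal δ h hδ⟩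
  | @app a b s t S θ S' hs ht hS ihs iht =>
    obtain ⟨⟨S₁, θ₁⟩, hsub, hs₁⟩ := ihs
    refine ⟨θ₁, hsub.2, .app {x | X.HasType E e' (t.subst σ) x} hs₁ (fun _ hx => hx) ?_⟩
    intro y hy
    obtain ⟨x, hx, hxy⟩ := hsub.1 y hy
    obtain ⟨z, hz, hzx⟩ := hS x hx
    obtain ⟨w, hwz, hw⟩ := iht z hz
    exact ⟨w, hw, hwz.trans (hzx.trans hxy)⟩

theorem ModelCheckingInstance.HasType.of_apps {Γ : List Ty} {e : TyEnv (Fin X.states) Γ} :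
    ∀ {τ : Ty} (s : Term (Symb X.hors.ranks X.hors.nts) Γ τ)
      (σ : Subst (Symb X.hors.ranks X.hors.nts) τ.args Γ) (q : Fin X.states),
      X.HasType E e (s.apps σ) q → ∃ θ : ITy (Fin X.states) τ, X.HasType E e s θ ∧
        ITy.target θ = q ∧ ∀ ⦃κ : Ty⦄ (x : Var τ.args κ), ∀ y ∈ ITy.params θ x,
          ∃ y', ITy.Sub y' y ∧ X.HasType E e (σ x) y'
  | .base, s, σ, q, h => ⟨q, h, rfl, fun _ x => nomatch x⟩
  | .arr _ _, s, σ, q, h => by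
    obtain ⟨θ, hθ, ht, hp⟩ := ModelCheckingInstance.HasType.of_apps
      (Term.app s (σ .here)) (fun _ x => σ (.there x)) q h
    cases hθ with
    | @app _ _ _ _ S _ S' hs ht' hS =>
      refine ⟨(S, θ), hs, ht, fun κ x y hy => ?_⟩
      cases x with
      | here =>
        obtain ⟨x, hx, hxy⟩ := hS y hy
        exact ⟨x, hxy, ht' x hx⟩
      | there x => exact hp x y hy

theorem ITy.target_ofTransition {Q : Type} (q : Q) : ∀ {n : ℕ} (f : Fin n → Q),
    ITy.target (ITy.ofTransition q f) = q
  | 0, _ => rfl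
  | _ + 1, f => ITy.target_ofTransition q (fun i => f i.succ)

/-- In a typing of a full application of a terminal, the children have the states of a transition.
-/
theorem ModelCheckingInstance.HasType.rankArg {Γ : List Ty} {e : TyEnv (Fin X.states) Γ}
    {q : Fin X.states} : ∀ {n : ℕ} (f : Fin n → Fin X.states)
      (σ : Subst (Symb X.hors.ranks X.hors.nts) (rankTy n).args Γ),
      (∀ ⦃κ : Ty⦄ (x : Var (rankTy n).args κ), ∀ y ∈ ITy.params (ITy.ofTransition q f) x,
        ∃ y', ITy.Sub y' y ∧ X.HasType E e (σ x) y') →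
      ∀ i, X.HasType E e (MSL.rankArg σ i) (τ := .base) (f i)
  | 0, _, _, _, i => i.elim0
  | n + 1, f, σ, h, ⟨0, _⟩ => by
    obtain ⟨y', hy, ht⟩ := h .here (f 0) rfl
    cases (hy : y' = f 0)
    exact ht
  | n + 1, f, σ, h, ⟨i + 1, hi⟩ =>
    ModelCheckingInstance.HasType.rankArg (fun i => f i.succ) (fun _ x => σ (.there x))
      (fun _ x => h (.there x)) ⟨i, Nat.lt_of_succ_lt_succ hi⟩

theorem ModelCheckingInstance.RejectsIn.not_hasType
    (hE : ∀ ⦃τ : Ty⦄ (F : Var X.hors.nts τ), ∀ θ ∈ E F,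
      X.HasType E (ITy.params θ) (X.hors.rules F) (ITy.target θ))
    (e : TyEnv (Fin X.states) []) {N : ℕ} : ∀ {q : Fin X.states} {t : X.hors.Tm},
      X.RejectsIn N q t → ¬ X.HasType E e t q := by
  induction N with
  | zero => intro q t h; exact h.elim
  | succ N ih =>
    intro q t h ht
    rcases hx : X.hors.eval t with t' | ⟨a, f⟩
    · have hst := HORS.headStep_iff.2 hx
      cases hst with
      | rule F σ =>
        obtain ⟨θ, hθ, rfl, hp⟩ := ht.of_apps
        cases hθ with
        | nonterminal hF =>
          obtain ⟨q', hq, ht'⟩ := (hE F θ hF).subst hp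
          cases (hq : q' = _)
          exact ih ((rejectsIn_inl hx).1 h) ht'
    · have hn := HORS.eq_node_iff.2 hx
      subst hn
      rw [HORS.node, rankApps_eq_apps] at ht
      obtain ⟨θ, hθ, hq, hp⟩ := ht.of_apps
      cases hθ with
      | terminal δ hr hδ =>
        rw [ITy.target_ofTransition] at hq
        obtain ⟨i, hi⟩ := (rejectsIn_inr hx).1 h δ hδ hq rfl
        have := ModelCheckingInstance.HasType.rankArg _ _ hp i
        rw [rankArg_rankSubst] at this
        exact ih hi this

/-- The exact intersection types of a closed term: the states from which its tree is not rejected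
and, at an arrow type, the pairs of all types of an argument and a type of the result. -/
def ModelCheckingInstance.exactTypes (X : ModelCheckingInstance) :
    ∀ {τ : Ty}, Term (Symb X.hors.ranks X.hors.nts) [] τ → Set (ITy (Fin X.states) τ)
  | .base, t => {q | ¬ X.Rejects q t}
  | .arr _ _, s => {p | ∃ t, p.1 = X.exactTypes t ∧ p.2 ∈ X.exactTypes (Term.app s t)}

theorem ModelCheckingInstance.mem_exactTypes (X : ModelCheckingInstance) :
    ∀ {τ : Ty} (s : Term (Symb X.hors.ranks X.hors.nts) [] τ) (θ : ITy (Fin X.states) τ),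
      θ ∈ X.exactTypes s → ∃ σ : Subst (Symb X.hors.ranks X.hors.nts) τ.args [],
        (∀ ⦃κ : Ty⦄ (x : Var τ.args κ), ITy.params θ x = X.exactTypes (σ x)) ∧
          ¬ X.Rejects (ITy.target θ) (s.apps σ)
  | .base, s, θ, h => ⟨Subst.nil, (fun _ x => nomatch x), h⟩
  | .arr _ _, s, (S, θ), ⟨t, hS, hθ⟩ => by
    obtain ⟨σ, hσ, hr⟩ := X.mem_exactTypes (Term.app s t) θ hθ
    refine ⟨Subst.cons t σ, fun κ x => ?_, hr⟩
    cases x with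
    | here => exact hS
    | there x => exact hσ x

theorem ITy.ofTransition_sub {Q : Type} (q : Q) : ∀ {n : ℕ} (f : Fin n → Q)
    (θ : ITy Q (rankTy n)), ITy.target θ = q →
    (∀ {K : Ty → Type} (σ : Subst K (rankTy n).args [])
      (T : Term K [] .base → Set Q) (T' : ∀ ⦃τ : Ty⦄, Term K [] τ → Set (ITy Q τ))
      (_ : ∀ t : Term K [] .base, T' t = T t)
      (_ : ∀ ⦃κ : Ty⦄ (x : Var (rankTy n).args κ), ITy.params θ x = T' (σ x))
      (_ : ∀ i, f i ∈ T (rankArg σ i)), ITy.Sub (ITy.ofTransition q f) θ)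
  | 0, _, θ, h => fun _ _ _ _ _ _ => h.symm
  | n + 1, f, (S, θ), h => fun σ T T' hT hp hf => by
    refine ⟨?_, ITy.ofTransition_sub q (fun i => f i.succ) θ h (fun _ x => σ (.there x)) T T' hT
      (fun _ x => hp (.there x)) (fun i => hf i.succ)⟩
    rintro y rfl
    refine ⟨f 0, ?_, ITy.Sub.refl _⟩
    have h0 : S = T' (σ .here) := hp .here
    rw [h0, hT]
    exact hf 0

/-- Exact types are derivable up to subtyping. -/
theorem ModelCheckingInstance.hasType_of_mem_exactTypes {Γ : List Ty}
    (σ : Subst (Symb X.hors.ranks X.hors.nts) Γ []) {τ : Ty}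
    (t : Term (Symb X.hors.ranks X.hors.nts) Γ τ) :
    ∀ θ ∈ X.exactTypes (t.subst σ), ∃ θ', ITy.Sub θ' θ ∧
      X.HasType (fun _ F => X.exactTypes (.cst (.nonterminal F)))
        (fun _ x => X.exactTypes (σ x)) t θ' := by
  induction t with
  | var x => exact fun θ h => ⟨θ, ITy.Sub.refl _, .var h⟩
  | cst c =>
    rcases c with ⟨a, rfl⟩ | F <;> intro θ h
    · obtain ⟨ρ, hρ, hr⟩ := X.mem_exactTypes _ θ h
      have hx : X.hors.eval ((Term.cst (.terminal a rfl)).apps ρ) = .inr ⟨a, rankArg ρ⟩ := by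
        rw [HORS.eval_apps, HORS.head]
      rw [Term.subst, rejects_inr hx] at hr
      push Not at hr
      obtain ⟨δ, hδ, hs, rfl, hr⟩ := hr
      exact ⟨_, ITy.ofTransition_sub _ δ.succ θ hs.symm ρ (fun t => {q | ¬ X.Rejects q t})
        (fun _ t => X.exactTypes t) (fun _ => rfl) hρ hr, .terminal δ rfl hδ⟩
    · exact ⟨θ, ITy.Sub.refl _, .nonterminal h⟩
  | app s t hs ht =>
    intro θ h
    obtain ⟨⟨S, θ'⟩, hsub, hty⟩ := hs (X.exactTypes (t.subst σ), θ) ⟨_, rfl, h⟩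
    refine ⟨θ', hsub.2, .app {x | X.HasType _ _ t x} hty (fun _ hx => hx) fun y hy => ?_⟩
    obtain ⟨x, hx, hxy⟩ := hsub.1 y hy
    obtain ⟨z, hzx, hz⟩ := ht x hx
    exact ⟨z, hz, hzx.trans hxy⟩

/-- Typeability is soundness and completeness of intersection types for acceptance: a typed term is
not rejected, and the exact types of the nonterminals form a consistent assignment. -/
theorem ModelCheckingInstance.typeable_iff_accepts : X.Typeable ↔ X.Accepts := by
  rw [ModelCheckingInstance.accepts_iff]
  constructor
  · rintro ⟨E, hE, hs⟩ ⟨N, hN⟩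
    exact hN.not_hasType hE (fun _ x => nomatch x) (.nonterminal hs)
  · intro h
    refine ⟨fun _ F => X.exactTypes (.cst (.nonterminal F)), fun τ F θ hθ => ?_, h⟩
    obtain ⟨σ, hσ, hr⟩ := X.mem_exactTypes _ θ hθ
    rw [rejects_inl (X.hors.eval_nonterminal F σ)] at hr
    obtain ⟨q, hq, hty⟩ := hasType_of_mem_exactTypes σ (X.hors.rules F) (ITy.target θ) hr
    cases (hq : q = _)
    have : ITy.params θ = fun _ x => X.exactTypes (σ x) := by
      funext κ x; exact hσ x
    rw [this]
    exact hty

end Typing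

/-! ### Completeness of the proof system for existential-free formulas -/

section Soundness

variable {A : Type} {Sig : List Ty} {n : ℕ}

theorem Term.eval_rename (I : Env A Sig) {Γ Δ : List Ty} (r : ∀ ⦃τ : Ty⦄, Var Γ τ → Var Δ τ)
    (e : Env A Δ) {τ : Ty} (t : Term (Var Sig) Γ τ) :
    (t.rename r).eval I e = t.eval I (fun _ x => e (r x)) := by
  induction t with
  | var x => rfl
  | cst c => rfl
  | app s t hs ht => simp [Term.eval, Term.rename, hs, ht]

theorem Term.eval_subst (I : Env A Sig) {Γ Δ : List Ty} (σ : Subst (Var Sig) Γ Δ)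
    (e : Env A Δ) {τ : Ty} (t : Term (Var Sig) Γ τ) :
    (t.subst σ).eval I e = t.eval I (fun _ x => (σ x).eval I e) := by
  induction t with
  | var x => rfl
  | cst c => rfl
  | app s t hs ht => simp [Term.eval, Term.subst, hs, ht]

theorem Goal.holds_subst (I : Env A Sig) (α : Fin n → A → Prop) {Γ : List Ty}
    (G : Goal Sig n Γ) : ∀ {Δ : List Ty} (σ : Subst (Var Sig) Γ Δ) (e : Env A Δ),
      (G.subst σ).Holds I α e ↔ G.Holds I α (fun _ x => (σ x).eval I e) := by
  induction G with
  | tt => intros; rfl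
  | atom P t => intros; simp [Goal.subst, Goal.Holds, Term.eval_subst]
  | and G H hG hH => intros; simp [Goal.subst, Goal.Holds, hG, hH]
  | ex κ G hG =>
    intro Δ σ e
    simp only [Goal.subst, Goal.Holds, hG]
    refine exists_congr fun d => iff_of_eq ?_
    congr 1
    funext τ x
    cases x with
    | here => rfl
    | there x => exact Term.eval_rename I _ _ _

theorem Term.eval_apps (I : Env A Sig) {Γ : List Ty} (e : Env A Γ) :
    ∀ {τ : Ty} (s : Term (Var Sig) Γ τ) (θ : Subst (Var Sig) τ.args Γ),
      (s.apps θ).eval I e = semApps (s.eval I e) (fun _ x => (θ x).eval I e)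
  | .base, _, _ => rfl
  | .arr _ _, s, θ => Term.eval_apps I e (Term.app s (θ .here)) (fun _ x => θ (.there x))

theorem Env.eq_cons_nil {κ : Ty} (e : Env A [κ]) : e = Env.cons (e .here) Env.nil := by
  funext τ x
  cases x with
  | here => rfl
  | there x => nomatch x

theorem Provable.entails {D : List (Clause Sig n)} {G : Goal Sig n []} (h : Provable D G) :
    Entails D G := by
  intro A _ I α hD
  induction h with
  | tt => trivial
  | and _ _ h1 h2 => exact ⟨h1, h2⟩
  | ex t _ ih =>
    rw [Goal.holds_subst, Env.eq_cons_nil (fun _ _ => _)] at ih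
    exact ⟨_, ih⟩
  | resVar s hC _ ih =>
    rw [Goal.holds_subst, Env.eq_cons_nil (fun _ _ => _)] at ih
    exact hD _ hC _ ih
  | resCon θ hC _ ih =>
    rw [Goal.holds_subst] at ih
    have := hD _ hC _ ih
    rw [Goal.Holds, Term.eval_apps]
    exact this

end Soundness

section Completeness

/-- The constants of a signature together with a fresh constant of every type, so that every type
is inhabited by closed terms. -/
abbrev FreshCst (Sig : List Ty) (τ : Ty) : Type := Var Sig τ ⊕ Unit

/-- The domain of the term model: closed terms of base type, fresh constants included. -/
abbrev TermDom (Sig : List Ty) : Type := Term (FreshCst Sig) [] .base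

variable {Sig : List Ty} {n : ℕ}

/-- The fresh constant of a given type, as a closed term. -/
abbrev freshTerm (Sig : List Ty) (τ : Ty) : Term (FreshCst Sig) [] τ := .cst (.inr ())

/-- A term over the signature as a term with fresh constants. -/
abbrev Term.embed {Γ : List Ty} {τ : Ty} (t : Term (Var Sig) Γ τ) : Term (FreshCst Sig) Γ τ :=
  t.mapCst (fun _ c => .inl c)

/-- The logical relation between elements of the full function spaces over the term model and the
closed terms that they represent. -/
def Represents : ∀ {τ : Ty}, τ.sem (TermDom Sig) → Term (FreshCst Sig) [] τ → Prop
  | .base, d, t => d = t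
  | .arr a _, f, s => ∀ (d : a.sem (TermDom Sig)) t, Represents d t → Represents (f d) (.app s t)

/-- The constant function whose value is the fresh constant. -/
def junkFun : ∀ {τ : Ty}, τ.sem (TermDom Sig)
  | .base => freshTerm Sig .base
  | .arr _ _ => fun _ => junkFun

theorem semApps_junkFun : ∀ {τ : Ty} (e : Env (TermDom Sig) τ.args),
    semApps (junkFun (τ := τ)) e = freshTerm Sig .base
  | .base, _ => rfl
  | .arr _ b, _ => semApps_junkFun (τ := b) _

/-- Every closed term is represented by an element that maps arguments that represent nothing to
the fresh constant, and every element represents at most one closed term. -/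
theorem exists_represents_and_unique : ∀ τ : Ty,
    (∀ s : Term (FreshCst Sig) [] τ, ∃ d : τ.sem (TermDom Sig), Represents d s ∧
      ∀ e : Env (TermDom Sig) τ.args,
        (∃ θ : Subst (FreshCst Sig) τ.args [], (∀ ⦃κ : Ty⦄ (x : Var τ.args κ),
          Represents (e x) (θ x)) ∧ semApps d e = s.apps θ) ∨
        semApps d e = freshTerm Sig .base) ∧
    ∀ (d : τ.sem (TermDom Sig)) s s', Represents d s → Represents d s' → s = s'
  | .base => by
    refine ⟨fun s => ⟨s, rfl, fun e => .inl ⟨Subst.nil, (fun _ x => nomatch x), rfl⟩⟩, ?_⟩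
    rintro d s s' h h'
    exact h.symm.trans h'
  | .arr a b => by
    obtain ⟨ha, ha'⟩ := exists_represents_and_unique a
    obtain ⟨hb, hb'⟩ := exists_represents_and_unique b
    constructor
    · intro s
      choose rep hrep hjunk using hb
      classical
      let f : a.sem (TermDom Sig) → b.sem (TermDom Sig) := fun d =>
        if h : ∃ t, Represents d t then rep (.app s h.choose) else junkFun
      refine ⟨f, fun d t hd => ?_, fun e => ?_⟩
      · have h : ∃ t, Represents d t := ⟨t, hd⟩
        have ht : h.choose = t := ha' d _ _ h.choose_spec hd
        simp only [f, dif_pos h]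
        rw [ht]
        exact hrep _
      · by_cases h : ∃ t, Represents (e .here) t
        · have hf : semApps (τ := .arr a b) f e =
              semApps (rep (.app s h.choose)) (fun _ x => e (.there x)) := by
            simp only [semApps, f, dif_pos h]
          rw [hf]
          refine (hjunk (.app s h.choose) (fun _ x => e (.there x))).imp_left ?_
          rintro ⟨θ, hθ, heq⟩
          refine ⟨Subst.cons h.choose θ, fun κ x => ?_, heq⟩
          cases x with
          | here => exact h.choose_spec
          | there x => exact hθ x
        · right
          have hf : semApps (τ := .arr a b) f e =
              semApps (junkFun (τ := b)) (fun _ x => e (.there x)) := by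
            simp only [semApps, f, dif_neg h]
          rw [hf, semApps_junkFun]
    · intro f s s' h h'
      obtain ⟨d, hd, -⟩ := ha (freshTerm Sig a)
      have := hb' _ _ _ (h d _ hd) (h' d _ hd)
      exact (Term.app.inj this).2.1 |> eq_of_heq

theorem Represents.eval {I : Env (TermDom Sig) Sig}
    (hI : ∀ ⦃τ : Ty⦄ (c : Var Sig τ), Represents (I c) (.cst (.inl c))) {Γ : List Ty}
    {e : Env (TermDom Sig) Γ} {θ : Subst (FreshCst Sig) Γ []}
    (he : ∀ ⦃τ : Ty⦄ (x : Var Γ τ), Represents (e x) (θ x)) {τ : Ty}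
    (t : Term (Var Sig) Γ τ) : Represents (t.eval I e) (t.embed.subst θ) := by
  induction t with
  | var x => exact he x
  | cst c => exact hI c
  | app s t hs ht => exact hs _ _ ht

/-- An atom holds in the term model if it is provable or its argument contains fresh constants. -/
def termModelPred (D : List (Clause Sig n)) (P : Fin n) (d : TermDom Sig) : Prop :=
  ∀ t : Term (Var Sig) [] .base, t.embed = d → Provable D (.atom P t)

theorem Goal.ExistentialFree.provable_of_holds {D : List (Clause Sig n)}
    {I : Env (TermDom Sig) Sig}
    (hI : ∀ ⦃τ : Ty⦄ (c : Var Sig τ), Represents (I c) (.cst (.inl c))) {Γ : List Ty}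
    {e : Env (TermDom Sig) Γ} {θ : Subst (Var Sig) Γ []}
    (he : ∀ ⦃τ : Ty⦄ (x : Var Γ τ), Represents (e x) (θ x).embed) {G : Goal Sig n Γ}
    (hG : G.ExistentialFree) (h : G.Holds I (termModelPred D) e) : Provable D (G.subst θ) := by
  induction G with
  | tt => exact .tt
  | atom P t =>
    refine h _ ?_
    have := Represents.eval hI he t
    rw [Term.embed, Term.mapCst_subst]
    exact Eq.symm this
  | and G H ihG ihH => exact .and (ihG he hG.1 h.1) (ihH he hG.2 h.2)
  | ex κ G => exact hG.elim

/-- Provability and entailment in the standard semantics agree for existential-free formulas. The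
countermodel for an unprovable goal consists of closed terms; an element of a function space that
represents no closed term is sent to a value of which all predicates are true. -/
theorem entails_iff_provable {D : List (Clause Sig n)} {G : Goal Sig n []}
    (hD : ∀ C ∈ D, C.ExistentialFree) (hG : G.ExistentialFree) :
    Entails D G ↔ Provable D G := by
  refine ⟨fun h => ?_, Provable.entails⟩
  choose rep hrep hjunk using fun τ => (exists_represents_and_unique (Sig := Sig) τ).1
  let I : Env (TermDom Sig) Sig := fun τ c => rep τ (.cst (.inl c))
  have hI : ∀ ⦃τ : Ty⦄ (c : Var Sig τ), Represents (I c) (.cst (.inl c)) := fun τ c => hrep τ _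
  have : Nonempty (TermDom Sig) := ⟨freshTerm Sig .base⟩
  rw [← Goal.subst_var G]
  refine hG.provable_of_holds hI (e := Env.nil) (fun _ x => nomatch x)
    (h (TermDom Sig) I (termModelPred D) ?_)
  rintro (⟨P, B⟩ | ⟨P, c, B⟩) hC
  · rintro d hB t rfl
    refine .resVar t hC ((hD _ hC).provable_of_holds hI (fun τ x => ?_) hB)
    cases x with
    | here => exact rfl
    | there x => nomatch x
  · intro e hB t ht
    rcases hjunk _ (.cst (.inl c)) e with ⟨θ, hθ, heq⟩ | heq
    · obtain ⟨s₀, θ₀, rfl, hs, rfl⟩ :=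
        Term.exists_apps_of_mapCst_eq _ _ _ t (ht.trans heq)
      cases s₀ with
      | var x => nomatch x
      | app s t => simp [Term.mapCst] at hs
      | cst c₀ =>
        cases hs
        exact .resCon θ₀ hC ((hD _ hC).provable_of_holds hI hθ hB)
    · have h0 := ht.trans heq
      cases t <;> simp [Term.mapCst] at h0

end Completeness

/-! ### Polynomial-time functions on binary trees -/

section PolyTime

theorem eval_le_eval (b : Polynomial ℕ) {m n : ℕ} (h : m ≤ n) : b.eval m ≤ b.eval n := by
  rw [Polynomial.eval_eq_sum, Polynomial.eval_eq_sum]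
  exact Finset.sum_le_sum fun i _ => Nat.mul_le_mul_left _ (Nat.pow_le_pow_left h i)

theorem Data.one_le_size (x : Data) : 1 ≤ x.size := by
  cases x <;> simp [Data.size]

theorem Runs.size_le {p : Prog} {x y : Data} {t : ℕ} (h : Runs p x y t) : y.size ≤ t := by
  induction h <;> (try simp only [Data.size] at *) <;> omega

/-- Functions on binary trees that are computable in polynomial time. -/
@[fun_prop]
def PolyTime (f : Data → Data) : Prop :=
  ∃ (p : Prog) (b : Polynomial ℕ), ∀ x, ∃ t ≤ b.eval x.size, Runs p x (f x) t

namespace PolyTime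

theorem size_le {f : Data → Data} (hf : PolyTime f) :
    ∃ b : Polynomial ℕ, ∀ x, (f x).size ≤ b.eval x.size := by
  obtain ⟨p, b, h⟩ := hf
  refine ⟨b, fun x => ?_⟩
  obtain ⟨t, ht, hr⟩ := h x
  exact hr.size_le.trans ht

@[fun_prop]
theorem id : PolyTime (fun x => x) :=
  ⟨.id, .X + 1, fun x => ⟨x.size + 1, by simp, .id x⟩⟩

@[fun_prop]
theorem comp {f g : Data → Data} (hf : PolyTime f) (hg : PolyTime g) :
    PolyTime (fun x => f (g x)) := by
  obtain ⟨p, b, h⟩ := hf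
  obtain ⟨q, c, h'⟩ := hg
  refine ⟨.seq q p, c + b.comp c + 1, fun x => ?_⟩
  obtain ⟨t, ht, hr⟩ := h' x
  obtain ⟨u, hu, hs⟩ := h (g x)
  refine ⟨t + u + 1, ?_, .seq hr hs⟩
  have := hu.trans (eval_le_eval b (hr.size_le.trans ht))
  simp only [Polynomial.eval_add, Polynomial.eval_comp, Polynomial.eval_one]
  omega

@[fun_prop]
theorem cons {f g : Data → Data} (hf : PolyTime f) (hg : PolyTime g) :
    PolyTime (fun x => Data.cons (f x) (g x)) := by
  obtain ⟨p, b, h⟩ := hf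
  obtain ⟨q, c, h'⟩ := hg
  refine ⟨.pair p q, b + c + 1, fun x => ?_⟩
  obtain ⟨t, ht, hr⟩ := h x
  obtain ⟨u, hu, hs⟩ := h' x
  refine ⟨t + u + 1, ?_, .pair hr hs⟩
  simp only [Polynomial.eval_add, Polynomial.eval_one]
  omega

theorem nil : PolyTime (fun _ => Data.nil) :=
  ⟨.nil, 1, fun x => ⟨1, by simp, .nil x⟩⟩

@[fun_prop]
theorem const : ∀ c : Data, PolyTime (fun _ => c)
  | .nil => nil
  | .cons a b => cons (const a) (const b)

end PolyTime

/-- The left subtree; that of `nil` is `nil`. -/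
def Data.fst : Data → Data
  | .nil => .nil
  | .cons x _ => x

/-- The right subtree; that of `nil` is `nil`. -/
def Data.snd : Data → Data
  | .nil => .nil
  | .cons _ y => y

/-- The case distinction whether a tree is `nil` (the second value) or not (the first value). -/
def Data.ite : Data → Data → Data → Data
  | .nil, _, y => y
  | .cons _ _, x, _ => x

@[simp] theorem Data.fst_nil : Data.nil.fst = .nil := rfl
@[simp] theorem Data.snd_nil : Data.nil.snd = .nil := rfl
@[simp] theorem Data.fst_cons (x y : Data) : (Data.cons x y).fst = x := rfl
@[simp] theorem Data.snd_cons (x y : Data) : (Data.cons x y).snd = y := rfl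
@[simp] theorem Data.ite_nil (x y : Data) : Data.nil.ite x y = y := rfl
@[simp] theorem Data.ite_cons (a b x y : Data) : (Data.cons a b).ite x y = x := rfl

theorem Data.size_fst_le (x : Data) : x.fst.size ≤ x.size := by
  cases x <;> simp [Data.size]; omega

theorem Data.size_snd_le (x : Data) : x.snd.size ≤ x.size := by
  cases x <;> simp [Data.size]; omega

namespace PolyTime

@[fun_prop]
theorem fst {f : Data → Data} (hf : PolyTime f) : PolyTime (fun x => (f x).fst) := by
  refine comp (f := Data.fst) ⟨.fst, .X + 1, fun x => ?_⟩ hf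
  cases x with
  | nil => exact ⟨1, by simp, .fstNil⟩
  | cons x y => exact ⟨_, by simp, .fstCons x y⟩

@[fun_prop]
theorem snd {f : Data → Data} (hf : PolyTime f) : PolyTime (fun x => (f x).snd) := by
  refine comp (f := Data.snd) ⟨.snd, .X + 1, fun x => ?_⟩ hf
  cases x with
  | nil => exact ⟨1, by simp, .sndNil⟩
  | cons x y => exact ⟨_, by simp, .sndCons x y⟩

@[fun_prop]
theorem ite {c f g : Data → Data} (hc : PolyTime c) (hf : PolyTime f) (hg : PolyTime g) :
    PolyTime (fun x => (c x).ite (f x) (g x)) := by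
  obtain ⟨r, d, h₀⟩ := hc
  obtain ⟨p, b, h⟩ := hf
  obtain ⟨q, e, h'⟩ := hg
  refine ⟨.cond r p q, d + b + e + 1, fun x => ?_⟩
  obtain ⟨s, hs, hr⟩ := h₀ x
  obtain ⟨t, ht, hp⟩ := h x
  obtain ⟨u, hu, hq⟩ := h' x
  simp only [Polynomial.eval_add, Polynomial.eval_one]
  cases hcx : c x with
  | nil => rw [hcx] at hr; exact ⟨s + u + 1, by omega, .condFalse hr hq⟩
  | cons y z => rw [hcx] at hr; exact ⟨s + t + 1, by omega, .condTrue hr hp⟩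

end PolyTime

/-- `LoopSteps c g B k s s'`: `k` rounds of the loop with test `c` and body `g` lead from the state
`s` to the state `s'`, and the sizes of the states passed are at most `B`. -/
inductive LoopSteps (c g : Data → Data) (B : ℕ) : ℕ → Data → Data → Prop where
  | refl (s : Data) : LoopSteps c g B 0 s s
  | head {k : ℕ} {s s' : Data} : c s ≠ .nil → s.size ≤ B → LoopSteps c g B k (g s) s' →
      LoopSteps c g B (k + 1) s s'

theorem LoopSteps.trans {c g : Data → Data} {B k l : ℕ} {s s' s'' : Data}
    (h : LoopSteps c g B k s s') (h' : LoopSteps c g B l s' s'') :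
    LoopSteps c g B (k + l) s s'' := by
  induction h with
  | refl => simpa using h'
  | head h1 h2 _ ih => rw [Nat.succ_add_eq_add_succ]; exact .head h1 h2 (ih h')

theorem LoopSteps.mono {c g : Data → Data} {B B' k : ℕ} (hB : B ≤ B') {s s' : Data}
    (h : LoopSteps c g B k s s') : LoopSteps c g B' k s s' := by
  induction h with
  | refl => exact .refl _
  | head h1 h2 _ ih => exact .head h1 (h2.trans hB) ih

/-- A loop with polynomially many rounds and states of polynomial size. -/
theorem PolyTime.loop {c g i f : Data → Data} (hc : PolyTime c) (hg : PolyTime g)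
    (hi : PolyTime i) (B : Polynomial ℕ)
    (h : ∀ x, ∃ k ≤ B.eval x.size, LoopSteps c g (B.eval x.size) k (i x) (f x))
    (hnil : ∀ x, c (f x) = .nil) (hsize : ∀ x, (f x).size ≤ B.eval x.size) : PolyTime f := by
  obtain ⟨p, b, hp⟩ := hc
  obtain ⟨q, d, hq⟩ := hg
  obtain ⟨r, e, hr⟩ := hi
  have key : ∀ {N k s s'}, LoopSteps c g N k s s' → c s' = .nil → s'.size ≤ N →
      ∃ t ≤ (k + 1) * (b.eval N + d.eval N + N + 1), Runs (.loop p q) s s' t := by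
    intro N k s s' hs hnil hsize
    induction hs with
    | refl s =>
      obtain ⟨t, ht, hr⟩ := hp s
      rw [hnil] at hr
      have := ht.trans (eval_le_eval b hsize)
      exact ⟨_, by omega, .loopStop hr⟩
    | @head k s s' h1 h2 _ ih =>
      obtain ⟨v, hv, hrv⟩ := ih hnil hsize
      obtain ⟨t, ht, hr⟩ := hp s
      obtain ⟨u, hu, hru⟩ := hq s
      cases hcs : c s with
      | nil => exact (h1 hcs).elim
      | cons y z =>
        rw [hcs] at hr
        have h3 := ht.trans (eval_le_eval b h2)
        have h4 := hu.trans (eval_le_eval d h2)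
        refine ⟨t + u + v + 1, ?_, .loopStep hr hru hrv⟩
        rw [Nat.succ_mul]
        omega
  refine ⟨.seq r (.loop p q), e + (B + 1) * (b.comp B + d.comp B + B + 1) + 1, fun x => ?_⟩
  obtain ⟨k, hk, hs⟩ := h x
  obtain ⟨t, ht, hrt⟩ := key hs (hnil x) (hsize x)
  obtain ⟨u, hu, hru⟩ := hr x
  refine ⟨u + t + 1, ?_, .seq hru hrt⟩
  simp only [Polynomial.eval_mul, Polynomial.eval_add, Polynomial.eval_comp, Polynomial.eval_one]
  have := ht.trans (Nat.mul_le_mul_right _ (Nat.add_le_add_right hk 1))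
  omega

/-- The list of the left subtrees along the right spine; inverse to `encList`. -/
def Data.toList : Data → List Data
  | .nil => []
  | .cons x y => x :: y.toList

@[simp] theorem encList_nil : encList [] = .nil := rfl

@[simp] theorem encList_cons (x : Data) (l : List Data) :
    encList (x :: l) = .cons x (encList l) := rfl

@[simp] theorem encList_toList : ∀ x : Data, encList x.toList = x
  | .nil => rfl
  | .cons x y => congrArg (Data.cons x) (encList_toList y)

theorem size_encList (l : List Data) : (encList l).size = (l.map (fun x => x.size + 1)).sum + 1 := by
  induction l with
  | nil => rfl
  | cons x l ih => simp [Data.size, ih]; omega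

section Recursion

variable (calls comb : Data → Data)

/-- A step of the stack machine that evaluates a recursive function. A state consists of a returned
value (`nil` if there is none, `cons v nil` for `v`) and a stack of frames; a frame holds an
argument, the list of the pending recursive calls, and the reversed list of the values of the calls
that have returned. -/
def stackStep (s : Data) : Data :=
  s.fst.ite
    (.cons .nil (.cons (.cons s.snd.fst.fst (.cons s.snd.fst.snd.fst
      (.cons s.fst.fst s.snd.fst.snd.snd))) s.snd.snd))
    (s.snd.fst.snd.fst.ite
      (.cons .nil (.cons (.cons s.snd.fst.snd.fst.fst
          (.cons (calls s.snd.fst.snd.fst.fst) .nil))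
        (.cons (.cons s.snd.fst.fst (.cons s.snd.fst.snd.fst.snd s.snd.fst.snd.snd))
          s.snd.snd)))
      (.cons (.cons (comb (.cons s.snd.fst.fst s.snd.fst.snd.snd)) .nil) s.snd.snd))

/-- A frame of the stack machine. -/
def stackFrame (z : Data) (pend done : List Data) : Data :=
  .cons z (.cons (encList pend) (encList done))

variable {calls comb}

theorem size_stackFrame (z : Data) (pend done : List Data) : (stackFrame z pend done).size =
    z.size + (encList pend).size + (encList done).size + 2 := by
  simp only [stackFrame, Data.size]; omega

theorem size_encList_append (l l' : List Data) :
    (encList (l ++ l')).size + 1 = (encList l).size + (encList l').size := by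
  simp only [size_encList, List.map_append, List.sum_append]; omega

variable {f : Data → Data} {μ : Data → ℕ}

theorem stackSteps
    (hf : ∀ z, f z = comb (.cons z (encList (((calls z).toList.map f).reverse))))
    (hμ : ∀ z, (((calls z).toList).map μ).sum < μ z)
    (hc : ∀ z, ∀ c ∈ (calls z).toList, c.size ≤ z.size) (n W : ℕ)
    (hW : ∀ z, z.size ≤ n →
      (∀ pend done, (calls z).toList = done ++ pend →
        (stackFrame z pend (done.map f).reverse).size + (f z).size + 3 ≤ W)) :
    ∀ m z, μ z ≤ m → z.size ≤ n → ∀ rest : Data, ∃ k, k + 2 ≤ 3 * μ z ∧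
      LoopSteps Data.snd (stackStep calls comb) (rest.size + μ z * W) k
        (.cons .nil (.cons (stackFrame z (calls z).toList []) rest))
        (.cons (.cons (f z) .nil) rest) := by
  intro m
  induction m with
  | zero => intro z hz; have := hμ z; omega
  | succ m ih =>
    intro z hz hn rest
    have hμz := hμ z
    have hWμ : W ≤ μ z * W := Nat.le_mul_of_pos_left _ (by omega)
    have inner : ∀ pend done, (calls z).toList = done ++ pend →
        ∃ k ≤ 3 * (pend.map μ).sum,
          LoopSteps Data.snd (stackStep calls comb) (rest.size + μ z * W) k
            (.cons .nil (.cons (stackFrame z pend (done.map f).reverse) rest))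
            (.cons .nil (.cons (stackFrame z [] (((calls z).toList).map f).reverse) rest)) := by
      intro pend
      induction pend with
      | nil =>
        intro done h
        rw [List.append_nil] at h
        rw [h]
        exact ⟨0, Nat.zero_le _, .refl _⟩
      | cons c pend ihp =>
        intro done h
        have hmem : c ∈ (calls z).toList := by rw [h]; simp
        have hsum : μ c ≤ ((calls z).toList.map μ).sum :=
          List.single_le_sum (by simp) _ (List.mem_map_of_mem hmem)
        have h' : (calls z).toList = (done ++ [c]) ++ pend := by rw [h]; simp
        obtain ⟨k, hk, hs⟩ := ih c (by omega) ((hc z c hmem).trans hn)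
          (.cons (stackFrame z pend (done.map f).reverse) rest)
        obtain ⟨l, hl, hs'⟩ := ihp (done ++ [c]) h'
        have hW1 := hW z hn (c :: pend) done h
        have hW2 := hW z hn pend (done ++ [c]) h'
        have hfr : (stackFrame z pend (done.map f).reverse).size ≤
            (stackFrame z (c :: pend) (done.map f).reverse).size := by
          simp only [size_stackFrame, encList_cons, Data.size]; omega
        have hfr2 : (stackFrame z pend ((done ++ [c]).map f).reverse).size =
            (stackFrame z pend (done.map f).reverse).size + (f c).size + 1 := by
          simp [size_stackFrame, Data.size]; omega
        have hmul : μ c * W + W ≤ μ z * W := by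
          rw [← Nat.succ_mul]; exact Nat.mul_le_mul_right _ (by omega)
        refine ⟨1 + k + 1 + l, by simp only [List.map_cons, List.sum_cons]; omega, ?_⟩
        have s1 : LoopSteps Data.snd (stackStep calls comb) (rest.size + μ z * W) 1
            (.cons .nil (.cons (stackFrame z (c :: pend) (done.map f).reverse) rest))
            (.cons .nil (.cons (stackFrame c (calls c).toList [])
              (.cons (stackFrame z pend (done.map f).reverse) rest))) := by
          refine .head (by simp) (by simp only [Data.size]; omega) ?_
          simp only [stackStep, stackFrame, encList_cons, Data.fst_cons, Data.snd_cons,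
            Data.ite_nil, Data.ite_cons, encList_toList, encList_nil, Data.fst_nil]
          exact .refl _
        have s2 : LoopSteps Data.snd (stackStep calls comb) (rest.size + μ z * W) 1
            (.cons (.cons (f c) .nil) (.cons (stackFrame z pend (done.map f).reverse) rest))
            (.cons .nil (.cons (stackFrame z pend ((done ++ [c]).map f).reverse) rest)) := by
          refine .head (by simp) (by simp only [Data.size]; omega) ?_
          simp only [stackStep, stackFrame, Data.fst_cons, Data.snd_cons,
            Data.ite_cons, List.map_append, List.map_cons, List.map_nil, List.reverse_append,
            List.reverse_cons, List.reverse_nil, List.nil_append, List.singleton_append,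
            encList_cons]
          exact .refl _
        refine (s1.trans (hs.mono ?_)).trans s2 |>.trans hs'
        simp only [Data.size]
        omega
    obtain ⟨k, hk, hs⟩ := inner (calls z).toList [] rfl
    refine ⟨k + 1, by omega, hs.trans (.head (by simp) ?_ ?_)⟩
    · have := hW z hn [] (calls z).toList (by simp)
      simp only [Data.size]
      omega
    · simp only [stackStep, stackFrame, Data.fst_cons, Data.snd_cons, Data.fst_nil,
        Data.ite_nil, encList_nil]
      rw [← hf]
      exact .refl _

/-- A recursive function is computable in polynomial time if the recursion is bounded in a strong
sense: the arguments of the recursive calls are not larger than the argument `z`, the numbers `μ` of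
calls add up to less than `μ z ≤ |z|`, and the value at `z` is larger than the values of the calls
taken together by at most a polynomial in `|z|`. -/
theorem PolyTime.recursion (hcalls : PolyTime calls) (hcomb : PolyTime comb)
    (hf : ∀ z, f z = comb (.cons z (encList (((calls z).toList.map f).reverse))))
    (μ : Data → ℕ) (hμ : ∀ z, (((calls z).toList).map μ).sum < μ z) (hμs : ∀ z, μ z ≤ z.size)
    (hc : ∀ z, ∀ c ∈ (calls z).toList, c.size ≤ z.size) (Q : Polynomial ℕ)
    (hQ : ∀ z, (f z).size ≤ ((calls z).toList.map (fun c => (f c).size)).sum + Q.eval z.size) :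
    PolyTime f := by
  have hsize : ∀ n m z, μ z ≤ m → z.size ≤ n → (f z).size ≤ μ z * Q.eval n := by
    intro n m
    induction m with
    | zero => intro z hz; have := hμ z; omega
    | succ m ih =>
      intro z hz hn
      have h1 : ∀ l : List Data, (∀ c ∈ l, c ∈ (calls z).toList) →
          (l.map (fun c => (f c).size)).sum ≤ (l.map μ).sum * Q.eval n := by
        intro l
        induction l with
        | nil => intro _; simp
        | cons c l ihl =>
          intro hl
          have hmem := hl c (by simp)
          have hsum : μ c ≤ ((calls z).toList.map μ).sum :=
            List.single_le_sum (by simp) _ (List.mem_map_of_mem hmem)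
          have := ih c (by have := hμ z; omega) ((hc z c hmem).trans hn)
          have := ihl (fun c hc => hl c (List.mem_cons_of_mem _ hc))
          simp only [List.map_cons, List.sum_cons, Nat.add_mul]
          omega
      have h2 := h1 _ (fun c h => h)
      have h3 := hQ z
      have h4 := eval_le_eval Q hn
      have h5 : (((calls z).toList.map μ).sum + 1) * Q.eval n ≤ μ z * Q.eval n :=
        Nat.mul_le_mul_right _ (hμ z)
      rw [Nat.succ_mul] at h5
      omega
  obtain ⟨K, hK⟩ := hcalls.size_le
  -- a bound for the size of a frame and the value returned to it
  let W : Polynomial ℕ := .X + K + .X * Q * .X + .X + .X * Q + 6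
  have hW : ∀ n z, z.size ≤ n → ∀ pend done, (calls z).toList = done ++ pend →
      (stackFrame z pend (done.map f).reverse).size + (f z).size + 3 ≤ W.eval n := by
    intro n z hn pend done h
    have hfz := (hsize n (μ z) z le_rfl hn).trans
      (Nat.mul_le_mul_right _ ((hμs z).trans hn))
    have hpend : (encList pend).size ≤ K.eval n := by
      have h1 := size_encList_append done pend
      rw [← h, encList_toList] at h1
      have := (hK z).trans (eval_le_eval K hn)
      have := Data.one_le_size (encList done)
      omega
    have hdone : (encList (done.map f).reverse).size ≤ n * Q.eval n * n + n + 1 := by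
      have hlen : ∀ l : List Data, (∀ c ∈ l, c.size ≤ n) →
          (encList (l.map f).reverse).size ≤ l.length * (n * Q.eval n) + l.length + 1 := by
        intro l
        induction l with
        | nil => intro _; simp [Data.size]
        | cons c l ih =>
          intro hl
          have h1 := size_encList_append (l.map f).reverse [f c]
          have h2 := ih (fun c hc => hl c (List.mem_cons_of_mem _ hc))
          have h3 := (hsize n (μ c) c le_rfl (hl c (by simp))).trans
            (Nat.mul_le_mul_right _ ((hμs c).trans (hl c (by simp))))
          simp only [encList_cons, encList_nil, Data.size] at h1
          simp only [List.map_cons, List.reverse_cons, List.length_cons, Nat.succ_mul]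
          omega
      have hl : done.length ≤ n := by
        have h1 : ∀ l : List Data, l.length ≤ (l.map μ).sum := by
          intro l
          induction l with
          | nil => simp
          | cons c l ih => have := hμ c; simp only [List.map_cons, List.sum_cons,
              List.length_cons]; omega
        have h2 := h1 (calls z).toList
        rw [h, List.length_append, ← h] at h2
        have := hμ z
        have := hμs z
        omega
      have := hlen done fun c hcd => (hc z c (by rw [h]; simp [hcd])).trans hn
      have h5 : done.length * (n * Q.eval n) ≤ n * (n * Q.eval n) := Nat.mul_le_mul_right _ hl
      have h6 : n * (n * Q.eval n) = n * Q.eval n * n := Nat.mul_comm _ _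
      omega
    rw [size_stackFrame]
    simp only [W, Polynomial.eval_add, Polynomial.eval_mul, Polynomial.eval_X,
      Polynomial.eval_ofNat]
    omega
  have hstep : PolyTime (stackStep calls comb) := by
    unfold stackStep
    have h1 := PolyTime.id.fst
    have h2 := PolyTime.id.snd.fst
    have h3 := PolyTime.id.snd.snd
    exact h1.ite (nil.cons ((h2.fst.cons (h2.snd.fst.cons (h1.fst.cons h2.snd.snd))).cons h3))
      (h2.snd.fst.ite (nil.cons ((h2.snd.fst.fst.cons
        ((hcalls.comp h2.snd.fst.fst).cons nil)).cons
          ((h2.fst.cons (h2.snd.fst.snd.cons h2.snd.snd)).cons h3)))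
        (((hcomb.comp (h2.fst.cons h2.snd.snd)).cons nil).cons h3))
  have hinit : PolyTime (fun z => Data.cons .nil (.cons (.cons z (.cons (calls z) .nil)) .nil)) :=
    nil.cons ((id.cons (hcalls.cons nil)).cons nil)
  have hloop : PolyTime (fun z => Data.cons (.cons (f z) .nil) .nil) := by
    refine loop (f := fun z => Data.cons (.cons (f z) .nil) .nil) id.snd hstep hinit
      (3 * .X + .X * W + W + 1) (fun z => ?_) (fun z => rfl) fun z => ?_
    · obtain ⟨k, hk, hs⟩ := stackSteps hf hμ hc z.size (W.eval z.size) (hW z.size) (μ z) z le_rfl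
        le_rfl .nil
      have h1 := hμs z
      have h2 := Nat.mul_le_mul_right (W.eval z.size) h1
      simp only [Polynomial.eval_mul, Polynomial.eval_add, Polynomial.eval_one,
        Polynomial.eval_X, Polynomial.eval_ofNat]
      refine ⟨k, by omega, ?_⟩
      rw [stackFrame, encList_toList, encList_nil] at hs
      refine hs.mono ?_
      simp only [Data.size]
      omega
    · have := hW z.size z le_rfl [] (calls z).toList (by simp)
      simp only [Data.size, Polynomial.eval_mul, Polynomial.eval_add, Polynomial.eval_one,
        Polynomial.eval_X, Polynomial.eval_ofNat]
      omega
  exact hloop.fst.fst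

end Recursion

end PolyTime

/-! ### A library of polynomial-time list functions -/

section Library

/-- Primitive recursion along the right spine, with a parameter. -/
def Data.para (a : Data → Data) (g : Data → Data → Data → Data → Data) (p : Data) : Data → Data
  | .nil => a p
  | .cons x l => g p x l (Data.para a g p l)

theorem PolyTime.para {a : Data → Data} {g : Data → Data → Data → Data → Data} (ha : PolyTime a)
    (hg : PolyTime (fun z => g z.fst z.snd.fst z.snd.snd.fst z.snd.snd.snd)) (Q : Polynomial ℕ)
    (hQ : ∀ p x l r, (g p x l r).size ≤ r.size + Q.eval (p.size + x.size + l.size))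
    {p l : Data → Data} (hp : PolyTime p) (hl : PolyTime l) :
    PolyTime (fun y => Data.para a g (p y) (l y)) := by
  obtain ⟨A, hA⟩ := ha.size_le
  have key : PolyTime (fun z => Data.para a g z.fst z.snd) := by
    refine PolyTime.recursion
      (calls := fun z => z.snd.ite (.cons (.cons z.fst z.snd.snd) .nil) .nil)
      (comb := fun w => w.fst.snd.ite
        (g w.fst.fst w.fst.snd.fst w.fst.snd.snd w.snd.fst) (a w.fst.fst))
      (by fun_prop) ?_ ?_ (fun z => z.snd.size) ?_ (fun z => z.size_snd_le) ?_ (Q + A) ?_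
    · have := hg.comp (g := fun w => .cons w.fst.fst (.cons w.fst.snd.fst
        (.cons w.fst.snd.snd w.snd.fst))) (by fun_prop)
      exact PolyTime.ite (by fun_prop) this (by fun_prop)
    · rintro (_ | ⟨p, _ | ⟨x, l⟩⟩) <;> rfl
    · rintro (_ | ⟨p, _ | ⟨x, l⟩⟩) <;> simp [Data.toList, Data.size]
    · rintro (_ | ⟨p, _ | ⟨x, l⟩⟩) <;> simp [Data.toList, Data.size]; omega
    · rintro (_ | ⟨p, _ | ⟨x, l⟩⟩) <;>
        simp only [Data.toList, Data.para, Data.fst_cons, Data.snd_cons, Data.ite_nil,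
          Data.ite_cons, Data.fst_nil, Data.snd_nil, List.map_cons, List.map_nil, List.sum_cons,
          List.sum_nil, Polynomial.eval_add, Nat.zero_add, Nat.add_zero]
      · exact (hA _).trans (Nat.le_add_left _ _)
      · refine (hA p).trans ((eval_le_eval A ?_).trans (Nat.le_add_left _ _))
        simp only [Data.size]; omega
      · refine (hQ p x l _).trans ?_
        have := eval_le_eval Q (m := p.size + x.size + l.size)
          (n := (Data.cons p (Data.cons x l)).size) (by simp only [Data.size]; omega)
        omega
  exact key.comp (hp.cons hl)

/-- `List.foldr` on trees that encode lists. -/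
def Data.fold (g : Data → Data → Data) (a : Data) : Data → Data
  | .nil => a
  | .cons x l => g x (Data.fold g a l)

@[simp] theorem Data.fold_encList (g : Data → Data → Data) (a : Data) (l : List Data) :
    Data.fold g a (encList l) = l.foldr g a := by
  induction l with
  | nil => rfl
  | cons x l ih => simp [Data.fold, ih]

theorem PolyTime.fold {g : Data → Data → Data} (hg : PolyTime (fun z => g z.fst z.snd)) (c : ℕ)
    (hc : ∀ x r, (g x r).size ≤ x.size + r.size + c) {a l : Data → Data} (ha : PolyTime a)
    (hl : PolyTime l) : PolyTime (fun y => Data.fold g (a y) (l y)) := by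
  have h := PolyTime.para (a := fun p => p) (g := fun _ x _ r => g x r) PolyTime.id
    (hg.comp (g := fun z => .cons z.snd.fst z.snd.snd.snd) (by fun_prop))
    (.X + Polynomial.C c) (fun p x l r => (hc x r).trans (by simp; omega)) ha hl
  have e : ∀ p l, Data.para (fun p => p) (fun _ x _ r => g x r) p l = Data.fold g p l := by
    intro p l
    induction l with
    | nil => rfl
    | cons x l _ ih => simp only [Data.para, Data.fold, ih]
  simpa only [e] using h

/-- `List.map` on trees that encode lists. -/
def Data.map (g : Data → Data) : Data → Data
  | .nil => .nil
  | .cons x l => .cons (g x) (Data.map g l)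

@[simp] theorem Data.map_encList (g : Data → Data) (l : List Data) :
    Data.map g (encList l) = encList (l.map g) := by
  induction l with
  | nil => rfl
  | cons x l ih => simp [Data.map, ih]

@[fun_prop]
theorem PolyTime.map {g : Data → Data → Data} (hg : PolyTime (fun z => g z.fst z.snd))
    {l : Data → Data} (hl : PolyTime l) : PolyTime (fun y => Data.map (g y) (l y)) := by
  obtain ⟨b, hb⟩ := hg.size_le
  have h := PolyTime.para (a := fun _ => .nil) (g := fun p x _ r => .cons (g p x) r)
    (PolyTime.const _)
    ((hg.comp (g := fun z => .cons z.fst z.snd.fst) (by fun_prop)).cons (by fun_prop))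
    (b.comp (.X + 1) + 1) (fun p x l r => by
      have h1 := hb (.cons p x)
      have h2 := eval_le_eval b (m := (Data.cons p x).size) (n := p.size + x.size + l.size + 1)
        (by simp only [Data.size]; omega)
      simp only [Data.size, Data.fst_cons, Data.snd_cons, Polynomial.eval_add,
        Polynomial.eval_comp, Polynomial.eval_X, Polynomial.eval_one] at *
      omega) PolyTime.id hl
  have e : ∀ p l, Data.para (fun _ => .nil) (fun p x _ r => .cons (g p x) r) p l =
      Data.map (g p) l := by
    intro p l
    induction l with
    | nil => rfl
    | cons x l _ ih => simp only [Data.para, Data.map, ih]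
  simpa only [e] using h

/-- Concatenation of trees that encode lists; addition of unary numbers. -/
def Data.append (x y : Data) : Data := Data.fold .cons y x

@[simp] theorem Data.append_encList (l l' : List Data) :
    (encList l).append (encList l') = encList (l ++ l') := by
  induction l with
  | nil => simp [Data.append, Data.fold]
  | cons x l ih => simpa [Data.append, Data.fold] using ih

theorem Data.size_append (x y : Data) : (x.append y).size + 1 = x.size + y.size := by
  induction x with
  | nil => simp [Data.append, Data.fold, Data.size]; omega
  | cons a x _ ih => simp only [Data.append, Data.fold, Data.size] at *; omega

@[fun_prop]
theorem PolyTime.append {f g : Data → Data} (hf : PolyTime f) (hg : PolyTime g) :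
    PolyTime (fun y => (f y).append (g y)) :=
  PolyTime.fold (by fun_prop) 1 (fun x r => by simp [Data.size]) hg hf

/-- `List.flatMap` on trees that encode lists. -/
def Data.flatMap (g : Data → Data) (x : Data) : Data := Data.fold .append .nil (x.map g)

@[fun_prop]
theorem PolyTime.flatMap {g : Data → Data → Data} (hg : PolyTime (fun z => g z.fst z.snd))
    {l : Data → Data} (hl : PolyTime l) : PolyTime (fun y => (l y).flatMap (g y)) :=
  PolyTime.fold (g := .append) (by fun_prop) 0
    (fun x r => by have := Data.size_append x r; omega) (PolyTime.const _) (PolyTime.map hg hl)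

/-- `List.reverse` on trees that encode lists. -/
def Data.reverse (x : Data) : Data :=
  Data.fold (fun a r => r.append (.cons a .nil)) .nil x

@[simp] theorem Data.reverse_encList (l : List Data) :
    (encList l).reverse = encList l.reverse := by
  induction l with
  | nil => rfl
  | cons x l ih =>
    simp only [Data.reverse, Data.fold, encList_cons] at *
    rw [ih, List.reverse_cons, ← Data.append_encList]
    rfl

@[fun_prop]
theorem PolyTime.reverse {f : Data → Data} (hf : PolyTime f) :
    PolyTime (fun y => (f y).reverse) :=
  PolyTime.fold (g := fun a r => r.append (.cons a .nil)) (by fun_prop) 1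
    (fun x r => by
      have := Data.size_append r (.cons x .nil)
      simp only [Data.size] at this
      omega) (PolyTime.const _) hf

theorem encNat_eq (n : ℕ) : encNat n = encList (List.replicate n .nil) := by
  induction n with
  | zero => rfl
  | succ n ih => simp [encNat, ih, List.replicate_succ]

@[simp] theorem Data.append_encNat (m n : ℕ) :
    (encNat m).append (encNat n) = encNat (m + n) := by
  simp [encNat_eq]

/-- The length of the right spine, as a unary number. -/
def Data.length (x : Data) : Data := x.map (fun _ => .nil)

@[simp] theorem Data.length_encList (l : List Data) : (encList l).length = encNat l.length := by
  simp [Data.length, encNat_eq]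

@[fun_prop]
theorem PolyTime.length {f : Data → Data} (hf : PolyTime f) : PolyTime (fun y => (f y).length) :=
  PolyTime.map (by fun_prop) hf

/-- The list of the nonempty suffixes of a list. -/
def Data.tails : Data → Data
  | .nil => .nil
  | .cons x l => .cons (.cons x l) l.tails

@[fun_prop]
theorem PolyTime.tails {f : Data → Data} (hf : PolyTime f) : PolyTime (fun y => (f y).tails) := by
  have h := PolyTime.para (a := fun _ => .nil) (g := fun _ x l r => .cons (.cons x l) r)
    (PolyTime.const _) (by fun_prop) (.X + 2)
    (fun p x l r => by simp [Data.size]; omega) PolyTime.id hf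
  have e : ∀ p l, Data.para (fun _ => .nil) (fun _ x l r => .cons (.cons x l) r) p l =
      l.tails := by
    intro p l
    induction l with
    | nil => rfl
    | cons x l _ ih => simp only [Data.para, Data.tails, ih]
  simpa only [e] using h

/-- The list of the numbers below a number. -/
def Data.range (x : Data) : Data := (x.tails.map Data.snd).reverse

@[simp] theorem Data.range_encNat (n : ℕ) :
    (encNat n).range = encList ((List.range n).map encNat) := by
  have h : (encNat n).tails.map Data.snd = encList ((List.range n).map encNat).reverse := by
    induction n with
    | zero => rfl
    | succ n ih => simp [encNat, Data.tails, Data.map, ih, List.range_succ]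
  simp [Data.range, h]

@[fun_prop]
theorem PolyTime.range {f : Data → Data} (hf : PolyTime f) : PolyTime (fun y => (f y).range) := by
  unfold Data.range
  exact (PolyTime.map (g := fun _ => Data.snd) (by fun_prop) hf.tails).reverse

/-- The list of the members of a list, each paired with its index. -/
def Data.zipIdx (x : Data) : Data :=
  (x.reverse.tails.map (fun l => .cons l.fst l.snd.length)).reverse

@[simp] theorem Data.zipIdx_encList (l : List Data) :
    (encList l).zipIdx = encList (l.zipIdx.map (fun p => .cons p.1 (encNat p.2))) := by
  have h : ∀ l : List Data, (encList l.reverse).tails.map (fun l => .cons l.fst l.snd.length) =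
      encList (l.zipIdx.map (fun p => .cons p.1 (encNat p.2))).reverse := by
    intro l
    induction l using List.reverseRecOn with
    | nil => rfl
    | append_singleton l a ih =>
      simp [List.zipIdx_append, Data.tails, Data.map, ih]
  simp [Data.zipIdx, h]

@[fun_prop]
theorem PolyTime.zipIdx {f : Data → Data} (hf : PolyTime f) :
    PolyTime (fun y => (f y).zipIdx) := by
  unfold Data.zipIdx
  fun_prop

/-- The member of a list with a given index. -/
def Data.nth (x i : Data) : Data := (Data.fold (fun _ r => r.snd) x i).fst

@[simp] theorem Data.nth_encList (l : List Data) (i : Fin l.length) :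
    (encList l).nth (encNat i) = l.get i := by
  obtain ⟨i, hi⟩ := i
  have h : ∀ i, Data.fold (fun _ r => r.snd) (encList l) (encNat i) = encList (l.drop i) := by
    intro i
    induction i with
    | zero => rfl
    | succ i ih =>
      rw [encNat, Data.fold, ih, ← List.drop_drop]
      cases l.drop i <;> rfl
  rw [Data.nth, h, List.drop_eq_getElem_cons hi]
  rfl

@[fun_prop]
theorem PolyTime.nth {f g : Data → Data} (hf : PolyTime f) (hg : PolyTime g) :
    PolyTime (fun y => (f y).nth (g y)) :=
  (PolyTime.fold (g := fun _ r => r.snd) (by fun_prop) 0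
    (fun x r => by have := r.size_snd_le; omega) hf hg).fst

/-- The equality test; `nil` is read as false. -/
def Data.eq : Data → Data → Data
  | .nil, .nil => .cons .nil .nil
  | .cons a b, .cons c d => (a.eq c).ite (b.eq d) .nil
  | _, _ => .nil

theorem Data.eq_of_eq {x y : Data} (h : x = y) : x.eq y = .cons .nil .nil := by
  subst h
  induction x with
  | nil => rfl
  | cons a b ha hb => rw [Data.eq, ha, Data.ite_cons, hb]

theorem Data.eq_of_ne : ∀ {x y : Data}, x ≠ y → x.eq y = .nil
  | .nil, .nil, h => (h rfl).elim
  | .nil, .cons _ _, _ => by rw [Data.eq] <;> simp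
  | .cons _ _, .nil, _ => by rw [Data.eq] <;> simp
  | .cons a b, .cons c d, h => by
    rw [Data.eq]
    by_cases hac : a = c
    · rw [Data.eq_of_eq hac, Data.ite_cons]
      exact Data.eq_of_ne (fun hbd => h (by rw [hac, hbd]))
    · rw [Data.eq_of_ne hac, Data.ite_nil]

theorem Data.eq_ite {P : Prop} [Decidable P] {x y : Data} (h : x = y ↔ P) (u v : Data) :
    (x.eq y).ite u v = if P then u else v := by
  split_ifs with hP
  · rw [Data.eq_of_eq (h.2 hP), Data.ite_cons]
  · rw [Data.eq_of_ne (fun e => hP (h.1 e)), Data.ite_nil]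

@[fun_prop]
theorem PolyTime.eq {f g : Data → Data} (hf : PolyTime f) (hg : PolyTime g) :
    PolyTime (fun y => (f y).eq (g y)) := by
  have key : PolyTime (fun z => z.fst.eq z.snd) := by
    refine PolyTime.recursion
      (calls := fun z => z.fst.ite (z.snd.ite (.cons (.cons z.fst.fst z.snd.fst)
        (.cons (.cons z.fst.snd z.snd.snd) .nil)) .nil) .nil)
      (comb := fun w => w.fst.fst.ite (w.fst.snd.ite (w.snd.snd.fst.ite w.snd.fst .nil) .nil)
        (w.fst.snd.ite .nil (.cons .nil .nil)))
      (by fun_prop) (by fun_prop) ?_ (fun z => z.fst.size) ?_ (fun z => z.size_fst_le) ?_ 3 ?_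
    · rintro (_ | ⟨_ | ⟨a, b⟩, _ | ⟨c, d⟩⟩) <;> simp [Data.toList, Data.eq]
    · rintro (_ | ⟨_ | ⟨a, b⟩, _ | ⟨c, d⟩⟩) <;> simp [Data.toList, Data.size]
    · rintro (_ | ⟨_ | ⟨a, b⟩, _ | ⟨c, d⟩⟩) <;> simp [Data.toList, Data.size]; omega
    · intro z
      by_cases h : z.fst = z.snd
      · rw [Data.eq_of_eq h]; simp [Data.size]
      · rw [Data.eq_of_ne h]; simp [Data.size]
  exact key.comp (hf.cons hg)

theorem encNat_injective : Function.Injective encNat := by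
  intro m
  induction m with
  | zero => rintro (_ | n) h <;> simp_all [encNat]
  | succ m ih =>
    rintro (_ | n) h
    · simp [encNat] at h
    · simp only [encNat, Data.cons.injEq, true_and] at h
      rw [ih h]

end Library

/-! ### Positions in concatenated lists of types -/

section Positions

/-- A position in the left part of a concatenation. -/
def Var.inl {l' : List Ty} : ∀ {l : List Ty} {τ : Ty}, Var l τ → Var (l ++ l') τ
  | _, _, .here => .here
  | _, _, .there x => .there x.inl

/-- A position in the right part of a concatenation. -/
def Var.inr {l' : List Ty} : ∀ (l : List Ty) {τ : Ty}, Var l' τ → Var (l ++ l') τ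
  | [], _, x => x
  | _ :: l, _, x => .there (Var.inr l x)

/-- The part of a concatenation of two lists to which a position belongs. -/
def Var.split {l' : List Ty} : ∀ (l : List Ty) {τ : Ty}, Var (l ++ l') τ → Var l τ ⊕ Var l' τ
  | [], _, x => .inr x
  | _ :: _, _, .here => .inl .here
  | _ :: l, _, .there x => (Var.split l x).map .there _root_.id

@[simp] theorem Var.split_inl {l l' : List Ty} {τ : Ty} (x : Var l τ) :
    Var.split l (x.inl : Var (l ++ l') τ) = .inl x := by
  induction x with
  | here => rfl
  | there x ih => simp [Var.inl, Var.split, ih]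

@[simp] theorem Var.split_inr {l' : List Ty} {τ : Ty} (x : Var l' τ) : ∀ l : List Ty,
    Var.split l (Var.inr l x) = .inr x
  | [] => rfl
  | _ :: l => by simp [Var.inr, Var.split, Var.split_inr x l]

@[simp] theorem Var.index_inl {l l' : List Ty} {τ : Ty} (x : Var l τ) :
    (x.inl : Var (l ++ l') τ).index = x.index := by
  induction x with
  | here => rfl
  | there x ih => simp [Var.inl, Var.index, ih]

@[simp] theorem Var.index_inr {l' : List Ty} {τ : Ty} (x : Var l' τ) : ∀ l : List Ty,
    (Var.inr l x).index = l.length + x.index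
  | [] => by simp [Var.inr]
  | _ :: l => by simp [Var.inr, Var.index, Var.index_inr x l]; omega

theorem Var.index_lt {l : List Ty} {τ : Ty} (x : Var l τ) : x.index < l.length := by
  induction x with
  | here => simp [Var.index]
  | there x ih => simpa [Var.index] using ih

theorem Var.index_injective {l : List Ty} {τ σ : Ty} (x : Var l τ) (y : Var l σ)
    (h : x.index = y.index) : (⟨τ, x⟩ : Σ τ, Var l τ) = ⟨σ, y⟩ := by
  induction x with
  | here =>
    cases y with
    | here => rfl
    | there y => simp [Var.index] at h
  | there x ih =>
    cases y with
    | here => simp [Var.index] at h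
    | there y =>
      have := ih y (by simpa [Var.index] using h)
      cases this
      rfl

variable {α β : Type}

theorem mem_tabulate {a : α} : ∀ {Γ : List Ty} {f : ∀ ⦃τ : Ty⦄, Var Γ τ → α},
    a ∈ tabulate Γ f ↔ ∃ (τ : Ty) (x : Var Γ τ), f x = a
  | [], _ => by
    simp only [tabulate, List.not_mem_nil, false_iff]
    rintro ⟨τ, x, -⟩; nomatch x
  | _ :: Γ, f => by
    rw [tabulate, List.mem_cons, mem_tabulate]
    constructor
    · rintro (rfl | ⟨τ, x, rfl⟩)
      · exact ⟨_, .here, rfl⟩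
      · exact ⟨_, .there x, rfl⟩
    · rintro ⟨τ, x, rfl⟩
      cases x with
      | here => exact .inl rfl
      | there x => exact .inr ⟨_, x, rfl⟩

theorem map_tabulate (g : α → β) : ∀ {Γ : List Ty} (f : ∀ ⦃τ : Ty⦄, Var Γ τ → α),
    (tabulate Γ f).map g = tabulate Γ (fun _ x => g (f x))
  | [], _ => rfl
  | _ :: _, f => congrArg (_ :: ·) (map_tabulate g (fun _ x => f (.there x)))

theorem tabulate_append : ∀ {l l' : List Ty} (f : ∀ ⦃τ : Ty⦄, Var (l ++ l') τ → α),
    tabulate (l ++ l') f =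
      tabulate l (fun _ x => f x.inl) ++ tabulate l' (fun _ x => f (Var.inr l x))
  | [], _, _ => rfl
  | _ :: _, _, f => congrArg (_ :: ·) (tabulate_append (fun _ x => f (.there x)))

theorem tabulate_index : ∀ (Γ : List Ty) (g : Ty → ℕ → α) (k : ℕ),
    tabulate Γ (fun τ x => g τ (k + x.index)) = (Γ.zipIdx k).map (fun p => g p.1 p.2)
  | [], _, _ => rfl
  | σ :: Γ, g, k => by
    rw [tabulate, List.zipIdx_cons, List.map_cons, ← tabulate_index Γ g (k + 1)]
    simp only [Var.index, Nat.add_zero, Nat.add_assoc, Nat.add_comm 1]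

theorem zipIdx_tabulate : ∀ {Γ : List Ty} (f : ∀ ⦃τ : Ty⦄, Var Γ τ → α) (k : ℕ),
    (tabulate Γ f).zipIdx k = tabulate Γ (fun _ x => (f x, k + x.index))
  | [], _, _ => rfl
  | _ :: _, f, k => by
    rw [tabulate, tabulate, List.zipIdx_cons, zipIdx_tabulate]
    simp only [Var.index, Nat.add_zero, Nat.add_assoc, Nat.add_comm 1]

end Positions

/-! ### Reduction of model checking to existential-free MSL(ω) -/

section ToMSL

/-- The position of a terminal among the types of all terminals. -/
def termVar : ∀ (ranks : List ℕ) (a : Fin ranks.length),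
    Var (ranks.map rankTy) (rankTy (ranks.get a))
  | _ :: _, ⟨0, _⟩ => .here
  | _ :: l, ⟨i + 1, h⟩ => .there (termVar l ⟨i, Nat.lt_of_succ_lt_succ h⟩)

/-- The terminal at a position among the types of all terminals. -/
def varTerm : ∀ {ranks : List ℕ} {τ : Ty}, Var (ranks.map rankTy) τ →
    {a : Fin ranks.length // rankTy (ranks.get a) = τ}
  | _ :: _, _, .here => ⟨⟨0, Nat.succ_pos _⟩, rfl⟩
  | _ :: _, _, .there x => ⟨(varTerm x).1.succ, (varTerm x).2⟩

theorem varTerm_termVar : ∀ (ranks : List ℕ) (a : Fin ranks.length),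
    varTerm (termVar ranks a) = ⟨a, rfl⟩
  | _ :: _, ⟨0, _⟩ => rfl
  | _ :: l, ⟨i + 1, h⟩ => by
    have ih := varTerm_termVar l ⟨i, Nat.lt_of_succ_lt_succ h⟩
    apply Subtype.ext
    have := congrArg (fun y => y.1.succ) ih
    exact this

theorem index_termVar : ∀ (ranks : List ℕ) (a : Fin ranks.length),
    (termVar ranks a).index = a
  | _ :: _, ⟨0, _⟩ => rfl
  | _ :: l, ⟨i + 1, h⟩ => by
    simp [termVar, Var.index, index_termVar l ⟨i, Nat.lt_of_succ_lt_succ h⟩]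

variable {ranks : List ℕ} {nts : List Ty}

/-- The symbols of a recursion scheme as constructors. -/
def symbVar : ∀ ⦃τ : Ty⦄, Symb ranks nts τ → Var (ranks.map rankTy ++ nts) τ
  | _, .terminal a rfl => (termVar ranks a).inl
  | _, .nonterminal F => Var.inr _ F

/-- The symbol of a recursion scheme that is represented by a constructor. -/
def varSymb ⦃τ : Ty⦄ (x : Var (ranks.map rankTy ++ nts) τ) : Symb ranks nts τ :=
  match Var.split _ x with
  | .inl y => .terminal (varTerm y).1 (varTerm y).2
  | .inr F => .nonterminal F

theorem varSymb_symbVar ⦃τ : Ty⦄ (c : Symb ranks nts τ) : varSymb (symbVar c) = c := by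
  rcases c with ⟨a, rfl⟩ | F
  · simp [symbVar, varSymb, varTerm_termVar]
  · simp [symbVar, varSymb]

/-- The variables of a clause for a terminal of rank `n`. -/
def rankVar : ∀ {n : ℕ}, Fin n → Var (rankTy n).args .base
  | _ + 1, ⟨0, _⟩ => .here
  | _ + 1, ⟨i + 1, h⟩ => .there (rankVar ⟨i, Nat.lt_of_succ_lt_succ h⟩)

theorem index_rankVar : ∀ {n : ℕ} (i : Fin n), (rankVar i).index = i
  | _ + 1, ⟨0, _⟩ => rfl
  | _ + 1, ⟨i + 1, h⟩ => by
    simp [rankVar, Var.index, index_rankVar ⟨i, Nat.lt_of_succ_lt_succ h⟩]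

theorem subst_rankVar {K : Ty → Type} {Γ : List Ty} : ∀ {n : ℕ} (θ : Subst K (rankTy n).args Γ)
    (i : Fin n), θ (rankVar i) = rankArg θ i
  | _ + 1, _, ⟨0, _⟩ => rfl
  | _ + 1, θ, ⟨i + 1, h⟩ =>
    subst_rankVar (fun _ x => θ (.there x)) ⟨i, Nat.lt_of_succ_lt_succ h⟩

/-- A finite conjunction of goals. -/
def Goal.conj {Sig Γ : List Ty} {n : ℕ} (l : List (Goal Sig n Γ)) : Goal Sig n Γ :=
  l.foldr .and .tt

theorem Goal.sat_conj {Sig Γ : List Ty} {n : ℕ} {A : Fin n → Term (Var Sig) [] .base → Prop}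
    {θ : Subst (Var Sig) Γ []} (l : List (Goal Sig n Γ)) :
    (Goal.conj l).Sat A θ ↔ ∀ G ∈ l, G.Sat A θ := by
  induction l with
  | nil => simp [Goal.conj, Goal.Sat]
  | cons G l ih => simpa [Goal.conj, Goal.Sat] using fun _ => ih

theorem Goal.existentialFree_conj {Sig Γ : List Ty} {n : ℕ} (l : List (Goal Sig n Γ))
    (h : ∀ G ∈ l, G.ExistentialFree) : (Goal.conj l).ExistentialFree := by
  induction l with
  | nil => trivial
  | cons G l ih => exact ⟨h G (by simp), ih fun G hG => h G (List.mem_cons_of_mem _ hG)⟩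

variable (X : ModelCheckingInstance)

/-- The constructors: the terminals and the nonterminals. -/
abbrev ModelCheckingInstance.mslSig : List Ty := X.hors.ranks.map rankTy ++ X.hors.nts

/-- The number of predicates: a predicate for every state `q` (rejection from `q`) and one for every
transition (failure of the transition at the root). -/
abbrev ModelCheckingInstance.mslPreds : ℕ := X.states + X.trans.length

variable {X}

/-- The predicate of a state. -/
abbrev statePred (q : Fin X.states) : Fin X.mslPreds := Fin.castAdd _ q

/-- The predicate of a transition. -/
abbrev transPred (j : Fin X.trans.length) : Fin X.mslPreds := Fin.natAdd _ j

/-- A term of the scheme as a term over the constructors. -/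
abbrev mslTerm {Γ : List Ty} {τ : Ty} (t : Term (Symb X.hors.ranks X.hors.nts) Γ τ) :
    Term (Var X.mslSig) Γ τ :=
  t.mapCst symbVar

variable (X)

/-- A tree whose root is a nonterminal is rejected if its reduct is. -/
def ModelCheckingInstance.ruleClauses : List (Clause X.mslSig X.mslPreds) :=
  (List.finRange X.states).flatMap fun q => tabulate X.hors.nts fun _ F =>
    .con (statePred q) (symbVar (.nonterminal F))
      (.atom (statePred q) (mslTerm (X.hors.rules F)))

/-- The condition that a transition, if it applies in the state `q` to the letter `a`, fails. -/
def ModelCheckingInstance.transGoal (q : Fin X.states) (a : Fin X.hors.ranks.length)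
    (j : Fin X.trans.length) : Goal X.mslSig X.mslPreds (rankTy (X.hors.ranks.get a)).args :=
  if (X.trans.get j).state = q then
    if (X.trans.get j).letter = a then
      .atom (transPred j)
        ((Term.cst (symbVar (.terminal a rfl))).apps (fun _ x => .var x))
    else .tt
  else .tt

/-- A tree whose root is a terminal is rejected from a state if all transitions fail. -/
def ModelCheckingInstance.nodeClauses : List (Clause X.mslSig X.mslPreds) :=
  (List.finRange X.states).flatMap fun q => (List.finRange X.hors.ranks.length).map fun a =>
    .con (statePred q) (symbVar (.terminal a rfl))
      (Goal.conj ((List.finRange X.trans.length).map (X.transGoal q a)))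

/-- A transition fails if a child is rejected from its state. -/
def ModelCheckingInstance.transClauses : List (Clause X.mslSig X.mslPreds) :=
  (List.finRange X.trans.length).flatMap fun j =>
    (List.finRange (X.hors.ranks.get (X.trans.get j).letter)).map fun i =>
      .con (transPred j) (symbVar (.terminal (X.trans.get j).letter rfl))
        (.atom (statePred ((X.trans.get j).succ i)) (.var (rankVar i)))

/-- The instance of MSL(ω) whose goal states that the value tree is rejected. -/
def ModelCheckingInstance.toMSL : Instance where
  sig := X.mslSig
  preds := X.mslPreds
  clauses := X.ruleClauses ++ (X.nodeClauses ++ X.transClauses)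
  goal := .atom (statePred X.init) (mslTerm (.cst (.nonterminal X.hors.start)))

theorem ModelCheckingInstance.toMSL_existentialFree : X.toMSL.ExistentialFree := by
  refine ⟨fun (C : Clause X.mslSig X.mslPreds)
    (hC : C ∈ X.ruleClauses ++ (X.nodeClauses ++ X.transClauses)) => ?_, trivial⟩
  simp only [ruleClauses, nodeClauses, transClauses, List.mem_append, List.mem_flatMap,
    mem_tabulate, List.mem_map] at hC
  obtain ⟨q, -, τ, F, rfl⟩ | ⟨q, -, a, -, rfl⟩ | ⟨j, -, i, -, rfl⟩ := hC
  · trivial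
  · refine Goal.existentialFree_conj _ fun G hG => ?_
    obtain ⟨j, -, rfl⟩ := List.mem_map.1 hG
    unfold transGoal
    split_ifs <;> trivial
  · trivial

variable {X}

theorem ModelCheckingInstance.RejectsIn.provable {N : ℕ} : ∀ {q : Fin X.states} {t : X.hors.Tm},
    X.RejectsIn N q t → Provable X.toMSL.clauses (.atom (statePred q) (mslTerm t)) := by
  induction N with
  | zero => intro q t h; exact h.elim
  | succ N ih =>
    intro q t h
    rcases hx : X.hors.eval t with t' | ⟨a, f⟩
    · have h' := ih ((rejectsIn_inl hx).1 h)
      cases HORS.headStep_iff.2 hx with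
      | rule F θ =>
        rw [mslTerm, Term.mapCst_apps]
        refine .resCon (G := .atom (statePred q) (mslTerm (X.hors.rules F))) _ ?_ ?_
        · refine List.mem_append_left _ (List.mem_flatMap.2 ⟨q, List.mem_finRange q, ?_⟩)
          exact mem_tabulate.2 ⟨_, F, rfl⟩
        · rw [mslTerm, Term.mapCst_subst] at h'
          exact h'
    · obtain rfl := HORS.eq_node_iff.2 hx
      have hr := (rejectsIn_inr hx).1 h
      rw [HORS.node, rankApps_eq_apps, mslTerm, Term.mapCst_apps]
      refine .resCon
        (G := Goal.conj ((List.finRange X.trans.length).map (X.transGoal q a))) _ ?_ ?_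
      · refine List.mem_append_right _ (List.mem_append_left _
          (List.mem_flatMap.2 ⟨q, List.mem_finRange q, List.mem_map.2 ⟨a, List.mem_finRange a, ?_⟩⟩))
        rfl
      · refine Goal.Sat.provable ((Goal.sat_conj _).2 fun G hG => ?_)
        obtain ⟨j, -, rfl⟩ := List.mem_map.1 hG
        unfold transGoal
        split_ifs with hq ha
        · subst ha
          obtain ⟨i, hi⟩ := hr _ (List.get_mem _ j) hq rfl
          rw [Goal.Sat, Term.subst_apps]
          refine .resCon (G := .atom (statePred ((X.trans.get j).succ i)) (.var (rankVar i))) _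
            ?_ ?_
          · refine List.mem_append_right _ (List.mem_append_right _ (List.mem_flatMap.2
              ⟨j, List.mem_finRange j, List.mem_map.2 ⟨i, List.mem_finRange i, rfl⟩⟩))
          · have h' := ih hi
            rw [← congrFun (rankArg_rankSubst f) i, ← subst_rankVar] at h'
            exact h'
        · trivial
        · trivial

/-- The Herbrand interpretation that reads the predicates as rejection and failure. -/
def ModelCheckingInstance.herbrand (X : ModelCheckingInstance) (P : Fin X.mslPreds)
    (t : Term (Var X.mslSig) [] .base) : Prop :=
  (∀ q, P = statePred q → X.Rejects q (t.mapCst varSymb)) ∧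
  (∀ j, P = transPred j → ∃ f : Fin (X.hors.ranks.get (X.trans.get j).letter) → X.hors.Tm,
    X.hors.eval (t.mapCst varSymb) = .inr ⟨(X.trans.get j).letter, f⟩ ∧
      ∃ i, X.Rejects ((X.trans.get j).succ i) (f i))

theorem statePred_ne_transPred (q : Fin X.states) (j : Fin X.trans.length) :
    statePred q ≠ transPred j := by
  intro h
  have := congrArg Fin.val h
  simp only [Fin.val_castAdd, Fin.val_natAdd] at this
  omega

theorem ModelCheckingInstance.rejects_of_provable {q : Fin X.states} {t : X.hors.Tm}
    (h : Provable X.toMSL.clauses (.atom (statePred q) (mslTerm t))) : X.Rejects q t := by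
  have back : ∀ {Γ : List Ty} {τ : Ty} (t : Term (Symb X.hors.ranks X.hors.nts) Γ τ),
      (mslTerm t).mapCst varSymb = t := fun t => Term.mapCst_leftInverse varSymb_symbVar t
  have hs := h.sat X.herbrand ?_ ?_
  · change X.herbrand (statePred q) ((mslTerm t).subst Subst.nil) at hs
    rw [Term.subst_closed] at hs
    have := hs.1 q rfl
    rwa [back] at this
  · intro P G hC
    simp [toMSL, ruleClauses, nodeClauses, transClauses, mem_tabulate] at hC
  · intro P τ c G hC θ hG
    change _ ∈ X.ruleClauses ++ (X.nodeClauses ++ X.transClauses) at hC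
    simp only [ruleClauses, nodeClauses, transClauses, List.mem_append, List.mem_flatMap,
      mem_tabulate, List.mem_map] at hC
    obtain ⟨q, -, τ, F, hF⟩ | ⟨q, -, a, -, ha⟩ | ⟨j, -, i, -, hj⟩ := hC
    · cases hF
      refine ⟨fun q' hq => ?_, fun j hj => (statePred_ne_transPred _ _ hj).elim⟩
      cases Fin.castAdd_injective _ _ hq
      have h1 := hG.1 q rfl
      rw [Term.mapCst_subst, back] at h1
      rw [Term.mapCst_apps, Term.mapCst, varSymb_symbVar]
      exact (rejects_inl (X.hors.eval_nonterminal F _)).2 h1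
    · cases ha
      refine ⟨fun q' hq => ?_, fun j hj => (statePred_ne_transPred _ _ hj).elim⟩
      cases Fin.castAdd_injective _ _ hq
      have he : X.hors.eval (((Term.cst (symbVar (.terminal a rfl))).apps θ).mapCst varSymb) =
          .inr ⟨a, rankArg (θ.mapCst varSymb)⟩ := by
        rw [Term.mapCst_apps, Term.mapCst, varSymb_symbVar, HORS.eval_apps, HORS.head]
      refine (rejects_inr he).2 fun δ hδ hs hl => ?_
      obtain ⟨j, rfl⟩ := List.get_of_mem hδ
      have h1 := (Goal.sat_conj _).1 hG (X.transGoal q a j)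
        (List.mem_map_of_mem (List.mem_finRange j))
      rw [transGoal, if_pos hs, if_pos hl, Goal.Sat, Term.subst_apps] at h1
      obtain ⟨f, hf, i, hi⟩ := h1.2 j rfl
      subst hl
      have he' := he.symm.trans hf
      rw [Sum.inr.injEq, Sigma.mk.injEq] at he'
      obtain rfl := eq_of_heq he'.2
      exact ⟨i, hi⟩
    · cases hj
      refine ⟨fun q hq => (statePred_ne_transPred _ _ hq.symm).elim, fun j' hj => ?_⟩
      cases Fin.natAdd_injective _ _ hj
      have h1 := hG.1 _ rfl
      refine ⟨rankArg (θ.mapCst varSymb), ?_, i, ?_⟩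
      · rw [Term.mapCst_apps, Term.mapCst, varSymb_symbVar, HORS.eval_apps, HORS.head]
      · rw [← subst_rankVar]
        exact h1

/-- The goal of the instance of MSL(ω) is unprovable if and only if the value tree is accepted. -/
theorem ModelCheckingInstance.accepts_iff_not_provable :
    X.Accepts ↔ ¬ Provable X.toMSL.clauses X.toMSL.goal := by
  rw [accepts_iff]
  exact not_congr ⟨fun ⟨_, h⟩ => h.provable, rejects_of_provable⟩

end ToMSL

/-! ### Computation of encodings of terms -/

section TermEncodings

/-- The encoding of an application. -/
def Data.mkApp (s t : Data) : Data := .cons (encNat 2) (.cons s t)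

/-- The encoding of a variable. -/
def Data.mkVar (i : Data) : Data := .cons (encNat 0) i

/-- The encoding of a constant. -/
def Data.mkCst (k : Data) : Data := .cons (encNat 1) k

@[fun_prop]
theorem PolyTime.mkApp {f g : Data → Data} (hf : PolyTime f) (hg : PolyTime g) :
    PolyTime (fun y => Data.mkApp (f y) (g y)) := by
  unfold Data.mkApp; fun_prop

@[fun_prop]
theorem PolyTime.mkVar {f : Data → Data} (hf : PolyTime f) :
    PolyTime (fun y => Data.mkVar (f y)) := by
  unfold Data.mkVar; fun_prop

@[fun_prop]
theorem PolyTime.mkCst {f : Data → Data} (hf : PolyTime f) :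
    PolyTime (fun y => Data.mkCst (f y)) := by
  unfold Data.mkCst; fun_prop

/-- The application of a term to the first `k` variables. -/
def Data.spine (h k : Data) : Data :=
  Data.fold (fun x r => .mkApp r (.mkVar x)) h k.range.reverse

@[fun_prop]
theorem PolyTime.spine {f g : Data → Data} (hf : PolyTime f) (hg : PolyTime g) :
    PolyTime (fun y => Data.spine (f y) (g y)) :=
  PolyTime.fold (g := fun x r => .mkApp r (.mkVar x)) (by fun_prop) 10
    (fun x r => by simp only [Data.mkApp, Data.mkVar, encNat, Data.size]; omega) hf
    (by fun_prop)

theorem encTerm_apps {K : Ty → Type} (encK : ∀ ⦃τ : Ty⦄, K τ → Data) {Γ : List Ty} :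
    ∀ {τ : Ty} (s : Term K Γ τ) (θ : Subst K τ.args Γ), encTerm encK (s.apps θ) =
      (tabulate τ.args (fun _ x => encTerm encK (θ x))).foldl .mkApp (encTerm encK s)
  | .base, _, _ => rfl
  | .arr _ _, s, θ => encTerm_apps encK (Term.app s (θ .here)) (fun _ x => θ (.there x))

theorem tabulate_index_range {α : Type} (Γ : List Ty) (g : ℕ → α) :
    tabulate Γ (fun _ x => g x.index) = (List.range Γ.length).map g := by
  have h := tabulate_index Γ (fun _ i => g i) 0
  simp only [Nat.zero_add] at h
  rw [h, List.range_eq_range', ← List.zipIdx_map_snd 0 Γ, List.map_map]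
  rfl

theorem foldl_mkApp_tabulate (Γ : List Ty) (h : Data) :
    (tabulate Γ (fun _ x => Data.cons (encNat 0) (encNat x.index))).foldl .mkApp h =
      Data.spine h (encNat Γ.length) := by
  rw [tabulate_index_range Γ (fun i => Data.cons (encNat 0) (encNat i))]
  rw [Data.spine, Data.range_encNat, Data.reverse_encList, Data.fold_encList, List.foldr_reverse,
    List.foldl_map, List.foldl_map]
  rfl

theorem encTerm_apps_var {K : Ty → Type} (encK : ∀ ⦃τ : Ty⦄, K τ → Data) {Γ : List Ty} {τ : Ty}
    (s : Term K Γ τ) (r : ∀ ⦃σ : Ty⦄, Var τ.args σ → Var Γ σ)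
    (hr : ∀ ⦃σ : Ty⦄ (x : Var τ.args σ), (r x).index = x.index) :
    encTerm encK (s.apps (fun _ x => .var (r x))) =
      Data.spine (encTerm encK s) (encNat τ.args.length) := by
  rw [encTerm_apps]
  simp only [encTerm, hr]
  exact foldl_mkApp_tabulate _ _

theorem length_args_rankTy : ∀ n : ℕ, (rankTy n).args.length = n
  | 0 => rfl
  | n + 1 => congrArg (· + 1) (length_args_rankTy n)

/-- The replacement of the encodings of the constants in the encoding of a term. -/
def Data.mapCst (g : Data → Data) : Data → Data
  | .nil => .nil
  | .cons a .nil => (a.eq (encNat 1)).ite (.cons a (g .nil)) (.cons a .nil)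
  | .cons a (.cons s t) =>
    (a.eq (encNat 2)).ite (.cons a (.cons (Data.mapCst g s) (Data.mapCst g t)))
      ((a.eq (encNat 1)).ite (.cons a (g (.cons s t))) (.cons a (.cons s t)))

@[fun_prop]
theorem PolyTime.mapCst {g : Data → Data → Data} (hg : PolyTime (fun z => g z.fst z.snd))
    {f : Data → Data} (hf : PolyTime f) : PolyTime (fun y => Data.mapCst (g y) (f y)) := by
  obtain ⟨b, hb⟩ := hg.size_le
  have key : PolyTime (fun z => Data.mapCst (g z.fst) z.snd) := by
    refine PolyTime.recursion
      (calls := fun z => z.snd.snd.ite ((z.snd.fst.eq (encNat 2)).ite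
        (.cons (.cons z.fst z.snd.snd.fst) (.cons (.cons z.fst z.snd.snd.snd) .nil)) .nil) .nil)
      (comb := fun w => w.fst.snd.ite
        (w.snd.ite (.cons w.fst.snd.fst (.cons w.snd.snd.fst w.snd.fst))
          ((w.fst.snd.fst.eq (encNat 1)).ite
            (.cons w.fst.snd.fst (g w.fst.fst w.fst.snd.snd)) w.fst.snd)) .nil)
      (by fun_prop) ?_ ?_ (fun z => z.snd.size) ?_ (fun z => z.size_snd_le) ?_ (.X + b + 3) ?_
    · have := hg.comp (g := fun w => .cons w.fst.fst w.fst.snd.snd) (by fun_prop)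
      exact PolyTime.ite (by fun_prop) (PolyTime.ite (by fun_prop) (by fun_prop)
        (PolyTime.ite (by fun_prop) (PolyTime.cons (by fun_prop) this) (by fun_prop)))
        (by fun_prop)
    · rintro (_ | ⟨p, _ | ⟨a, _ | ⟨s, t⟩⟩⟩)
      · rfl
      · rfl
      · rfl
      · by_cases h : a = encNat 2
        · simp [Data.toList, Data.mapCst, Data.eq_of_eq h]
        · simp [Data.toList, Data.mapCst, Data.eq_of_ne h]
    · rintro (_ | ⟨p, _ | ⟨a, _ | ⟨s, t⟩⟩⟩)
      · simp [Data.toList, Data.size]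
      · simp [Data.toList, Data.size]
      · simp [Data.toList, Data.size]
      · by_cases h : a = encNat 2
        · simp [Data.toList, Data.size, Data.eq_of_eq h]; omega
        · simp [Data.toList, Data.size, Data.eq_of_ne h]
    · rintro (_ | ⟨p, _ | ⟨a, _ | ⟨s, t⟩⟩⟩)
      · simp [Data.toList]
      · simp [Data.toList]
      · simp [Data.toList]
      · by_cases h : a = encNat 2
        · simp [Data.toList, Data.size, Data.eq_of_eq h]; omega
        · simp [Data.toList, Data.eq_of_ne h]
    · have hgb : ∀ p k n, p.size + k.size + 1 ≤ n → (g p k).size ≤ b.eval n := fun p k n hn =>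
        (hb (.cons p k)).trans (eval_le_eval b (by simp only [Data.size]; omega))
      rintro (_ | ⟨p, _ | ⟨a, _ | ⟨s, t⟩⟩⟩)
      · simp [Data.toList, Data.size, Data.mapCst]
      · simp [Data.toList, Data.size, Data.mapCst]
      · by_cases h : a = encNat 1
        · have := hgb p .nil (p.size + (a.size + 1 + 1) + 1) (by simp only [Data.size]; omega)
          simp [Data.toList, Data.size, Data.mapCst, Data.eq_of_eq h]
          omega
        · simp [Data.toList, Data.size, Data.mapCst, Data.eq_of_ne h]
          omega
      · by_cases h : a = encNat 2
        · simp [Data.toList, Data.size, Data.mapCst, Data.eq_of_eq h]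
          omega
        · by_cases h1 : a = encNat 1
          · have := hgb p (.cons s t) (p.size + (a.size + (s.size + t.size + 1) + 1) + 1)
              (by simp only [Data.size]; omega)
            simp [Data.toList, Data.size, Data.mapCst, Data.eq_of_ne h, Data.eq_of_eq h1]
            omega
          · simp [Data.toList, Data.size, Data.mapCst, Data.eq_of_ne h, Data.eq_of_ne h1]
            omega
  exact key.comp (PolyTime.id.cons hf)

theorem encTerm_mapCst {K K' : Ty → Type} {encK : ∀ ⦃τ : Ty⦄, K τ → Data}
    {encK' : ∀ ⦃τ : Ty⦄, K' τ → Data} {f : ∀ ⦃τ : Ty⦄, K τ → K' τ} {g : Data → Data}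
    (h : ∀ ⦃τ : Ty⦄ (c : K τ), encK' (f c) = g (encK c)) {Γ : List Ty} {τ : Ty}
    (t : Term K Γ τ) : encTerm encK' (t.mapCst f) = Data.mapCst g (encTerm encK t) := by
  have h21 : encNat 1 ≠ encNat 2 := fun h => by simpa using encNat_injective h
  have h20 : encNat 0 ≠ encNat 2 := fun h => by simpa using encNat_injective h
  have h10 : encNat 0 ≠ encNat 1 := fun h => by simpa using encNat_injective h
  induction t with
  | var x =>
    simp only [Term.mapCst, encTerm]
    cases encNat x.index <;> simp [Data.mapCst, Data.eq_of_ne h20, Data.eq_of_ne h10]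
  | cst c =>
    simp only [Term.mapCst, encTerm, h]
    cases encK c <;> simp [Data.mapCst, Data.eq_of_ne h21, Data.eq_of_eq]
  | app s t hs ht =>
    simp only [Term.mapCst, encTerm, hs, ht, Data.mapCst, Data.eq_of_eq, Data.ite_cons]

theorem Data.map_encList_map {α : Type} (g : Data → Data) (e : α → Data) (l : List α) :
    (encList (l.map e)).map g = encList (l.map (fun a => g (e a))) := by
  rw [Data.map_encList, List.map_map]; rfl

theorem Data.flatMap_encList_map {α : Type} {g : Data → Data} {e : α → Data} {l : List α}
    (h : α → List Data) (hg : ∀ a, g (e a) = encList (h a)) :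
    (encList (l.map e)).flatMap g = encList (l.flatMap h) := by
  induction l with
  | nil => rfl
  | cons x l ih =>
    simp only [Data.flatMap, List.map_cons, encList_cons, Data.map, Data.fold, hg,
      List.flatMap_cons] at *
    rw [ih, Data.append_encList]

theorem range_map_eq_finRange {α : Type} (n : ℕ) (g : ℕ → α) :
    (List.range n).map g = (List.finRange n).map (fun i => g i.val) := by
  rw [← List.map_coe_finRange_eq_range, List.map_map]; rfl

theorem Data.range_encNat' (n : ℕ) :
    (encNat n).range = encList ((List.finRange n).map (fun i => encNat i.val)) := by
  rw [Data.range_encNat, range_map_eq_finRange]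

theorem zipIdx_eq_finRange {α : Type} (l : List α) :
    l.zipIdx = (List.finRange l.length).map (fun i => (l.get i, i.val)) := by
  apply List.ext_getElem <;> simp

theorem Data.zipIdx_encList_map {α : Type} (e : α → Data) (l : List α) :
    (encList (l.map e)).zipIdx =
      encList ((List.finRange l.length).map (fun i => .cons (e (l.get i)) (encNat i.val))) := by
  rw [Data.zipIdx_encList, List.zipIdx_map, zipIdx_eq_finRange]
  simp [List.map_map, Function.comp_def]

theorem Data.zipIdx_encList_ofFn {n : ℕ} (f : Fin n → Data) :
    (encList (List.ofFn f)).zipIdx =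
      encList ((List.finRange n).map (fun i => .cons (f i) (encNat i.val))) := by
  rw [Data.zipIdx_encList]
  congr 1
  apply List.ext_getElem <;> simp

theorem Data.zipIdx_tabulate {Γ : List Ty} (f : ∀ ⦃τ : Ty⦄, Var Γ τ → Data) :
    (encList (tabulate Γ f)).zipIdx =
      encList (tabulate Γ (fun _ x => .cons (f x) (encNat x.index))) := by
  rw [Data.zipIdx_encList, MSL.zipIdx_tabulate, map_tabulate]
  simp

end TermEncodings

/-! ### The reduction of model checking to MSL(ω) is computable in polynomial time -/

section ToMSLComputable

/-- The conversion of encodings of symbols to encodings of constructors, for `r` terminals. -/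
def Data.symbVar (r k : Data) : Data := k.fst.ite (r.append k.snd) k.snd

/-- The conversion of the encoding of a term. -/
def Data.mslTerm (r t : Data) : Data := t.mapCst (Data.symbVar r)

/-- The encoding of the clauses for the nonterminals. -/
def Data.ruleClauses (r states rules : Data) : Data :=
  states.range.flatMap fun q => rules.zipIdx.map fun p =>
    .cons (encNat 1) (.cons q (.cons (r.append p.snd)
      (.cons (encNat 1) (.cons q (Data.mslTerm r p.fst)))))

/-- The encoding of the condition that a transition `d` fails. -/
def Data.transGoal (states q k a d : Data) : Data :=
  (d.fst.fst.eq q).ite ((d.fst.snd.fst.eq a).ite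
    (.cons (encNat 1) (.cons (states.append d.snd) (Data.spine (.mkCst a) k)))
    (.cons (encNat 0) .nil)) (.cons (encNat 0) .nil)

/-- The encoding of a conjunction. -/
def Data.conj (l : Data) : Data :=
  Data.fold (fun x r => .cons (encNat 2) (.cons x r)) (.cons (encNat 0) .nil) l

/-- The encoding of the clauses for the terminals. -/
def Data.nodeClauses (states ranks trans : Data) : Data :=
  states.range.flatMap fun q => ranks.zipIdx.map fun p =>
    .cons (encNat 1) (.cons q (.cons p.snd
      (Data.conj (trans.zipIdx.map (fun d => Data.transGoal states q p.fst p.snd d)))))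

/-- The encoding of the clauses for the transitions. -/
def Data.transClauses (states trans : Data) : Data :=
  trans.zipIdx.flatMap fun d => d.fst.snd.snd.zipIdx.map fun p =>
    .cons (encNat 1) (.cons (states.append d.snd) (.cons d.fst.snd.fst
      (.cons (encNat 1) (.cons p.fst (.mkVar p.snd)))))

/-- The encoding of the instance of MSL(ω) for an instance of model checking. -/
def Data.toMSL (x : Data) : Data :=
  .cons (x.fst.fst.append x.fst.snd.fst)
    (.cons (x.snd.fst.append x.snd.snd.snd.length)
      (.cons ((Data.ruleClauses x.fst.fst.length x.snd.fst x.fst.snd.snd.snd).append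
          ((Data.nodeClauses x.snd.fst x.fst.fst x.snd.snd.snd).append
            (Data.transClauses x.snd.fst x.snd.snd.snd)))
        (.cons (encNat 1) (.cons x.snd.snd.fst
          (.mkCst (x.fst.fst.length.append x.fst.snd.snd.fst))))))

@[fun_prop]
theorem PolyTime.conj {f : Data → Data} (hf : PolyTime f) :
    PolyTime (fun y => Data.conj (f y)) :=
  PolyTime.fold (g := fun x r => .cons (encNat 2) (.cons x r)) (by fun_prop) 7
    (fun x r => by simp only [encNat, Data.size]; omega) (PolyTime.const _) hf

theorem polyTime_toMSL : PolyTime Data.toMSL := by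
  unfold Data.toMSL Data.ruleClauses Data.nodeClauses Data.transClauses Data.transGoal
    Data.mslTerm Data.symbVar
  fun_prop

variable (X : ModelCheckingInstance)

theorem encTerm_mslTerm {Γ : List Ty} {τ : Ty} (t : Term (Symb X.hors.ranks X.hors.nts) Γ τ) :
    encTerm (fun _ c => encNat c.index) (mslTerm t) =
      Data.mslTerm (encNat X.hors.ranks.length) (encTerm encSymb t) := by
  refine encTerm_mapCst (fun τ c => ?_) t
  rcases c with ⟨a, rfl⟩ | F
  · simp [MSL.symbVar, encSymb, Data.symbVar, index_termVar, encNat]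
  · simp [MSL.symbVar, encSymb, Data.symbVar, encNat]

theorem enc_ruleClauses : encList (X.ruleClauses.map encClause) =
    Data.ruleClauses (encNat X.hors.ranks.length) (encNat X.states)
      (encList (tabulate X.hors.nts (fun _ F => encTerm encSymb (X.hors.rules F)))) := by
  unfold Data.ruleClauses ModelCheckingInstance.ruleClauses
  rw [Data.range_encNat', Data.zipIdx_tabulate, List.map_flatMap,
    Data.flatMap_encList_map (fun q => _) (fun q => ?_)]
  rw [Data.map_encList, map_tabulate, map_tabulate]
  simp only [Data.fst_cons, Data.snd_cons, encClause, encGoal, encTerm_mslTerm, MSL.symbVar,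
    Var.index_inr, List.length_map, Data.append_encNat, Fin.val_castAdd]

theorem enc_transGoal (q : Fin X.states) (a : Fin X.hors.ranks.length) (j : Fin X.trans.length) :
    encGoal (X.transGoal q a j) = Data.transGoal (encNat X.states) (encNat q)
      (encNat (X.hors.ranks.get a)) (encNat a) (.cons (X.trans.get j).enc (encNat j)) := by
  unfold Data.transGoal ModelCheckingInstance.transGoal Transition.enc
  have h1 : ∀ {n : ℕ} (i j : Fin n), encNat i = encNat j ↔ i = j := fun i j =>
    ⟨fun h => Fin.ext (encNat_injective h), fun h => h ▸ rfl⟩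
  simp only [Data.fst_cons, Data.snd_cons]
  rw [Data.eq_ite (h1 _ _), Data.eq_ite (h1 _ _)]
  split_ifs
  · rw [encGoal, encTerm_apps_var _ _ (fun _ x => x) (fun _ _ => rfl), length_args_rankTy]
    simp [encTerm, MSL.symbVar, index_termVar, Data.mkCst]
  · rfl
  · rfl

theorem enc_conj {Sig Γ : List Ty} {n : ℕ} (l : List (Goal Sig n Γ)) :
    encGoal (Goal.conj l) = Data.conj (encList (l.map encGoal)) := by
  rw [Data.conj, Data.fold_encList]
  induction l with
  | nil => rfl
  | cons G l ih => simp only [Goal.conj, List.foldr_cons, List.map_cons, encGoal] at *; rw [ih]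

theorem enc_nodeClauses : encList (X.nodeClauses.map encClause) =
    Data.nodeClauses (encNat X.states) (encList (X.hors.ranks.map encNat))
      (encList (X.trans.map Transition.enc)) := by
  unfold Data.nodeClauses ModelCheckingInstance.nodeClauses
  rw [Data.range_encNat', Data.zipIdx_encList_map, Data.zipIdx_encList_map, List.map_flatMap,
    Data.flatMap_encList_map (fun q => _) (fun q => ?_)]
  rw [Data.map_encList_map, List.map_map]
  simp only [Function.comp_def, Data.map_encList_map, encClause, enc_conj, List.map_map,
    enc_transGoal, Data.fst_cons, Data.snd_cons, MSL.symbVar, Var.index_inl, index_termVar,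
    Fin.val_castAdd]

theorem enc_transClauses : encList (X.transClauses.map encClause) =
    Data.transClauses (encNat X.states) (encList (X.trans.map Transition.enc)) := by
  unfold Data.transClauses ModelCheckingInstance.transClauses
  rw [Data.zipIdx_encList_map, List.map_flatMap,
    Data.flatMap_encList_map (fun q => _) (fun j => ?_)]
  simp only [Transition.enc, Data.fst_cons, Data.snd_cons]
  rw [Data.zipIdx_encList_ofFn, Data.map_encList_map, List.map_map]
  simp only [Function.comp_def, Data.fst_cons, Data.snd_cons, encClause, encGoal, encTerm,
    MSL.symbVar, Var.index_inl, index_termVar, index_rankVar, Data.mkVar, Data.append_encNat,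
    Fin.val_castAdd, Fin.val_natAdd]

theorem enc_toMSL : X.toMSL.enc = Data.toMSL X.enc := by
  have hsig : X.mslSig.map encTy = X.hors.ranks.map encNat ++ X.hors.nts.map encTy := by
    have : ∀ n, encTy (rankTy n) = encNat n := fun n => by
      induction n with
      | zero => rfl
      | succ n ih => rw [rankTy, encTy, ih]; rfl
    simp [this]
  have hs : (Var.inr (X.hors.ranks.map rankTy) X.hors.start).index =
      X.hors.ranks.length + X.hors.start.index := by simp
  change Data.cons (encList (X.mslSig.map encTy)) (.cons (encNat (X.states + X.trans.length))
    (.cons (encList ((X.ruleClauses ++ (X.nodeClauses ++ X.transClauses)).map encClause))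
      (.cons (encNat 1) (.cons (encNat X.init) (.mkCst (encNat (Var.inr _ X.hors.start).index))))))
    = _
  simp only [Data.toMSL, ModelCheckingInstance.enc, HORS.enc, Data.fst_cons, Data.snd_cons,
    Data.length_encList, List.length_map, hsig, hs, List.map_append, Data.append_encList,
    Data.append_encNat, ← enc_ruleClauses, ← enc_nodeClauses, ← enc_transClauses]

end ToMSLComputable

/-! ### Reduction of MSL(ω) to model checking: the recursion scheme -/

section Snoc

/-- The type with an additional last argument. -/
def Ty.snoc : Ty → Ty → Ty
  | .base, κ => .arr κ .base
  | .arr a b, κ => .arr a (b.snoc κ)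

/-- The domain of an arrow type. -/
def Ty.dom : Ty → Ty
  | .base => .base
  | .arr a _ => a

/-- The codomain of an arrow type. -/
def Ty.cod : Ty → Ty
  | .base => .base
  | .arr _ b => b

/-- The position of the additional argument. -/
def Var.snocLast {κ : Ty} : ∀ τ : Ty, Var (τ.snoc κ).args κ
  | .base => .here
  | .arr _ b => .there (Var.snocLast b)

/-- The position of an old argument after the addition of a last argument. -/
def Var.snocWeak {κ : Ty} : ∀ {τ σ : Ty}, Var τ.args σ → Var (τ.snoc κ).args σ
  | .arr _ _, _, .here => .here
  | .arr _ b, _, .there x => .there (Var.snocWeak (τ := b) x)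

theorem Var.index_snocLast {κ : Ty} : ∀ τ : Ty,
    (Var.snocLast τ : Var (τ.snoc κ).args κ).index = τ.args.length
  | .base => rfl
  | .arr _ b => congrArg (· + 1) (Var.index_snocLast b)

theorem Var.index_snocWeak {κ : Ty} : ∀ {τ σ : Ty} (x : Var τ.args σ),
    (Var.snocWeak x : Var (τ.snoc κ).args σ).index = x.index
  | .arr _ _, _, .here => rfl
  | .arr _ b, _, .there x => congrArg (· + 1) (Var.index_snocWeak (τ := b) x)

variable {K : Ty → Type} {Γ Δ : List Ty} {κ : Ty}

/-- The application of a term to all arguments but the last. -/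
def Term.appsSnoc : ∀ {τ : Ty}, Term K Γ (τ.snoc κ) → Subst K τ.args Γ →
    Term K Γ (.arr κ .base)
  | .base, s, _ => s
  | .arr _ b, s, θ => Term.appsSnoc (τ := b) (.app s (θ .here)) (fun _ x => θ (.there x))

/-- The list of arguments with an additional last argument. -/
def Subst.snoc : ∀ {τ : Ty}, Subst K τ.args Γ → Term K Γ κ → Subst K (τ.snoc κ).args Γ
  | .base, θ, t => Subst.cons t θ
  | .arr _ b, θ, t => Subst.cons (θ .here) (Subst.snoc (τ := b) (fun _ x => θ (.there x)) t)

theorem Term.app_appsSnoc : ∀ {τ : Ty} (s : Term K Γ (τ.snoc κ)) (θ : Subst K τ.args Γ)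
    (t : Term K Γ κ), Term.app (s.appsSnoc θ) t = s.apps (θ.snoc t)
  | .base, _, _, _ => rfl
  | .arr _ b, s, θ, t =>
    Term.app_appsSnoc (τ := b) (.app s (θ .here)) (fun _ x => θ (.there x)) t

theorem Subst.snoc_last : ∀ {τ : Ty} (θ : Subst K τ.args Γ) (t : Term K Γ κ),
    θ.snoc t (Var.snocLast τ) = t
  | .base, _, _ => rfl
  | .arr _ b, θ, t => Subst.snoc_last (τ := b) (fun _ x => θ (.there x)) t

theorem Subst.snoc_weak : ∀ {τ σ : Ty} (θ : Subst K τ.args Γ) (t : Term K Γ κ)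
    (x : Var τ.args σ), θ.snoc t (Var.snocWeak x) = θ x
  | .arr _ _, _, _, _, .here => rfl
  | .arr _ b, _, θ, t, .there x =>
    Subst.snoc_weak (τ := b) (fun _ x => θ (.there x)) t x

theorem Term.subst_appsSnoc (σ : Subst K Γ Δ) : ∀ {τ : Ty} (s : Term K Γ (τ.snoc κ))
    (θ : Subst K τ.args Γ), (s.appsSnoc θ).subst σ = (s.subst σ).appsSnoc (θ.comp σ)
  | .base, _, _ => rfl
  | .arr _ b, s, θ =>
    Term.subst_appsSnoc σ (τ := b) (.app s (θ .here)) (fun _ x => θ (.there x))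

end Snoc

section Elimination

/-- Case distinction on the positions of a nonempty list. -/
def Var.consElim {M : Ty → Type} {σ : Ty} {l : List Ty} (a : M σ)
    (f : ∀ ⦃τ : Ty⦄, Var l τ → M τ) : ∀ ⦃τ : Ty⦄, Var (σ :: l) τ → M τ
  | _, .here => a
  | _, .there x => f x

/-- Case distinction on the positions of a concatenation. -/
def Var.appendElim {M : Ty → Type} {l l' : List Ty} (f : ∀ ⦃τ : Ty⦄, Var l τ → M τ)
    (g : ∀ ⦃τ : Ty⦄, Var l' τ → M τ) ⦃τ : Ty⦄ (x : Var (l ++ l') τ) : M τ :=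
  (Var.split l x).elim (fun y => f y) (fun y => g y)

@[simp] theorem Var.appendElim_inl {M : Ty → Type} {l l' : List Ty}
    (f : ∀ ⦃τ : Ty⦄, Var l τ → M τ) (g : ∀ ⦃τ : Ty⦄, Var l' τ → M τ) {τ : Ty} (x : Var l τ) :
    Var.appendElim f g x.inl = f x := by
  simp [Var.appendElim]

@[simp] theorem Var.appendElim_inr {M : Ty → Type} {l l' : List Ty}
    (f : ∀ ⦃τ : Ty⦄, Var l τ → M τ) (g : ∀ ⦃τ : Ty⦄, Var l' τ → M τ) {τ : Ty} (x : Var l' τ) :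
    Var.appendElim f g (Var.inr l x) = g x := by
  simp [Var.appendElim]

/-- A position of a list as a position of its image under `f`. -/
def Var.map (f : Ty → Ty) : ∀ {l : List Ty} {τ : Ty}, Var l τ → Var (l.map f) (f τ)
  | _, _, .here => .here
  | _, _, .there x => .there (x.map f)

/-- Functions on the positions of a mapped list. -/
def Var.mapElim {M : Ty → Type} {f : Ty → Ty} : ∀ {l : List Ty},
    (∀ ⦃τ : Ty⦄, Var l τ → M (f τ)) → ∀ ⦃τ : Ty⦄, Var (l.map f) τ → M τ
  | _ :: _, g, _, .here => g .here
  | _ :: _, g, _, .there x => Var.mapElim (fun _ y => g (.there y)) x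

@[simp] theorem Var.mapElim_map {M : Ty → Type} {f : Ty → Ty} {l : List Ty} {τ : Ty}
    (x : Var l τ) : ∀ (g : ∀ ⦃τ : Ty⦄, Var l τ → M (f τ)), Var.mapElim g (x.map f) = g x := by
  induction x with
  | here => intro g; rfl
  | there x ih => intro g; exact ih _

@[simp] theorem Var.index_map (f : Ty → Ty) {l : List Ty} {τ : Ty} (x : Var l τ) :
    (x.map f).index = x.index := by
  induction x with
  | here => rfl
  | there x ih => simp [Var.map, Var.index, ih]

theorem mem_iff_nonempty_var {l : List Ty} {τ : Ty} : τ ∈ l ↔ Nonempty (Var l τ) := by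
  constructor
  · intro h
    induction l with
    | nil => simp at h
    | cons σ l ih =>
      rcases List.mem_cons.1 h with rfl | h
      · exact ⟨.here⟩
      · exact (ih h).map .there
  · rintro ⟨x⟩
    induction x with
    | here => simp
    | there x ih => exact List.mem_cons_of_mem _ ih

end Elimination

section Scheme

/-- The ranks of the terminals of the scheme. All terminals are binary; there are three of them in
addition to one terminal for every predicate. -/
abbrev mcRanks (n : ℕ) : List ℕ := List.replicate (n + 3) 2

theorem rankTy_mcRanks {n : ℕ} (a : Fin (mcRanks n).length) :
    rankTy ((mcRanks n).get a) = .arr .base (.arr .base .base) := by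
  simp [rankTy]

/-- The terminal of a tree both of whose children have to be accepted. -/
def allLetter (n : ℕ) : Fin (mcRanks n).length := ⟨0, by simp⟩

/-- The terminal of a tree one of whose children has to be accepted. -/
def andLetter (n : ℕ) : Fin (mcRanks n).length := ⟨1, by simp⟩

/-- The terminal of a tree that is rejected. -/
def ttLetter (n : ℕ) : Fin (mcRanks n).length := ⟨2, by simp⟩

/-- The terminal of a predicate. -/
def litLetter {n : ℕ} (P : Fin n) : Fin (mcRanks n).length := ⟨P + 3, by simp⟩

variable {n : ℕ} {sig sp nts : List Ty} {Γ Δ : List Ty}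

/-- Terms of the scheme. -/
abbrev McTerm (n : ℕ) (nts Γ : List Ty) (τ : Ty) : Type := Term (Symb (mcRanks n) nts) Γ τ

/-- The application of a binary terminal. -/
def mcNode (a : Fin (mcRanks n).length) (s t : McTerm n nts Γ .base) : McTerm n nts Γ .base :=
  .app (.app (.cst (.terminal a (rankTy_mcRanks a))) s) t

/-- The type of the nonterminal that enumerates the applications of terms of type `τ`. -/
def enumTy (τ : Ty) : Ty := .arr (.arr τ.cod .base) .base

/-- The type of the nonterminal that enumerates the applications of a given term of type `τ`. -/
def pushTy (τ : Ty) : Ty := .arr (.arr τ.cod .base) (.arr τ .base)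

/-- The type of the nonterminal that passes an application of a term of type `τ` on. -/
def pappTy (τ : Ty) : Ty := .arr (.arr τ.cod .base) (.arr τ (.arr τ.dom .base))

/-- The positions of the nonterminals that do not depend on the formulas: a diverging nonterminal,
the constructors, and three nonterminals for every arrow type `τ` in the list `sp`. -/
structure Embed (sig sp nts : List Ty) where
  omega : Var nts .base
  con : ∀ ⦃τ : Ty⦄, Var sig τ → Var nts τ
  enum : ∀ ⦃τ : Ty⦄, Var sp τ → Var nts (enumTy τ)
  push : ∀ ⦃τ : Ty⦄, Var sp τ → Var nts (pushTy τ)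
  papp : ∀ ⦃τ : Ty⦄, Var sp τ → Var nts (pappTy τ)

variable (I : Embed sig sp nts)

/-- The term that generates the undefined tree. -/
def Embed.bot (n : ℕ) {Γ : List Ty} : McTerm n nts Γ .base := .cst (.nonterminal I.omega)

/-- A term over the constructors as a term of the scheme. -/
def Embed.term (n : ℕ) {Γ : List Ty} {τ : Ty} (t : Term (Var sig) Γ τ) : McTerm n nts Γ τ :=
  t.mapCst (fun _ c => .nonterminal (I.con c))

open Classical in
/-- The continuation `k` applied to the constructor `c`, if `c` has type `κ`. -/
noncomputable def Embed.tryCon {κ : Ty} (k : McTerm n nts Γ (.arr κ .base)) {τ : Ty}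
    (c : Var sig τ) : McTerm n nts Γ .base :=
  if h : τ = κ then .app k (.cst (.nonterminal (I.con (h ▸ c)))) else I.bot n

open Classical in
/-- The enumeration of the applications of terms of type `τ`, if they have type `κ`. -/
noncomputable def Embed.tryEnum {κ : Ty} (k : McTerm n nts Γ (.arr κ .base)) {τ : Ty}
    (x : Var sp τ) : McTerm n nts Γ .base :=
  if h : κ = τ.cod then .app (.cst (.nonterminal (I.enum x))) (h ▸ k) else I.bot n

/-- The tree that is accepted if all trees generated by the terms of a list are. -/
def Embed.all (l : List (McTerm n nts Γ .base)) : McTerm n nts Γ .base :=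
  l.foldr (mcNode (allLetter n)) (I.bot n)

/-- The tree that is accepted if the trees generated by the applications of `k` to all closed terms
of type `κ` are. -/
noncomputable def Embed.forall {κ : Ty} (k : McTerm n nts Γ (.arr κ .base)) :
    McTerm n nts Γ .base :=
  I.all (tabulate sig (fun _ c => I.tryCon k c) ++ tabulate sp (fun _ x => I.tryEnum k x))

/-- The right-hand side `∀ f : τ. push k f` of the rule for `enum k`. -/
noncomputable def Embed.enumRule (n : ℕ) {τ : Ty} (x : Var sp τ) :
    McTerm n nts (enumTy τ).args .base :=
  I.forall (κ := τ) (.app (.cst (.nonterminal (I.push x))) (.var .here))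

/-- The right-hand side `∀ y : τ.dom. papp k f y` of the rule for `push k f`. -/
noncomputable def Embed.pushRule (n : ℕ) {τ : Ty} (x : Var sp τ) :
    McTerm n nts (pushTy τ).args .base :=
  I.forall (κ := τ.dom)
    (.app (.app (.cst (.nonterminal (I.papp x))) (.var .here)) (.var (.there .here)))

/-- The right-hand side `k (f y)` of the rule for `papp k f y`. -/
def Embed.pappRule (n : ℕ) : ∀ {τ : Ty}, Var sp τ → McTerm n nts (pappTy τ).args .base
  | .base, _ => I.bot n
  | .arr _ _, _ =>
    .app (.var .here) (.app (.var (.there .here)) (.var (.there (.there .here))))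

/-- The types of the nonterminals for the subgoals of a goal whose variables are the arguments of
the type `τ`. -/
def goalSyms : ∀ {Γ : List Ty}, Goal sig n Γ → Ty → List Ty
  | _, .tt, τ => [τ]
  | _, .atom _ _, τ => [τ]
  | _, .and G H, τ => τ :: (goalSyms G τ ++ goalSyms H τ)
  | _, .ex κ G, τ => τ :: τ.snoc κ :: goalSyms G (.arr κ τ)

/-- The nonterminal for a goal itself. -/
def goalRoot : ∀ {Γ : List Ty} (G : Goal sig n Γ) (τ : Ty), Var (goalSyms G τ) τ
  | _, .tt, _ => .here
  | _, .atom _ _, _ => .here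
  | _, .and _ _, _ => .here
  | _, .ex _ _, _ => .here

/-- The right-hand sides of rules for a list of nonterminals. -/
abbrev McRules (n : ℕ) (nts l : List Ty) : Type :=
  ∀ ⦃σ : Ty⦄, Var l σ → McTerm n nts σ.args .base

/-- The right-hand sides of the rules for the subgoals of a goal. An existential goal has two
nonterminals, since the witness is the last argument in the enumeration of the witnesses and the
first variable of the subgoal. -/
noncomputable def Embed.goalRules : ∀ {Γ : List Ty} (G : Goal sig n Γ) (τ : Ty)
    (_ : Γ = τ.args) (_ : ∀ ⦃σ : Ty⦄, Var (goalSyms G τ) σ → Var nts σ),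
      McRules n nts (goalSyms G τ)
  | _, .tt, τ, _, _ =>
    Var.consElim (M := fun σ => McTerm n nts σ.args .base) (σ := τ)
      (mcNode (ttLetter n) (I.bot n) (I.bot n)) (fun _ v => nomatch v)
  | _, .atom P t, τ, h, _ =>
    Var.consElim (M := fun σ => McTerm n nts σ.args .base) (σ := τ)
      (mcNode (litLetter P) (h ▸ I.term n t) (I.bot n)) (fun _ v => nomatch v)
  | _, .and G H, τ, h, e =>
    Var.consElim (M := fun σ => McTerm n nts σ.args .base) (σ := τ)
      (mcNode (andLetter n)
        ((Term.cst (.nonterminal (e (.there (goalRoot G τ).inl)))).apps (fun _ x => .var x))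
        ((Term.cst (.nonterminal (e (.there (Var.inr _ (goalRoot H τ)))))).apps
          (fun _ x => .var x)))
      (Var.appendElim (M := fun σ => McTerm n nts σ.args .base)
        (Embed.goalRules G τ h (fun _ v => e (.there v.inl)))
        (Embed.goalRules H τ h (fun _ v => e (.there (Var.inr _ v)))))
  | _, .ex κ G, τ, h, e =>
    Var.consElim (M := fun σ => McTerm n nts σ.args .base) (σ := τ)
      (I.forall (Term.appsSnoc (τ := τ) (.cst (.nonterminal (e (.there .here))))
        (fun _ x => .var x)))
      (Var.consElim (M := fun σ => McTerm n nts σ.args .base) (σ := τ.snoc κ)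
        (Term.apps (τ := .arr κ τ) (.cst (.nonterminal (e (.there (.there (goalRoot G _))))))
          (Subst.cons (.var (Var.snocLast τ)) (fun _ x => .var (Var.snocWeak x))))
        (Embed.goalRules G (.arr κ τ) (congrArg (κ :: ·) h)
          (fun _ v => e (.there (.there v)))))

/-- The type whose arguments are the variables of a clause. -/
def Clause.ty : Clause sig n → Ty
  | .var _ _ => .arr .base .base
  | .con (τ := τ) _ _ _ => τ

/-- The predicate in the head of a clause. -/
def Clause.pred : Clause sig n → Fin n
  | .var P _ => P
  | .con P _ _ => P

/-- The body of a clause, with the arguments of `Clause.ty` as variables. -/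
def Clause.body : ∀ C : Clause sig n, Goal sig n C.ty.args
  | .var _ G => G
  | .con _ _ G => G

/-- The types of the nonterminals for the bodies of clauses. -/
def clauseSyms : List (Clause sig n) → List Ty
  | [] => []
  | C :: l => goalSyms C.body C.ty ++ clauseSyms l

/-- The right-hand sides of the rules for the bodies of clauses. -/
noncomputable def Embed.clauseRules : ∀ (l : List (Clause sig n))
    (_ : ∀ ⦃σ : Ty⦄, Var (clauseSyms l) σ → Var nts σ), McRules n nts (clauseSyms l)
  | [], _ => fun _ v => nomatch v
  | C :: l, e =>
    Var.appendElim (M := fun σ => McTerm n nts σ.args .base)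
      (I.goalRules C.body C.ty rfl (fun _ v => e v.inl))
      (Embed.clauseRules l (fun _ v => e (Var.inr _ v)))

/-- The clauses together with the nonterminals for their bodies. -/
def locate : ∀ (l : List (Clause sig n)) (_ : ∀ ⦃σ : Ty⦄, Var (clauseSyms l) σ → Var nts σ),
    List (Σ C : Clause sig n, Var nts C.ty)
  | [], _ => []
  | C :: l, e => ⟨C, e (goalRoot C.body C.ty).inl⟩ :: locate l (fun _ v => e (Var.inr _ v))

open Classical in
/-- The body of a clause, as far as the clause applies to a term with the constructor `c`. -/
noncomputable def Embed.tryClause {τ : Ty} (c : Var sig τ) :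
    (Σ C : Clause sig n, Var nts C.ty) → McTerm n nts τ.args .base
  | ⟨.var _ _, F⟩ => .app (.cst (.nonterminal F))
      ((Term.cst (.nonterminal (I.con c))).apps (fun _ x => .var x))
  | ⟨.con (τ := σ) _ d _, F⟩ =>
    if h : (⟨σ, d⟩ : Σ σ, Var sig σ) = ⟨τ, c⟩ then
      (Term.cst (.nonterminal ((Sigma.mk.inj h).1 ▸ (F : Var nts σ)))).apps
        (fun _ x => .var x)
    else I.bot n

/-- The right-hand side of the rule for a constructor: the list of the bodies of the clauses, each
labelled with the predicate in the head. -/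
noncomputable def Embed.conRule (L : List (Σ C : Clause sig n, Var nts C.ty)) {τ : Ty}
    (c : Var sig τ) : McTerm n nts τ.args .base :=
  L.foldr (fun p r => mcNode (litLetter p.1.pred) (I.tryClause c p) r) (I.bot n)

/-- The arrow types among a type and its iterated codomains. -/
def Ty.suffixes : Ty → List Ty
  | .base => []
  | .arr a b => .arr a b :: b.suffixes

variable (X : Instance)

/-- The arrow types of the partial applications of constructors. -/
def Instance.spine : List Ty := X.sig.flatMap Ty.suffixes

/-- The types of the nonterminals of the scheme. -/
abbrev Instance.mcNts : List Ty :=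
  .base :: (X.sig ++ (X.spine.map enumTy ++ (X.spine.map pushTy ++ (X.spine.map pappTy ++
    (clauseSyms X.clauses ++ goalSyms X.goal .base)))))

/-- The positions of the nonterminals. -/
def Instance.embed : Embed X.sig X.spine X.mcNts where
  omega := .here
  con _ c := .there c.inl
  enum _ x := .there (Var.inr _ (x.map enumTy).inl)
  push _ x := .there (Var.inr _ (Var.inr _ (x.map pushTy).inl))
  papp _ x := .there (Var.inr _ (Var.inr _ (Var.inr _ (x.map pappTy).inl)))

/-- The positions of the nonterminals for the bodies of the clauses. -/
def Instance.clauseEmb ⦃σ : Ty⦄ (v : Var (clauseSyms X.clauses) σ) : Var X.mcNts σ :=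
  .there (Var.inr _ (Var.inr _ (Var.inr _ (Var.inr _ v.inl))))

/-- The positions of the nonterminals for the goal. -/
def Instance.goalEmb ⦃σ : Ty⦄ (v : Var (goalSyms X.goal .base) σ) : Var X.mcNts σ :=
  .there (Var.inr _ (Var.inr _ (Var.inr _ (Var.inr _ (Var.inr _ v)))))

/-- The clauses of an instance together with the nonterminals for their bodies. -/
def Instance.located : List (Σ C : Clause X.sig X.preds, Var X.mcNts C.ty) :=
  locate X.clauses X.clauseEmb

/-- The right-hand sides of the rules. -/
noncomputable def Instance.mcRules : McRules X.preds X.mcNts X.mcNts :=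
  Var.consElim (M := fun σ => McTerm X.preds X.mcNts σ.args .base)
    (X.embed.bot X.preds)
    (Var.appendElim (M := fun σ => McTerm X.preds X.mcNts σ.args .base)
      (fun _ c => X.embed.conRule X.located c)
      (Var.appendElim (M := fun σ => McTerm X.preds X.mcNts σ.args .base)
        (Var.mapElim (M := fun σ => McTerm X.preds X.mcNts σ.args .base)
          (fun _ x => X.embed.enumRule X.preds x))
        (Var.appendElim (M := fun σ => McTerm X.preds X.mcNts σ.args .base)
          (Var.mapElim (M := fun σ => McTerm X.preds X.mcNts σ.args .base)
            (fun _ x => X.embed.pushRule X.preds x))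
          (Var.appendElim (M := fun σ => McTerm X.preds X.mcNts σ.args .base)
            (Var.mapElim (M := fun σ => McTerm X.preds X.mcNts σ.args .base)
              (fun _ x => X.embed.pappRule X.preds x))
            (Var.appendElim (M := fun σ => McTerm X.preds X.mcNts σ.args .base)
              (X.embed.clauseRules X.clauses X.clauseEmb)
              (X.embed.goalRules X.goal .base rfl X.goalEmb))))))

/-- The recursion scheme of an instance of MSL(ω). -/
noncomputable def Instance.toHORS : HORS where
  ranks := mcRanks X.preds
  nts := X.mcNts
  start := X.goalEmb (goalRoot X.goal .base)
  rules := X.mcRules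

/-- The state from which every tree is accepted. -/
def anyState (n : ℕ) : Fin (n + 2) := ⟨0, by omega⟩

/-- The state that accepts the trees of the unprovable goals. -/
def goalState (n : ℕ) : Fin (n + 2) := ⟨1, by omega⟩

/-- The state that accepts the trees of the terms of which a predicate cannot be proved. -/
def predState {n : ℕ} (P : Fin n) : Fin (n + 2) := ⟨P + 2, by omega⟩

/-- The transitions of the automaton, as quadruples of a state, a terminal and two states. -/
def mcDelta (n : ℕ) :
    List (Fin (n + 2) × Fin (mcRanks n).length × Fin (n + 2) × Fin (n + 2)) :=
  (List.finRange (mcRanks n).length).map (fun a => (anyState n, a, anyState n, anyState n)) ++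
  ([(goalState n, allLetter n, goalState n, goalState n),
    (goalState n, andLetter n, goalState n, anyState n),
    (goalState n, andLetter n, anyState n, goalState n)] ++
  ((List.finRange n).map (fun P => (goalState n, litLetter P, predState P, anyState n)) ++
  (List.finRange n).flatMap (fun P => (List.finRange n).map (fun P' =>
    (predState P, litLetter P', if P' = P then goalState n else anyState n, predState P)))))

/-- A transition of the automaton. -/
def mcTransition {n : ℕ}
    (d : Fin (n + 2) × Fin (mcRanks n).length × Fin (n + 2) × Fin (n + 2)) :
    Transition (mcRanks n) (n + 2) where
  state := d.1
  letter := d.2.1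
  succ i := if i.val = 0 then d.2.2.1 else d.2.2.2

/-- The instance of model checking for an instance of MSL(ω). -/
noncomputable def Instance.toModelChecking : ModelCheckingInstance where
  hors := X.toHORS
  states := X.preds + 2
  init := goalState X.preds
  trans := (mcDelta X.preds).map mcTransition

end Scheme

/-! ### Reduction of MSL(ω) to model checking: correctness -/

section Automaton

variable {n : ℕ}

theorem mcDelta_any {a : Fin (mcRanks n).length} :
    (anyState n, a, anyState n, anyState n) ∈ mcDelta n := by
  simp [mcDelta]

theorem mcDelta_all {A B : Fin (n + 2) → Prop} :
    (∀ q r, (goalState n, allLetter n, q, r) ∈ mcDelta n → A q ∨ B r) ↔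
      A (goalState n) ∨ B (goalState n) := by
  simp [mcDelta, goalState, anyState, predState, allLetter, andLetter, litLetter]

theorem mcDelta_and {A B : Fin (n + 2) → Prop} (hA : ¬ A (anyState n)) (hB : ¬ B (anyState n)) :
    (∀ q r, (goalState n, andLetter n, q, r) ∈ mcDelta n → A q ∨ B r) ↔
      A (goalState n) ∧ B (goalState n) := by
  simp [mcDelta, goalState, anyState, predState, allLetter, andLetter, litLetter] at *
  grind

theorem mcDelta_tt {A B : Fin (n + 2) → Prop} :
    ∀ q r, (goalState n, ttLetter n, q, r) ∈ mcDelta n → A q ∨ B r := by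
  simp [mcDelta, goalState, anyState, predState, allLetter, andLetter, ttLetter, litLetter]

theorem mcDelta_atom {A B : Fin (n + 2) → Prop} (hB : ¬ B (anyState n)) (P : Fin n) :
    (∀ q r, (goalState n, litLetter P, q, r) ∈ mcDelta n → A q ∨ B r) ↔ A (predState P) := by
  simp [mcDelta, goalState, anyState, predState, allLetter, andLetter, litLetter] at *
  grind

theorem mcDelta_clause {A B : Fin (n + 2) → Prop} (hA : ¬ A (anyState n)) (P P' : Fin n) :
    (∀ q r, (predState P, litLetter P', q, r) ∈ mcDelta n → A q ∨ B r) ↔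
      (P' = P ∧ A (goalState n)) ∨ B (predState P) := by
  simp [mcDelta, goalState, anyState, predState, allLetter, andLetter, litLetter] at *
  grind

end Automaton

section Rejection

variable (X : Instance)

/-- Rejection within `N` steps of the tree generated by a term of the scheme of an instance. -/
def Instance.RejIn (N : ℕ) (q : Fin (X.preds + 2)) (t : McTerm X.preds X.mcNts [] .base) : Prop :=
  X.toModelChecking.RejectsIn N q t

/-- Rejection of the tree generated by a term of the scheme of an instance. -/
def Instance.Rej (q : Fin (X.preds + 2)) (t : McTerm X.preds X.mcNts [] .base) : Prop :=
  X.toModelChecking.Rejects q t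

variable {X}

theorem Instance.not_rejIn_zero {q : Fin (X.preds + 2)} {t : McTerm X.preds X.mcNts [] .base} :
    ¬ X.RejIn 0 q t := fun h => h

theorem Instance.rejIn_rule {N : ℕ} {q : Fin (X.preds + 2)} {τ : Ty} (F : Var X.mcNts τ)
    (θ : Subst (Symb (mcRanks X.preds) X.mcNts) τ.args []) :
    X.RejIn (N + 1) q ((Term.cst (.nonterminal F)).apps θ) ↔
      X.RejIn N q ((X.mcRules F).subst θ) :=
  ModelCheckingInstance.rejectsIn_inl (X.toHORS.eval_nonterminal F θ)

theorem Instance.rej_rule {q : Fin (X.preds + 2)} {τ : Ty} (F : Var X.mcNts τ)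
    (θ : Subst (Symb (mcRanks X.preds) X.mcNts) τ.args []) :
    X.Rej q ((Term.cst (.nonterminal F)).apps θ) ↔ X.Rej q ((X.mcRules F).subst θ) :=
  ModelCheckingInstance.rejects_inl (X.toHORS.eval_nonterminal F θ)

theorem rankApps_two {K : Ty → Type} {Γ : List Ty} {k : ℕ} (c : ∀ τ, rankTy k = τ → K τ)
    (hk : k = 2) (h : rankTy k = .arr .base (.arr .base .base)) (s t : Term K Γ .base) :
    rankApps (.cst (c _ rfl)) (fun i : Fin k => if i.val = 0 then s else t) =
      .app (.app (.cst (c _ h)) s) t := by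
  subst hk; rfl

theorem Instance.eval_mcNode (a : Fin (mcRanks X.preds).length)
    (s t : McTerm X.preds X.mcNts [] .base) : X.toHORS.eval (mcNode a s t) =
      .inr ⟨a, fun i => if i.val = 0 then s else t⟩ := by
  refine HORS.eq_node_iff.1 ?_
  exact (rankApps_two (fun τ h => Symb.terminal a h) (by simp) (rankTy_mcRanks a) s t).symm

theorem forall_mcTransition {A B : Fin (X.preds + 2) → Prop} {q : Fin (X.preds + 2)}
    {a : Fin (mcRanks X.preds).length} :
    (∀ δ ∈ (mcDelta X.preds).map mcTransition, δ.state = q → ∀ h : δ.letter = a,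
      ∃ i : Fin ((mcRanks X.preds).get a),
        (if i.val = 0 then A (δ.succ (h ▸ i)) else B (δ.succ (h ▸ i)))) ↔
    ∀ q₀ q₁, (q, a, q₀, q₁) ∈ mcDelta X.preds → A q₀ ∨ B q₁ := by
  have h2 : (mcRanks X.preds).get a = 2 := by simp
  constructor
  · intro H q₀ q₁ hd
    obtain ⟨i, hi⟩ := H _ (List.mem_map_of_mem hd) rfl rfl
    split_ifs at hi with h0
    · left; simpa [mcTransition, h0] using hi
    · right; simpa [mcTransition, h0] using hi
  · rintro H δ hδ rfl rfl
    obtain ⟨⟨q, a, q₀, q₁⟩, hd, rfl⟩ := List.mem_map.1 hδ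
    rcases H q₀ q₁ hd with h | h
    · exact ⟨⟨0, by rw [h2]; omega⟩, by simpa [mcTransition] using h⟩
    · exact ⟨⟨1, by rw [h2]; omega⟩, by simpa [mcTransition] using h⟩

theorem Instance.rejIn_node {N : ℕ} {q : Fin (X.preds + 2)} (a : Fin (mcRanks X.preds).length)
    (s t : McTerm X.preds X.mcNts [] .base) : X.RejIn (N + 1) q (mcNode a s t) ↔
      ∀ q₀ q₁, (q, a, q₀, q₁) ∈ mcDelta X.preds → X.RejIn N q₀ s ∨ X.RejIn N q₁ t := by
  rw [← forall_mcTransition]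
  refine (ModelCheckingInstance.rejectsIn_inr (eval_mcNode a s t)).trans ?_
  refine forall₂_congr fun δ _ => forall₂_congr fun _ h => exists_congr fun i => ?_
  by_cases h0 : i.val = 0
  · simp only [if_pos h0]
    exact iff_of_eq (congrArg (X.toModelChecking.RejectsIn N _) (if_pos h0))
  · simp only [if_neg h0]
    exact iff_of_eq (congrArg (X.toModelChecking.RejectsIn N _) (if_neg h0))

theorem Instance.rej_node {q : Fin (X.preds + 2)} (a : Fin (mcRanks X.preds).length)
    (s t : McTerm X.preds X.mcNts [] .base) : X.Rej q (mcNode a s t) ↔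
      ∀ q₀ q₁, (q, a, q₀, q₁) ∈ mcDelta X.preds → X.Rej q₀ s ∨ X.Rej q₁ t := by
  rw [← forall_mcTransition]
  refine (ModelCheckingInstance.rejects_inr (eval_mcNode a s t)).trans ?_
  refine forall₂_congr fun δ _ => forall₂_congr fun _ h => exists_congr fun i => ?_
  by_cases h0 : i.val = 0
  · simp only [if_pos h0]
    exact iff_of_eq (congrArg (X.toModelChecking.Rejects _) (if_pos h0))
  · simp only [if_neg h0]
    exact iff_of_eq (congrArg (X.toModelChecking.Rejects _) (if_neg h0))

theorem Instance.not_rejIn_any {N : ℕ} : ∀ {t : McTerm X.preds X.mcNts [] .base},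
    ¬ X.RejIn N (anyState _) t := by
  induction N with
  | zero => exact not_rejIn_zero
  | succ N ih =>
    intro t h
    rcases ht : X.toHORS.eval t with t' | ⟨a, f⟩
    · exact ih ((ModelCheckingInstance.rejectsIn_inl ht).1 h)
    · have h' := (ModelCheckingInstance.rejectsIn_inr ht).1 h
        (mcTransition (anyState _, a, anyState _, anyState _))
        (List.mem_map_of_mem mcDelta_any) rfl rfl
      obtain ⟨i, hi⟩ := h'
      refine ih (t := f i) ?_
      have : (mcTransition (anyState X.preds, a, anyState X.preds, anyState X.preds)).succ i =
          anyState X.preds := by simp [mcTransition]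
      exact this ▸ hi

theorem Instance.not_rej_any {t : McTerm X.preds X.mcNts [] .base} :
    ¬ X.Rej (anyState _) t := fun ⟨_, h⟩ => not_rejIn_any h

theorem Instance.not_rejIn_bot {N : ℕ} {q : Fin (X.preds + 2)} :
    ¬ X.RejIn N q (X.embed.bot X.preds) := by
  induction N with
  | zero => exact not_rejIn_zero
  | succ N ih =>
    intro h
    exact ih ((rejIn_rule (τ := .base) _ Subst.nil).1 h)

end Rejection

section Rules

variable (X : Instance)

theorem Instance.mcRules_con {τ : Ty} (c : Var X.sig τ) :
    X.mcRules (X.embed.con c) = X.embed.conRule X.located c := by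
  simp [mcRules, embed, Var.consElim]

theorem Instance.mcRules_enum {τ : Ty} (x : Var X.spine τ) :
    X.mcRules (X.embed.enum x) = X.embed.enumRule X.preds x := by
  simp [mcRules, embed, Var.consElim]

theorem Instance.mcRules_push {τ : Ty} (x : Var X.spine τ) :
    X.mcRules (X.embed.push x) = X.embed.pushRule X.preds x := by
  simp [mcRules, embed, Var.consElim]

theorem Instance.mcRules_papp {τ : Ty} (x : Var X.spine τ) :
    X.mcRules (X.embed.papp x) = X.embed.pappRule X.preds x := by
  simp [mcRules, embed, Var.consElim]

theorem Instance.mcRules_clause {σ : Ty} (v : Var (clauseSyms X.clauses) σ) :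
    X.mcRules (X.clauseEmb v) = X.embed.clauseRules X.clauses X.clauseEmb v := by
  simp [mcRules, clauseEmb, Var.consElim]

theorem Instance.mcRules_goal {σ : Ty} (v : Var (goalSyms X.goal .base) σ) :
    X.mcRules (X.goalEmb v) = X.embed.goalRules X.goal .base rfl X.goalEmb v := by
  simp [mcRules, goalEmb, Var.consElim]

end Rules

section Substitution

variable {n : ℕ} {sig sp nts Γ Δ : List Ty} (I : Embed sig sp nts)

theorem Embed.subst_all (θ : Subst (Symb (mcRanks n) nts) Γ Δ) :
    ∀ l : List (McTerm n nts Γ .base), (I.all l).subst θ = I.all (l.map (fun t => t.subst θ))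
  | [] => rfl
  | s :: l => congrArg (mcNode (allLetter n) (s.subst θ)) (Embed.subst_all θ l)

theorem Embed.subst_tryCon (θ : Subst (Symb (mcRanks n) nts) Γ Δ) {κ : Ty}
    (k : McTerm n nts Γ (.arr κ .base)) {τ : Ty} (c : Var sig τ) :
    (I.tryCon k c).subst θ = I.tryCon (k.subst θ) c := by
  by_cases h : τ = κ
  · subst h; simp [Embed.tryCon, Term.subst]
  · simp only [Embed.tryCon, dif_neg h]; rfl

theorem Embed.subst_tryEnum (θ : Subst (Symb (mcRanks n) nts) Γ Δ) {κ : Ty}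
    (k : McTerm n nts Γ (.arr κ .base)) {τ : Ty} (x : Var sp τ) :
    (I.tryEnum k x).subst θ = I.tryEnum (k.subst θ) x := by
  by_cases h : κ = τ.cod
  · subst h; simp [Embed.tryEnum, Term.subst]
  · simp only [Embed.tryEnum, dif_neg h]; rfl

theorem Embed.subst_forall (θ : Subst (Symb (mcRanks n) nts) Γ Δ) {κ : Ty}
    (k : McTerm n nts Γ (.arr κ .base)) :
    (I.forall k).subst θ = I.forall (k.subst θ) := by
  simp only [Embed.forall, Embed.subst_all, List.map_append, map_tabulate, Embed.subst_tryCon,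
    Embed.subst_tryEnum]

/-- A substitution of terms over the constructors as a substitution of terms of the scheme. -/
def Embed.subst (n : ℕ) (θ : Subst (Var sig) Γ Δ) : Subst (Symb (mcRanks n) nts) Γ Δ :=
  fun _ x => I.term n (θ x)

theorem Embed.term_subst (θ : Subst (Var sig) Γ Δ) {τ : Ty} (t : Term (Var sig) Γ τ) :
    I.term n (t.subst θ) = (I.term n t).subst (I.subst n θ) :=
  Term.mapCst_subst _ _ _

theorem Embed.term_cst_apps {τ : Ty} (c : Var sig τ) (θ : Subst (Var sig) τ.args Γ) :
    I.term n ((Term.cst c).apps θ) =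
      (Term.cst (.nonterminal (I.con c))).apps (I.subst n θ) :=
  Term.mapCst_apps _ _ _

theorem Embed.subst_cons {κ : Ty} (t : Term (Var sig) Δ κ) (θ : Subst (Var sig) Γ Δ) :
    I.subst n (Subst.cons t θ) = Subst.cons (I.term n t) (I.subst n θ) := by
  funext τ x; cases x <;> rfl

theorem Term.cst_apps_var_subst {K : Ty → Type} {τ : Ty} (c : K τ) (θ : Subst K τ.args Γ) :
    ((Term.cst c).apps (fun _ x => Term.var x)).subst θ = (Term.cst c).apps θ :=
  Term.subst_apps _ _ _

/-- A closed term of base type is a full application of a constructor. -/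
theorem Term.exists_eq_cst_apps {K : Ty → Type} {τ : Ty} (t : Term K [] τ)
    (θ : Subst K τ.args []) :
    ∃ (σ : Ty) (c : K σ) (θ' : Subst K σ.args []), t.apps θ = (Term.cst c).apps θ' := by
  induction t with
  | var x => nomatch x
  | cst c => exact ⟨_, c, θ, rfl⟩
  | app s t hs _ => exact hs (Subst.cons t θ)

theorem Instance.suffixes_subset_spine (X : Instance) {τ : Ty} (t : Term (Var X.sig) [] τ) :
    τ.suffixes ⊆ X.spine := by
  induction t with
  | var x => nomatch x
  | cst c =>
    intro σ hσ
    exact List.mem_flatMap.2 ⟨_, mem_iff_nonempty_var.2 ⟨c⟩, hσ⟩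
  | app s t hs _ => exact fun σ hσ => hs (List.mem_cons_of_mem _ hσ)

end Substitution

section Connectives

variable {X : Instance} {N : ℕ} {s t : McTerm X.preds X.mcNts [] .base}

theorem Instance.rejIn_all_node :
    X.RejIn (N + 1) (goalState _) (mcNode (allLetter _) s t) ↔
      X.RejIn N (goalState _) s ∨ X.RejIn N (goalState _) t :=
  (rejIn_node _ _ _).trans mcDelta_all

theorem Instance.rej_all_node :
    X.Rej (goalState _) (mcNode (allLetter _) s t) ↔
      X.Rej (goalState _) s ∨ X.Rej (goalState _) t :=
  (rej_node _ _ _).trans mcDelta_all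

theorem Instance.rejIn_and_node :
    X.RejIn (N + 1) (goalState _) (mcNode (andLetter _) s t) ↔
      X.RejIn N (goalState _) s ∧ X.RejIn N (goalState _) t :=
  (rejIn_node _ _ _).trans (mcDelta_and not_rejIn_any not_rejIn_any)

theorem Instance.rej_and_node :
    X.Rej (goalState _) (mcNode (andLetter _) s t) ↔
      X.Rej (goalState _) s ∧ X.Rej (goalState _) t :=
  (rej_node _ _ _).trans (mcDelta_and not_rej_any not_rej_any)

theorem Instance.rej_tt_node : X.Rej (goalState _) (mcNode (ttLetter _) s t) :=
  (rej_node _ _ _).2 mcDelta_tt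

theorem Instance.rejIn_atom_node {P : Fin X.preds} :
    X.RejIn (N + 1) (goalState _) (mcNode (litLetter P) s t) ↔ X.RejIn N (predState P) s :=
  (rejIn_node _ _ _).trans (mcDelta_atom not_rejIn_any P)

theorem Instance.rej_atom_node {P : Fin X.preds} :
    X.Rej (goalState _) (mcNode (litLetter P) s t) ↔ X.Rej (predState P) s :=
  (rej_node _ _ _).trans (mcDelta_atom not_rej_any P)

theorem Instance.rejIn_clause_node {P P' : Fin X.preds} :
    X.RejIn (N + 1) (predState P) (mcNode (litLetter P') s t) ↔
      (P' = P ∧ X.RejIn N (goalState _) s) ∨ X.RejIn N (predState P) t :=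
  (rejIn_node _ _ _).trans (mcDelta_clause not_rejIn_any P P')

theorem Instance.rej_clause_node {P P' : Fin X.preds} :
    X.Rej (predState P) (mcNode (litLetter P') s t) ↔
      (P' = P ∧ X.Rej (goalState _) s) ∨ X.Rej (predState P) t :=
  (rej_node _ _ _).trans (mcDelta_clause not_rej_any P P')

theorem Instance.RejIn.exists_mem_of_all {l : List (McTerm X.preds X.mcNts [] .base)} :
    ∀ {N : ℕ}, X.RejIn N (goalState _) (X.embed.all l) →
      ∃ s ∈ l, ∃ M < N, X.RejIn M (goalState _) s := by
  induction l with
  | nil => exact fun h => (not_rejIn_bot h).elim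
  | cons s l ih =>
    rintro (_ | N) h
    · exact (not_rejIn_zero h).elim
    · rcases rejIn_all_node.1 h with h | h
      · exact ⟨s, by simp, N, by omega, h⟩
      · obtain ⟨s', hs', M, hM, h'⟩ := ih h
        exact ⟨s', List.mem_cons_of_mem _ hs', M, by omega, h'⟩

theorem Instance.Rej.all {l : List (McTerm X.preds X.mcNts [] .base)} (hs : s ∈ l)
    (h : X.Rej (goalState _) s) : X.Rej (goalState _) (X.embed.all l) := by
  induction l with
  | nil => simp at hs
  | cons s' l ih =>
    refine rej_all_node.2 ?_
    rcases List.mem_cons.1 hs with rfl | hs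
    · exact .inl h
    · exact .inr (ih hs)

end Connectives

section Enumeration

variable {X : Instance}

theorem Instance.RejIn.exists_succ {N : ℕ} {q : Fin (X.preds + 2)}
    {t : McTerm X.preds X.mcNts [] .base} (h : X.RejIn N q t) : ∃ M, N = M + 1 := by
  cases N with
  | zero => exact (not_rejIn_zero h).elim
  | succ N => exact ⟨N, rfl⟩

theorem Instance.rejIn_iff_of_rule {N : ℕ} {q : Fin (X.preds + 2)}
    {s t : McTerm X.preds X.mcNts [] .base} {τ : Ty} {F : Var X.mcNts τ}
    {θ : Subst (Symb (mcRanks X.preds) X.mcNts) τ.args []}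
    (hs : s = (Term.cst (.nonterminal F)).apps θ) (ht : (X.mcRules F).subst θ = t) :
    X.RejIn (N + 1) q s ↔ X.RejIn N q t := by
  rw [hs, rejIn_rule, ht]

theorem Instance.rej_iff_of_rule {q : Fin (X.preds + 2)}
    {s t : McTerm X.preds X.mcNts [] .base} {τ : Ty} {F : Var X.mcNts τ}
    {θ : Subst (Symb (mcRanks X.preds) X.mcNts) τ.args []}
    (hs : s = (Term.cst (.nonterminal F)).apps θ) (ht : (X.mcRules F).subst θ = t) :
    X.Rej q s ↔ X.Rej q t := by
  rw [hs, rej_rule, ht]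

theorem Instance.tryEnum_cod {τ : Ty} (x : Var X.spine τ)
    (k : McTerm X.preds X.mcNts [] (.arr τ.cod .base)) :
    X.embed.tryEnum k x = (Term.cst (.nonterminal (X.embed.enum x))).apps (τ := enumTy τ)
      (Subst.cons k Subst.nil) := by
  rw [Embed.tryEnum, dif_pos rfl]; rfl

theorem Instance.enumRule_subst {τ : Ty} (x : Var X.spine τ)
    (k : McTerm X.preds X.mcNts [] (.arr τ.cod .base)) :
    (X.mcRules (X.embed.enum x)).subst (Subst.cons k Subst.nil) =
      X.embed.forall (.app (.cst (.nonterminal (X.embed.push x))) k) := by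
  rw [mcRules_enum]; exact Embed.subst_forall _ _ _

theorem Instance.pushRule_subst {τ : Ty} (x : Var X.spine τ)
    (k : McTerm X.preds X.mcNts [] (.arr τ.cod .base)) (s : McTerm X.preds X.mcNts [] τ) :
    (X.mcRules (X.embed.push x)).subst (Subst.cons k (Subst.cons s Subst.nil)) =
      X.embed.forall (.app (.app (.cst (.nonterminal (X.embed.papp x))) k) s) := by
  rw [mcRules_push]; exact Embed.subst_forall _ _ _

/-- The enumeration reaches every closed term, by induction on the term. -/
theorem Instance.Rej.forall {κ : Ty} (t : Term (Var X.sig) [] κ) :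
    ∀ {k : McTerm X.preds X.mcNts [] (.arr κ .base)},
      X.Rej (goalState _) (.app k (X.embed.term X.preds t)) →
        X.Rej (goalState _) (X.embed.forall k) := by
  induction t with
  | var x => nomatch x
  | cst c =>
    intro k h
    refine Rej.all (s := X.embed.tryCon k c)
      (List.mem_append_left _ (mem_tabulate.2 ⟨_, c, rfl⟩)) ?_
    rw [Embed.tryCon, dif_pos rfl]
    exact h
  | @app σ κ s t hs ht =>
    intro k h
    obtain ⟨x⟩ := mem_iff_nonempty_var.1
      (X.suffixes_subset_spine s (List.mem_cons_self : Ty.arr σ κ ∈ _))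
    refine Rej.all (s := X.embed.tryEnum k x)
      (List.mem_append_right _ (mem_tabulate.2 ⟨_, x, rfl⟩)) ?_
    refine (rej_iff_of_rule (tryEnum_cod x k) (enumRule_subst x k)).2 (hs ?_)
    refine (rej_iff_of_rule (F := X.embed.push x) rfl (pushRule_subst x k _)).2 (ht ?_)
    refine (rej_rule (X.embed.papp x) (Subst.cons k (Subst.cons (X.embed.term _ s)
      (Subst.cons (X.embed.term _ t) Subst.nil)))).2 ?_
    rw [mcRules_papp]
    exact h

/-- The enumeration reaches closed terms only, by induction on the number of steps. -/
theorem Instance.RejIn.exists_of_forall (N : ℕ) : ∀ {κ : Ty}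
    {k : McTerm X.preds X.mcNts [] (.arr κ .base)},
      X.RejIn N (goalState _) (X.embed.forall k) →
        ∃ t : Term (Var X.sig) [] κ, ∃ M < N,
          X.RejIn M (goalState _) (.app k (X.embed.term X.preds t)) := by
  induction N using Nat.strong_induction_on with
  | _ N ih =>
    intro κ k h
    obtain ⟨s, hs, M, hM, h⟩ := h.exists_mem_of_all
    rcases List.mem_append.1 hs with hs | hs
    · obtain ⟨τ, c, rfl⟩ := mem_tabulate.1 hs
      by_cases hτ : τ = κ
      · subst hτ
        rw [Embed.tryCon, dif_pos rfl] at h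
        exact ⟨.cst c, M, hM, h⟩
      · rw [Embed.tryCon, dif_neg hτ] at h
        exact (not_rejIn_bot h).elim
    · obtain ⟨τ, x, rfl⟩ := mem_tabulate.1 hs
      by_cases hτ : κ = τ.cod
      · subst hτ
        obtain ⟨M, rfl⟩ := h.exists_succ
        replace h := (rejIn_iff_of_rule (tryEnum_cod x k) (enumRule_subst x k)).1 h
        obtain ⟨s, M₁, hM₁, h⟩ := ih M (by omega) h
        obtain ⟨M₁, rfl⟩ := h.exists_succ
        replace h := (rejIn_iff_of_rule (F := X.embed.push x) rfl (pushRule_subst x k _)).1 h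
        obtain ⟨t, M₂, hM₂, h⟩ := ih M₁ (by omega) h
        obtain ⟨M₂, rfl⟩ := h.exists_succ
        replace h := (rejIn_rule (X.embed.papp x) (Subst.cons k (Subst.cons (X.embed.term _ s)
          (Subst.cons (X.embed.term _ t) Subst.nil)))).1 h
        rw [mcRules_papp] at h
        cases τ with
        | base => exact (not_rejIn_bot h).elim
        | arr σ κ => exact ⟨.app s t, M₂, by omega, h⟩
      · rw [Embed.tryEnum, dif_neg hτ] at h
        exact (not_rejIn_bot h).elim

end Enumeration

section Goals

variable {X : Instance}

/-- The rules of the nonterminals for the subgoals of a goal are those of the scheme. -/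
def Instance.Locates (X : Instance) {Γ : List Ty} (G : Goal X.sig X.preds Γ) (τ : Ty)
    (h : Γ = τ.args) (e : ∀ ⦃σ : Ty⦄, Var (goalSyms G τ) σ → Var X.mcNts σ) : Prop :=
  ∀ ⦃σ : Ty⦄ (v : Var (goalSyms G τ) σ), X.mcRules (e v) = X.embed.goalRules G τ h e v

section

variable {Γ : List Ty} {τ : Ty} {h : Γ = τ.args}

theorem Instance.Locates.and_left {G H : Goal X.sig X.preds Γ}
    {e : ∀ ⦃σ : Ty⦄, Var (goalSyms (.and G H) τ) σ → Var X.mcNts σ}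
    (he : X.Locates (.and G H) τ h e) : X.Locates G τ h (fun _ v => e (.there v.inl)) :=
  fun _ v => (he (.there v.inl)).trans (Var.appendElim_inl _ _ v)

theorem Instance.Locates.and_right {G H : Goal X.sig X.preds Γ}
    {e : ∀ ⦃σ : Ty⦄, Var (goalSyms (.and G H) τ) σ → Var X.mcNts σ}
    (he : X.Locates (.and G H) τ h e) :
    X.Locates H τ h (fun _ v => e (.there (Var.inr _ v))) :=
  fun _ v => (he (.there (Var.inr _ v))).trans (Var.appendElim_inr _ _ v)

theorem Instance.Locates.ex {κ : Ty} {G : Goal X.sig X.preds (κ :: Γ)}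
    {e : ∀ ⦃σ : Ty⦄, Var (goalSyms (.ex κ G) τ) σ → Var X.mcNts σ}
    (he : X.Locates (.ex κ G) τ h e) :
    X.Locates G (.arr κ τ) (congrArg (κ :: ·) h) (fun _ v => e (.there (.there v))) :=
  fun _ v => he (.there (.there v))

end

/-- The tree of an instance of a goal. -/
def Instance.goalTree {Γ : List Ty} {G : Goal X.sig X.preds Γ} {τ : Ty}
    (e : ∀ ⦃σ : Ty⦄, Var (goalSyms G τ) σ → Var X.mcNts σ) (θ : Subst (Var X.sig) τ.args []) :
    McTerm X.preds X.mcNts [] .base :=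
  (Term.cst (.nonterminal (e (goalRoot G τ)))).apps (X.embed.subst X.preds θ)

section

variable {τ : Ty} {θ : Subst (Var X.sig) τ.args []}

theorem Instance.Locates.tt_rule
    {e : ∀ ⦃σ : Ty⦄, Var (goalSyms (.tt : Goal X.sig X.preds τ.args) τ) σ → Var X.mcNts σ}
    (he : X.Locates .tt τ rfl e) :
    (X.mcRules (e (goalRoot .tt τ))).subst (X.embed.subst X.preds θ) =
      mcNode (ttLetter _) (X.embed.bot _) (X.embed.bot _) :=
  congrArg (fun u => u.subst (X.embed.subst X.preds θ)) (he .here)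

theorem Instance.Locates.atom_rule {P : Fin X.preds} {t : Term (Var X.sig) τ.args .base}
    {e : ∀ ⦃σ : Ty⦄, Var (goalSyms (.atom P t) τ) σ → Var X.mcNts σ}
    (he : X.Locates (.atom P t) τ rfl e) :
    (X.mcRules (e (goalRoot (.atom P t) τ))).subst (X.embed.subst X.preds θ) =
      mcNode (litLetter P) (X.embed.term _ (t.subst θ)) (X.embed.bot _) := by
  rw [Embed.term_subst]
  exact congrArg (fun u => u.subst (X.embed.subst X.preds θ)) (he .here)

theorem Instance.Locates.and_rule {G H : Goal X.sig X.preds τ.args}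
    {e : ∀ ⦃σ : Ty⦄, Var (goalSyms (.and G H) τ) σ → Var X.mcNts σ}
    (he : X.Locates (.and G H) τ rfl e) :
    (X.mcRules (e (goalRoot (.and G H) τ))).subst (X.embed.subst X.preds θ) =
      mcNode (andLetter _) (goalTree (G := G) (fun _ v => e (.there v.inl)) θ)
        (goalTree (G := H) (fun _ v => e (.there (Var.inr _ v))) θ) := by
  refine (congrArg (fun u => u.subst (X.embed.subst X.preds θ)) (he .here)).trans ?_
  exact congrArg₂ (mcNode (andLetter _)) (Term.cst_apps_var_subst _ _)
    (Term.cst_apps_var_subst _ _)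

theorem Instance.Locates.ex_rule {κ : Ty} {G : Goal X.sig X.preds (κ :: τ.args)}
    {e : ∀ ⦃σ : Ty⦄, Var (goalSyms (.ex κ G) τ) σ → Var X.mcNts σ}
    (he : X.Locates (.ex κ G) τ rfl e) :
    (X.mcRules (e (goalRoot (.ex κ G) τ))).subst (X.embed.subst X.preds θ) =
      X.embed.forall (Term.appsSnoc (τ := τ) (.cst (.nonterminal (e (.there .here))))
        (X.embed.subst X.preds θ)) := by
  refine (congrArg (fun u => u.subst (X.embed.subst X.preds θ)) (he .here)).trans ?_
  refine (Embed.subst_forall _ _ _).trans ?_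
  rw [Term.subst_appsSnoc]; rfl

theorem Instance.Locates.ex_rule_snoc {κ : Ty} {G : Goal X.sig X.preds (κ :: τ.args)}
    {e : ∀ ⦃σ : Ty⦄, Var (goalSyms (.ex κ G) τ) σ → Var X.mcNts σ}
    (he : X.Locates (.ex κ G) τ rfl e) (t : Term (Var X.sig) [] κ) :
    (X.mcRules (e (.there .here))).subst
        (Subst.snoc (τ := τ) (X.embed.subst X.preds θ) (X.embed.term X.preds t)) =
      goalTree (G := G) (τ := .arr κ τ) (fun _ v => e (.there (.there v))) (Subst.cons t θ) := by
  refine (congrArg (Term.subst (Subst.snoc (τ := τ) (X.embed.subst X.preds θ) (X.embed.term _ t))) (he (.there .here))).trans ?_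
  refine (Term.subst_apps (τ := .arr κ τ) _ _ _).trans ?_
  refine Eq.trans ?_ (congrArg (Term.apps (τ := .arr κ τ) _) (X.embed.subst_cons t θ).symm)
  refine congrArg (Term.apps (τ := .arr κ τ) _) ?_
  funext σ x
  cases x with
  | here => exact Subst.snoc_last _ _
  | there x => exact Subst.snoc_weak _ _ x

end

/-- The tree of an instance of a goal that holds is rejected. -/
theorem Goal.Sat.rej {Γ : List Ty} (G : Goal X.sig X.preds Γ) : ∀ (τ : Ty) (h : Γ = τ.args)
    (e : ∀ ⦃σ : Ty⦄, Var (goalSyms G τ) σ → Var X.mcNts σ), X.Locates G τ h e →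
      ∀ θ : Subst (Var X.sig) τ.args [],
        (h ▸ G).Sat (fun P t => X.Rej (predState P) (X.embed.term _ t)) θ →
          X.Rej (goalState _) (Instance.goalTree (G := G) e θ) := by
  induction G with
  | tt =>
    rintro τ rfl e he θ -
    rw [Instance.goalTree, Instance.rej_rule, he.tt_rule]
    exact Instance.rej_tt_node
  | atom P t =>
    rintro τ rfl e he θ hA
    rw [Instance.goalTree, Instance.rej_rule, he.atom_rule]
    exact Instance.rej_atom_node.2 hA
  | and G H hG hH =>
    rintro τ rfl e he θ hA
    rw [Instance.goalTree, Instance.rej_rule, he.and_rule]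
    exact Instance.rej_and_node.2
      ⟨hG τ rfl _ he.and_left θ hA.1, hH τ rfl _ he.and_right θ hA.2⟩
  | ex κ G hG =>
    rintro τ rfl e he θ ⟨t, hA⟩
    rw [Instance.goalTree, Instance.rej_rule, he.ex_rule]
    refine Instance.Rej.forall t ?_
    rw [Term.app_appsSnoc, Instance.rej_rule, he.ex_rule_snoc]
    exact hG (.arr κ τ) rfl _ he.ex (Subst.cons t θ) hA

/-- Instances of goals whose trees are rejected hold, if this is the case for atoms. -/
theorem Goal.sat_of_rejIn {A : Fin X.preds → Term (Var X.sig) [] .base → Prop} {N : ℕ}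
    (hN : ∀ M ≤ N, ∀ P t, X.RejIn M (predState P) (X.embed.term _ t) → A P t)
    {Γ : List Ty} (G : Goal X.sig X.preds Γ) : ∀ (τ : Ty) (h : Γ = τ.args)
    (e : ∀ ⦃σ : Ty⦄, Var (goalSyms G τ) σ → Var X.mcNts σ), X.Locates G τ h e →
      ∀ (θ : Subst (Var X.sig) τ.args []), ∀ M ≤ N,
        X.RejIn M (goalState _) (Instance.goalTree (G := G) e θ) → (h ▸ G).Sat A θ := by
  induction G with
  | tt => rintro τ rfl e he θ M hM h; trivial
  | atom P t =>
    rintro τ rfl e he θ M hM h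
    obtain ⟨M, rfl⟩ := h.exists_succ
    rw [Instance.goalTree, Instance.rejIn_rule, he.atom_rule] at h
    obtain ⟨M, rfl⟩ := h.exists_succ
    exact hN M (by omega) P _ (Instance.rejIn_atom_node.1 h)
  | and G H hG hH =>
    rintro τ rfl e he θ M hM h
    obtain ⟨M, rfl⟩ := h.exists_succ
    rw [Instance.goalTree, Instance.rejIn_rule, he.and_rule] at h
    obtain ⟨M, rfl⟩ := h.exists_succ
    obtain ⟨h1, h2⟩ := Instance.rejIn_and_node.1 h
    exact ⟨hG τ rfl _ he.and_left θ M (by omega) h1,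
      hH τ rfl _ he.and_right θ M (by omega) h2⟩
  | ex κ G hG =>
    rintro τ rfl e he θ M hM h
    obtain ⟨M, rfl⟩ := h.exists_succ
    rw [Instance.goalTree, Instance.rejIn_rule, he.ex_rule] at h
    obtain ⟨t, M₁, hM₁, h⟩ := h.exists_of_forall
    obtain ⟨M₁, rfl⟩ := h.exists_succ
    rw [Term.app_appsSnoc, Instance.rejIn_rule, he.ex_rule_snoc] at h
    exact ⟨t, hG (.arr κ τ) rfl _ he.ex (Subst.cons t θ) M₁ (by omega) h⟩

end Goals

section Clauses

variable {X : Instance}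

/-- The nonterminal of a located clause is the nonterminal for the body of the clause. -/
theorem Instance.exists_locates_of_mem_locate {l : List (Clause X.sig X.preds)} :
    ∀ {e : ∀ ⦃σ : Ty⦄, Var (clauseSyms l) σ → Var X.mcNts σ},
      (∀ ⦃σ : Ty⦄ (v : Var (clauseSyms l) σ),
        X.mcRules (e v) = X.embed.clauseRules l e v) →
      ∀ p ∈ locate l e, p.1 ∈ l ∧
        ∃ e' : ∀ ⦃σ : Ty⦄, Var (goalSyms p.1.body p.1.ty) σ → Var X.mcNts σ,
          X.Locates p.1.body p.1.ty rfl e' ∧ p.2 = e' (goalRoot p.1.body p.1.ty) := by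
  induction l with
  | nil => intro e he p hp; simp [locate] at hp
  | cons C l ih =>
    intro e he p hp
    rcases List.mem_cons.1 hp with rfl | hp
    · exact ⟨by simp, fun _ v => e v.inl,
        fun _ v => (he v.inl).trans (Var.appendElim_inl _ _ v), rfl⟩
    · obtain ⟨h1, h2⟩ := ih (fun _ v => (he (Var.inr _ v)).trans (Var.appendElim_inr _ _ v)) p hp
      exact ⟨List.mem_cons_of_mem _ h1, h2⟩

theorem exists_mem_locate {n : ℕ} {sig nts : List Ty} {C : Clause sig n} {l : List (Clause sig n)} :
    ∀ {e : ∀ ⦃σ : Ty⦄, Var (clauseSyms l) σ → Var nts σ}, C ∈ l → ∃ F, ⟨C, F⟩ ∈ locate l e := by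
  induction l with
  | nil => intro e h; simp at h
  | cons C' l ih =>
    intro e h
    rcases List.mem_cons.1 h with rfl | h
    · exact ⟨_, List.mem_cons_self⟩
    · obtain ⟨F, hF⟩ := ih (e := fun _ v => e (Var.inr _ v)) h
      exact ⟨F, List.mem_cons_of_mem _ hF⟩

theorem Instance.Rej.conRule {L : List (Σ C : Clause X.sig X.preds, Var X.mcNts C.ty)}
    {p : Σ C : Clause X.sig X.preds, Var X.mcNts C.ty} (hp : p ∈ L) {τ : Ty} {c : Var X.sig τ}
    {θ : Subst (Symb (mcRanks X.preds) X.mcNts) τ.args []}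
    (h : X.Rej (goalState _) ((X.embed.tryClause c p).subst θ)) :
    X.Rej (predState p.1.pred) ((X.embed.conRule L c).subst θ) := by
  induction L with
  | nil => simp at hp
  | cons p' L ih =>
    refine rej_clause_node.2 ?_
    rcases List.mem_cons.1 hp with rfl | hp
    · exact .inl ⟨rfl, h⟩
    · exact .inr (ih hp)

theorem Instance.RejIn.exists_mem_of_conRule
    {L : List (Σ C : Clause X.sig X.preds, Var X.mcNts C.ty)} {P : Fin X.preds} {τ : Ty}
    {c : Var X.sig τ} {θ : Subst (Symb (mcRanks X.preds) X.mcNts) τ.args []} :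
    ∀ {N : ℕ}, X.RejIn N (predState P) ((X.embed.conRule L c).subst θ) →
      ∃ p ∈ L, p.1.pred = P ∧ ∃ M < N,
        X.RejIn M (goalState _) ((X.embed.tryClause c p).subst θ) := by
  induction L with
  | nil => exact fun h => (not_rejIn_bot h).elim
  | cons p' L ih =>
    intro N h
    obtain ⟨N, rfl⟩ := h.exists_succ
    rcases rejIn_clause_node.1 h with ⟨hP, h⟩ | h
    · exact ⟨p', by simp, hP, N, by omega, h⟩
    · obtain ⟨p, hp, hP, M, hM, h⟩ := ih h
      exact ⟨p, List.mem_cons_of_mem _ hp, hP, M, by omega, h⟩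

theorem Embed.subst_tryClause_var {n : ℕ} {sig sp nts : List Ty} (I : Embed sig sp nts)
    {P : Fin n} {G : Goal sig n [.base]} {F : Var nts (Clause.var P G).ty} {τ : Ty}
    (c : Var sig τ) (θ : Subst (Var sig) τ.args []) :
    (I.tryClause c ⟨.var P G, F⟩).subst (I.subst n θ) =
      (Term.cst (.nonterminal F)).apps (τ := .arr .base .base)
        (I.subst n (Subst.single ((Term.cst c).apps θ))) := by
  refine congrArg (Term.app _) ?_
  refine (Term.cst_apps_var_subst _ _).trans ?_
  exact (I.term_cst_apps c θ).symm

theorem Embed.subst_tryClause_con {n : ℕ} {sig sp nts : List Ty} (I : Embed sig sp nts)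
    {P : Fin n} {τ : Ty} {G : Goal sig n τ.args}
    (c : Var sig τ) {F : Var nts (Clause.con P c G).ty} (θ : Subst (Var sig) τ.args []) :
    (I.tryClause c ⟨.con P c G, F⟩).subst (I.subst n θ) =
      (Term.cst (.nonterminal F)).apps (I.subst n θ) := by
  refine (congrArg (Term.subst (I.subst n θ)) (dif_pos rfl : I.tryClause c ⟨.con P c G, F⟩ = _)).trans ?_
  exact Term.cst_apps_var_subst _ _

theorem Instance.exists_locates_of_mem_located :
    ∀ (C : Clause X.sig X.preds) (F : Var X.mcNts C.ty), ⟨C, F⟩ ∈ X.located → C ∈ X.clauses ∧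
      ∃ e' : ∀ ⦃σ : Ty⦄, Var (goalSyms C.body C.ty) σ → Var X.mcNts σ,
        X.Locates C.body C.ty rfl e' ∧ F = e' (goalRoot C.body C.ty) :=
  fun C F => exists_locates_of_mem_locate (fun _ v => X.mcRules_clause v) ⟨C, F⟩

theorem Instance.rej_of_clause {C : Clause X.sig X.preds} (hC : C ∈ X.clauses) {τ : Ty}
    (c : Var X.sig τ) (θ : Subst (Var X.sig) τ.args [])
    (h : ∀ F, ⟨C, F⟩ ∈ X.located →
      X.Rej (goalState _) ((X.embed.tryClause c ⟨C, F⟩).subst (X.embed.subst _ θ))) :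
    X.Rej (predState C.pred) (X.embed.term _ ((Term.cst c).apps θ)) := by
  obtain ⟨F, hF⟩ := exists_mem_locate (e := X.clauseEmb) hC
  rw [Embed.term_cst_apps, rej_rule, mcRules_con]
  exact Rej.conRule hF (h F hF)

/-- The trees of provable goals are rejected. -/
theorem Provable.rej {G : Goal X.sig X.preds []} (h : Provable X.clauses G) :
    G.Sat (fun P t => X.Rej (predState P) (X.embed.term _ t)) Subst.nil := by
  refine h.sat _ (fun P G hC s hs => ?_) (fun P τ c G hC θ hs => ?_)
  · obtain ⟨τ, c, θ, hθ⟩ := s.exists_eq_cst_apps Subst.nil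
    obtain rfl : s = (Term.cst c).apps θ := hθ
    refine Instance.rej_of_clause hC c θ fun F hF => ?_
    obtain ⟨-, e, he, rfl⟩ := Instance.exists_locates_of_mem_located _ _ hF
    refine (congrArg (X.Rej _) (Embed.subst_tryClause_var _ c θ)).mpr ?_
    exact Goal.Sat.rej G (.arr .base .base) rfl e he _ hs
  · refine Instance.rej_of_clause hC c θ fun F hF => ?_
    obtain ⟨-, e, he, rfl⟩ := Instance.exists_locates_of_mem_located _ _ hF
    refine (congrArg (X.Rej _) (Embed.subst_tryClause_con _ c θ)).mpr ?_
    exact Goal.Sat.rej G τ rfl e he _ hs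

/-- Atoms whose trees are rejected are provable, by induction on the number of steps. -/
theorem Instance.RejIn.provable (N : ℕ) : ∀ (P : Fin X.preds) (t : Term (Var X.sig) [] .base),
    X.RejIn N (predState P) (X.embed.term _ t) → Provable X.clauses (.atom P t) := by
  induction N using Nat.strong_induction_on with
  | _ N ih =>
    intro P t h
    obtain ⟨τ, c, θ, hθ⟩ := t.exists_eq_cst_apps Subst.nil
    obtain rfl : t = (Term.cst c).apps θ := hθ
    obtain ⟨N, rfl⟩ := h.exists_succ
    rw [Embed.term_cst_apps, rejIn_rule, mcRules_con] at h
    obtain ⟨⟨C, F⟩, hp, rfl, M, hM, h⟩ := h.exists_mem_of_conRule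
    obtain ⟨hC, e, he, rfl⟩ := exists_locates_of_mem_located _ _ hp
    have hA : ∀ M' ≤ M, ∀ P t, X.RejIn M' (predState P) (X.embed.term _ t) →
        Provable X.clauses (.atom P t) := fun M' hM' => ih M' (by omega)
    cases C with
    | var P G =>
      replace h := (congrArg (X.RejIn M _) (Embed.subst_tryClause_var _ c θ)).mp h
      exact .resVar _ hC (Goal.sat_of_rejIn hA G (.arr .base .base) rfl e he _ M le_rfl h).provable
    | @con P σ d G =>
      by_cases hd : (⟨σ, d⟩ : Σ σ, Var X.sig σ) = ⟨τ, c⟩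
      · cases hd
        replace h := (congrArg (X.RejIn M _) (Embed.subst_tryClause_con _ c θ)).mp h
        exact .resCon _ hC (Goal.sat_of_rejIn hA G τ rfl e he _ M le_rfl h).provable
      · rw [Embed.tryClause, dif_neg hd] at h
        exact (not_rejIn_bot h).elim

/-- The automaton accepts the value tree of the scheme if and only if the goal is not provable. -/
theorem Instance.not_provable_iff_accepts (X : Instance) :
    ¬ Provable X.clauses X.goal ↔ X.toModelChecking.Accepts := by
  rw [ModelCheckingInstance.accepts_iff, not_iff_not]
  constructor
  · intro h
    exact Goal.Sat.rej X.goal .base rfl X.goalEmb (fun _ v => X.mcRules_goal v) Subst.nil h.rej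
  · rintro ⟨N, h⟩
    have := (Goal.sat_of_rejIn (fun M _ => RejIn.provable M) X.goal .base rfl X.goalEmb
      (fun _ v => X.mcRules_goal v) Subst.nil N le_rfl h).provable
    rw [Subst.nil_unique Subst.nil (fun _ x => .var x)] at this
    exact (Goal.subst_var X.goal) ▸ this

end Clauses

/-! ### The reduction of MSL(ω) to model checking is computable in polynomial time -/

section GoalNodes

/-- The list of the subgoals of a goal, in the order of their nonterminals. The members consist of
the type of the nonterminal, the encoding of the subgoal, and, in the case of a conjunction, the
number of the nonterminals for the first conjunct. The tag `4` is used for the additional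
nonterminal of an existential goal. -/
def Data.goalNodes : Data → Data → Data
  | τ, .cons t (.cons a b) => t.snd.ite
    (t.snd.snd.ite
      (.cons (.cons τ (.cons (.cons t (.cons a b)) .nil))
        (.cons (.cons (τ.append (.cons a .nil)) (.cons (.cons (encNat 4) .nil) .nil))
          (Data.goalNodes (.cons a τ) b)))
      (.cons (.cons τ (.cons (.cons t (.cons a b)) (Data.goalNodes τ a).length))
        ((Data.goalNodes τ a).append (Data.goalNodes τ b))))
    (.cons (.cons τ (.cons (.cons t (.cons a b)) .nil)) .nil)
  | τ, g => .cons (.cons τ (.cons g .nil)) .nil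

theorem Data.length_cons (x y : Data) : (Data.cons x y).length = .cons .nil y.length := rfl

theorem Data.size_length_append (x y : Data) :
    (x.append y).length.size + 1 = x.length.size + y.length.size := by
  induction x with
  | nil => simp [Data.append, Data.fold, Data.length, Data.map, Data.size]; omega
  | cons a x _ ih =>
    simp only [Data.append, Data.fold, Data.length, Data.map, Data.size] at *
    omega

theorem Data.size_length_goalNodes : ∀ g τ : Data,
    (Data.goalNodes τ g).length.size ≤ 2 * g.size + 1
  | .nil, τ => by simp [Data.goalNodes, Data.length, Data.map, Data.size]
  | .cons t .nil, τ => by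
    simp [Data.goalNodes, Data.length, Data.map, Data.size]
  | .cons t (.cons a b), τ => by
    have h1 := Data.size_length_goalNodes a τ
    have h2 := Data.size_length_goalNodes b τ
    have h3 := Data.size_length_goalNodes b (.cons a τ)
    have h4 := Data.size_length_append (Data.goalNodes τ a) (Data.goalNodes τ b)
    have h5 := t.one_le_size
    have h6 := a.one_le_size
    rw [Data.goalNodes]
    generalize t.snd.snd = u
    generalize t.snd = v
    cases v
    · simp [Data.length, Data.map, Data.size]
    · cases u <;> simp only [Data.ite_nil, Data.ite_cons, Data.length_cons, Data.size] <;> omega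

@[fun_prop]
theorem PolyTime.goalNodes {f g : Data → Data} (hf : PolyTime f) (hg : PolyTime g) :
    PolyTime (fun y => Data.goalNodes (f y) (g y)) := by
  have key : PolyTime (fun z => Data.goalNodes z.fst z.snd) := by
    refine PolyTime.recursion
      (calls := fun z => z.snd.snd.ite (z.snd.fst.snd.ite (z.snd.fst.snd.snd.ite
        (.cons (.cons (.cons z.snd.snd.fst z.fst) z.snd.snd.snd) .nil)
        (.cons (.cons z.fst z.snd.snd.fst) (.cons (.cons z.fst z.snd.snd.snd) .nil))) .nil) .nil)
      (comb := fun w => w.snd.ite (w.snd.snd.ite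
        (.cons (.cons w.fst.fst (.cons w.fst.snd w.snd.snd.fst.length))
          (w.snd.snd.fst.append w.snd.fst))
        (.cons (.cons w.fst.fst (.cons w.fst.snd .nil))
          (.cons (.cons (w.fst.fst.append (.cons w.fst.snd.snd.fst .nil))
            (.cons (.cons (encNat 4) .nil) .nil)) w.snd.fst)))
        (.cons (.cons w.fst.fst (.cons w.fst.snd .nil)) .nil))
      (by fun_prop) (by fun_prop) ?_ (fun z => z.snd.size) ?_ (fun z => z.size_snd_le) ?_
      (4 * .X + 40) ?_
    · rintro (_ | ⟨p, _ | ⟨t, _ | ⟨a, b⟩⟩⟩)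
      · rfl
      · rfl
      · rfl
      · cases h1 : t.snd <;> cases h2 : t.snd.snd <;>
          simp_all [Data.toList, Data.goalNodes]
    · rintro (_ | ⟨p, _ | ⟨t, _ | ⟨a, b⟩⟩⟩)
      · simp [Data.toList, Data.size]
      · simp [Data.toList, Data.size]
      · simp [Data.toList, Data.size]
      · cases h1 : t.snd <;> cases h2 : t.snd.snd <;>
          simp_all [Data.toList, Data.size] <;> omega
    · rintro (_ | ⟨p, _ | ⟨t, _ | ⟨a, b⟩⟩⟩)
      · simp [Data.toList]
      · simp [Data.toList]
      · simp [Data.toList]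
      · have := t.one_le_size
        cases h1 : t.snd <;> cases h2 : t.snd.snd <;>
          simp_all [Data.toList, Data.size] <;> omega
    · rintro (_ | ⟨p, _ | ⟨t, _ | ⟨a, b⟩⟩⟩)
      · simp [Data.toList, Data.size, Data.goalNodes]
      · simp [Data.toList, Data.size, Data.goalNodes]; omega
      · simp [Data.toList, Data.size, Data.goalNodes]; omega
      · have h3 := Data.size_append p (.cons a .nil)
        have h4 := Data.size_append (Data.goalNodes p a) (Data.goalNodes p b)
        have h5 := Data.size_length_goalNodes a p
        simp only [Data.size] at h3
        cases h1 : t.snd <;> cases h2 : t.snd.snd <;>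
          simp_all [Data.toList, Data.size, Data.goalNodes, encNat] <;> omega
  exact key.comp (hf.cons hg)

end GoalNodes

section Programs

/-- The encoding of a nonterminal as a term. -/
def Data.nt (i : Data) : Data := .mkCst (.cons (encNat 1) i)

/-- The encoding of the application of a binary terminal. -/
def Data.mcNode (a s t : Data) : Data := .mkApp (.mkApp (.mkCst (.cons (encNat 0) a)) s) t

/-- The encoding of the term that generates the undefined tree. -/
def Data.mcBot : Data := .nt (encNat 0)

/-- The encoding of a term over the constructors as a term of the scheme. -/
def Data.mcTerm (t : Data) : Data := t.mapCst fun k => .cons (encNat 1) (.cons .nil k)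

/-- The encoding of the quantification over all closed terms of the type `κ`. The parameter `p`
consists of the list of the types of the constructors and the list of their iterated codomains. -/
def Data.mcForall (p κ k : Data) : Data :=
  Data.fold (fun x r => .mcNode (encNat 0) x r) .mcBot
    ((p.fst.zipIdx.map fun c => (c.fst.eq κ).ite (.mkApp k (.nt (.cons .nil c.snd))) .mcBot).append
      (p.snd.zipIdx.map fun x => (κ.eq x.fst.snd).ite
        (.mkApp (.nt (.cons .nil (p.fst.length.append x.snd))) k) .mcBot))

/-- The encoding of the right-hand side of the rule for the subgoal `e` with the nonterminal `i`. -/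
def Data.goalRule (p e i : Data) : Data :=
  e.snd.fst.fst.ite (e.snd.fst.fst.snd.ite (e.snd.fst.fst.snd.snd.ite
    (e.snd.fst.fst.snd.snd.snd.ite
      (.spine (.mkApp (.nt (.cons .nil i)) (.mkVar e.fst.snd.length)) e.fst.snd.length)
      (.mcForall p e.snd.fst.snd.fst (.spine (.nt (.cons .nil i)) e.fst.length)))
    (.mcNode (encNat 1) (.spine (.nt (.cons .nil i)) e.fst.length)
      (.spine (.nt ((Data.cons .nil i).append e.snd.snd)) e.fst.length)))
    (.mcNode ((encNat 3).append e.snd.fst.snd.fst) (.mcTerm e.snd.fst.snd.snd) .mcBot))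
    (.mcNode (encNat 2) .mcBot .mcBot)

/-- The encoding of the type of a clause. -/
def Data.clauseTy (sig C : Data) : Data := C.fst.ite (sig.nth C.snd.snd.fst) (.cons .nil .nil)

/-- The list of the subgoals of a clause; the first is paired with the clause. -/
def Data.clauseNodes (sig C : Data) : Data :=
  .cons (.cons C (Data.goalNodes (.clauseTy sig C) (C.fst.ite C.snd.snd.snd C.snd.snd)).fst)
    ((Data.goalNodes (.clauseTy sig C) (C.fst.ite C.snd.snd.snd C.snd.snd)).snd.map
      (fun e => .cons .nil e))

/-- The clauses of a list of subgoals, with the nonterminals for their bodies; the nonterminal of the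
first subgoal is `B`. -/
def Data.locate (B l : Data) : Data :=
  l.zipIdx.flatMap fun e => e.fst.fst.ite (.cons (.cons e.fst.fst (B.append e.snd)) .nil) .nil

/-- The encoding of the body of a clause, as far as it applies to the constructor `c`. -/
def Data.tryClause (c e : Data) : Data :=
  e.fst.fst.ite
    ((e.fst.snd.snd.fst.eq c.snd).ite (.spine (.nt e.snd) c.fst.length) .mcBot)
    (.mkApp (.nt e.snd) (.spine (.nt (.cons .nil c.snd)) c.fst.length))

/-- The encoding of the right-hand side of the rule for a constructor `c`. -/
def Data.conRule (L c : Data) : Data :=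
  Data.fold (fun x r => .mcNode x.fst x.snd r) .mcBot
    (L.map fun e => .cons ((encNat 3).append e.fst.snd.fst) (.tryClause c e))

/-- The number of the nonterminals that do not depend on the formulas. -/
def Data.mcBase (p : Data) : Data :=
  .cons .nil (p.fst.length.append (p.snd.length.append (p.snd.length.append p.snd.length)))

/-- The encodings of the right-hand sides of the rules, for the list `l` of the subgoals of the
clauses and the list `l'` of the subgoals of the goal. -/
def Data.mcRules (p l l' : Data) : Data :=
  .cons .mcBot ((p.fst.zipIdx.map fun c => .conRule (.locate p.mcBase l) c).append
    ((p.snd.zipIdx.map fun x => .mcForall p x.fst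
      (.mkApp (.nt (.cons .nil (p.fst.length.append (p.snd.length.append x.snd))))
        (.mkVar (encNat 0)))).append
    ((p.snd.zipIdx.map fun x => .mcForall p x.fst.fst
      (.mkApp (.mkApp
        (.nt (.cons .nil (p.fst.length.append (p.snd.length.append (p.snd.length.append x.snd)))))
        (.mkVar (encNat 0))) (.mkVar (encNat 1)))).append
    ((p.snd.map fun x => x.ite (.mkApp (.mkVar (encNat 0)) (.mkApp (.mkVar (encNat 1))
      (.mkVar (encNat 2)))) .mcBot).append
    ((l.append l').zipIdx.map fun e => .goalRule p e.fst.snd (p.mcBase.append e.snd))))))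

/-- The encodings of the types of the nonterminals. -/
def Data.mcNts (p l : Data) : Data :=
  .cons .nil (p.fst.append
    ((p.snd.map fun x => .cons (.cons x.snd .nil) .nil).append
    ((p.snd.map fun x => .cons (.cons x.snd .nil) (.cons x .nil)).append
    ((p.snd.map fun x => .cons (.cons x.snd .nil) (.cons x (.cons x.fst .nil))).append
    (l.map fun e => e.snd.fst)))))

/-- The encoding of a transition. -/
def Data.mcTransition (q a r s : Data) : Data := .cons q (.cons a (.cons r (.cons s .nil)))

/-- The encodings of the transitions, for `n` predicates. -/
def Data.mcDelta (n : Data) : Data :=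
  (((encNat 3).append n).range.map fun a =>
    .mcTransition (encNat 0) a (encNat 0) (encNat 0)).append
  ((encList [.mcTransition (encNat 1) (encNat 0) (encNat 1) (encNat 1),
    .mcTransition (encNat 1) (encNat 1) (encNat 1) (encNat 0),
    .mcTransition (encNat 1) (encNat 1) (encNat 0) (encNat 1)]).append
  ((n.range.map fun P => .mcTransition (encNat 1) ((encNat 3).append P) ((encNat 2).append P)
    (encNat 0)).append
  (n.range.flatMap fun P => n.range.map fun P' => .mcTransition ((encNat 2).append P)
    ((encNat 3).append P') ((P'.eq P).ite (encNat 1) (encNat 0)) ((encNat 2).append P))))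

/-- The encoding of the instance of model checking, for the parameter `p`, the number `n` of
predicates, the list `l` of the subgoals of the clauses and the list `l'` of the subgoals of the
goal. -/
def Data.toModelCheckingAux (p n l l' : Data) : Data :=
  .cons (.cons (((encNat 3).append n).map fun _ => encNat 2)
    (.cons (.mcNts p (l.append l')) (.cons (p.mcBase.append l.length) (.mcRules p l l'))))
    (.cons ((encNat 2).append n) (.cons (encNat 1) (.mcDelta n)))

/-- The encoding of the instance of model checking for an instance of MSL(ω). -/
def Data.toModelChecking (x : Data) : Data :=
  .toModelCheckingAux (.cons x.fst (x.fst.flatMap .tails)) x.snd.fst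
    (x.snd.snd.fst.flatMap fun C => .clauseNodes x.fst C)
    ((Data.goalNodes .nil x.snd.snd.snd).map fun e => .cons .nil e)

section

variable {f g h k : Data → Data}

@[fun_prop]
theorem PolyTime.nt (hf : PolyTime f) : PolyTime (fun y => Data.nt (f y)) := by
  unfold Data.nt; fun_prop

@[fun_prop]
theorem PolyTime.mcNode (hf : PolyTime f) (hg : PolyTime g) (hh : PolyTime h) :
    PolyTime (fun y => Data.mcNode (f y) (g y) (h y)) := by
  unfold Data.mcNode; fun_prop

@[fun_prop]
theorem PolyTime.mcTerm (hf : PolyTime f) : PolyTime (fun y => Data.mcTerm (f y)) := by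
  unfold Data.mcTerm; fun_prop

@[fun_prop]
theorem PolyTime.mcForall (hf : PolyTime f) (hg : PolyTime g) (hh : PolyTime h) :
    PolyTime (fun y => Data.mcForall (f y) (g y) (h y)) :=
  PolyTime.fold (g := fun x r => .mcNode (encNat 0) x r) (by fun_prop) 40
    (fun x r => by simp only [Data.mcNode, Data.mkApp, Data.mkCst, encNat, Data.size]; omega)
    (PolyTime.const _) (by fun_prop)

@[fun_prop]
theorem PolyTime.goalRule (hf : PolyTime f) (hg : PolyTime g) (hh : PolyTime h) :
    PolyTime (fun y => Data.goalRule (f y) (g y) (h y)) := by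
  unfold Data.goalRule; fun_prop

@[fun_prop]
theorem PolyTime.clauseNodes (hf : PolyTime f) (hg : PolyTime g) :
    PolyTime (fun y => Data.clauseNodes (f y) (g y)) := by
  unfold Data.clauseNodes Data.clauseTy; fun_prop

@[fun_prop]
theorem PolyTime.locate (hf : PolyTime f) (hg : PolyTime g) :
    PolyTime (fun y => Data.locate (f y) (g y)) := by
  unfold Data.locate; fun_prop

@[fun_prop]
theorem PolyTime.conRule (hf : PolyTime f) (hg : PolyTime g) :
    PolyTime (fun y => Data.conRule (f y) (g y)) :=
  PolyTime.fold (g := fun x r => .mcNode x.fst x.snd r) (by fun_prop) 40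
    (fun x r => by
      cases x <;> simp only [Data.mcNode, Data.mkApp, Data.mkCst, encNat, Data.size,
        Data.fst_nil, Data.snd_nil, Data.fst_cons, Data.snd_cons] <;> omega)
    (PolyTime.const _) (by unfold Data.tryClause; fun_prop)

@[fun_prop]
theorem PolyTime.mcRules (hf : PolyTime f) (hg : PolyTime g) (hh : PolyTime h) :
    PolyTime (fun y => Data.mcRules (f y) (g y) (h y)) := by
  unfold Data.mcRules Data.mcBase; fun_prop

@[fun_prop]
theorem PolyTime.mcNts (hf : PolyTime f) (hg : PolyTime g) :
    PolyTime (fun y => Data.mcNts (f y) (g y)) := by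
  unfold Data.mcNts; fun_prop

@[fun_prop]
theorem PolyTime.mcDelta (hf : PolyTime f) : PolyTime (fun y => Data.mcDelta (f y)) := by
  unfold Data.mcDelta Data.mcTransition; fun_prop

@[fun_prop]
theorem PolyTime.toModelCheckingAux (hf : PolyTime f) (hg : PolyTime g) (hh : PolyTime h)
    (hk : PolyTime k) : PolyTime (fun y => Data.toModelCheckingAux (f y) (g y) (h y) (k y)) := by
  unfold Data.toModelCheckingAux Data.mcBase; fun_prop

theorem polyTime_toModelChecking : PolyTime Data.toModelChecking := by
  unfold Data.toModelChecking; fun_prop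

end

end Programs

section TypeEncodings

theorem encTy_eq : ∀ τ : Ty, encTy τ = encList (τ.args.map encTy)
  | .base => rfl
  | .arr a b => congrArg (Data.cons (encTy a)) (encTy_eq b)

theorem length_encTy (τ : Ty) : (encTy τ).length = encNat τ.args.length := by
  rw [encTy_eq, Data.length_encList, List.length_map]

theorem encTy_snoc (κ : Ty) : ∀ τ : Ty,
    encTy (τ.snoc κ) = (encTy τ).append (.cons (encTy κ) .nil)
  | .base => rfl
  | .arr a b => congrArg (Data.cons (encTy a)) (encTy_snoc κ b)

theorem length_args_snoc (κ : Ty) : ∀ τ : Ty, (τ.snoc κ).args.length = τ.args.length + 1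
  | .base => rfl
  | .arr _ b => congrArg (· + 1) (length_args_snoc κ b)

theorem tails_encTy : ∀ τ : Ty, (encTy τ).tails = encList (τ.suffixes.map encTy)
  | .base => rfl
  | .arr a b => congrArg (Data.cons (encTy (.arr a b))) (tails_encTy b)

theorem encTy_inj : ∀ {τ σ : Ty}, encTy τ = encTy σ ↔ τ = σ
  | .base, .base => by simp
  | .base, .arr _ _ => by simp [encTy]
  | .arr _ _, .base => by simp [encTy]
  | .arr _ _, .arr _ _ => by simp [encTy, encTy_inj]

theorem encTy_cod (τ : Ty) : encTy τ.cod = (encTy τ).snd := by cases τ <;> rfl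

theorem encTy_dom (τ : Ty) : encTy τ.dom = (encTy τ).fst := by cases τ <;> rfl

theorem length_args_cod (τ : Ty) (κ : Ty) : (encTy (τ.snoc κ)).snd.length = encNat τ.args.length := by
  rw [← encTy_cod, length_encTy]
  have := length_args_snoc κ τ
  cases τ <;> simp_all [Ty.snoc, Ty.cod, Ty.args]

theorem map_eq_tabulate {α : Type} (g : Ty → α) : ∀ Γ : List Ty,
    Γ.map g = tabulate Γ (fun τ _ => g τ)
  | [] => rfl
  | _ :: Γ => congrArg (_ :: ·) (map_eq_tabulate g Γ)

theorem Data.zipIdx_encList_map_encTy (Γ : List Ty) : (encList (Γ.map encTy)).zipIdx =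
    encList (tabulate Γ (fun τ x => .cons (encTy τ) (encNat x.index))) := by
  rw [map_eq_tabulate, Data.zipIdx_tabulate]

theorem tabulate_mapElim {α : Type} {M : Ty → Type} {f : Ty → Ty} (u : ∀ ⦃τ : Ty⦄, M τ → α) :
    ∀ {l : List Ty} (g : ∀ ⦃τ : Ty⦄, Var l τ → M (f τ)),
      tabulate (l.map f) (fun _ x => u (Var.mapElim g x)) = tabulate l (fun _ x => u (g x))
  | [], _ => rfl
  | _ :: _, g => congrArg (_ :: ·) (tabulate_mapElim u (fun _ y => g (.there y)))

theorem encTerm_appsSnoc {K : Ty → Type} (encK : ∀ ⦃τ : Ty⦄, K τ → Data) {Γ : List Ty} {κ : Ty} :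
    ∀ {τ : Ty} (s : Term K Γ (τ.snoc κ)) (θ : Subst K τ.args Γ), encTerm encK (s.appsSnoc θ) =
      (tabulate τ.args (fun _ x => encTerm encK (θ x))).foldl .mkApp (encTerm encK s)
  | .base, _, _ => rfl
  | .arr _ b, s, θ =>
    encTerm_appsSnoc encK (τ := b) (Term.app s (θ .here)) (fun _ x => θ (.there x))

end TypeEncodings

section Rules

variable (X : Instance)

/-- The parameter of the program. -/
def Instance.param : Data :=
  .cons (encList (X.sig.map encTy)) (encList (X.spine.map encTy))

variable {X} {Γ : List Ty}

/-- The encoding of a term of the scheme. -/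
abbrev encMc {n : ℕ} {nts Γ : List Ty} {τ : Ty} (t : McTerm n nts Γ τ) : Data :=
  encTerm encSymb t

theorem encMc_mcNode {n : ℕ} {nts : List Ty} (a : Fin (mcRanks n).length)
    (s t : McTerm n nts Γ .base) :
    encMc (mcNode a s t) = Data.mcNode (encNat a) (encMc s) (encMc t) := rfl

theorem encMc_spine {n : ℕ} {nts : List Ty} {τ : Ty} (F : Var nts τ) :
    encMc (n := n) ((Term.cst (.nonterminal F)).apps (fun _ x => .var x)) =
      Data.spine (.nt (encNat F.index)) (encTy τ).length := by
  rw [length_encTy]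
  exact encTerm_apps_var _ _ (fun _ x => x) (fun _ _ => rfl)

theorem encMc_bot : encMc (X.embed.bot X.preds : McTerm _ _ Γ _) = Data.mcBot := rfl

theorem Instance.index_con {τ : Ty} (c : Var X.sig τ) :
    (X.embed.con c).index = c.index + 1 := by
  simp [embed, Var.index]

theorem Instance.index_enum {τ : Ty} (x : Var X.spine τ) :
    (X.embed.enum x).index = (X.sig.length + x.index) + 1 := by
  simp [embed, Var.index]

theorem Instance.index_push {τ : Ty} (x : Var X.spine τ) :
    (X.embed.push x).index = (X.sig.length + (X.spine.length + x.index)) + 1 := by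
  simp [embed, Var.index]

theorem Instance.index_papp {τ : Ty} (x : Var X.spine τ) :
    (X.embed.papp x).index =
      (X.sig.length + (X.spine.length + (X.spine.length + x.index))) + 1 := by
  simp [embed, Var.index]

theorem encMc_term {τ : Ty} (t : Term (Var X.sig) Γ τ) :
    encMc (X.embed.term X.preds t) = Data.mcTerm (encTerm (fun _ c => encNat c.index) t) := by
  refine encTerm_mapCst (fun τ c => ?_) t
  rw [encSymb, X.index_con]; rfl

theorem encMc_tryCon {κ : Ty} (k : McTerm X.preds X.mcNts Γ (.arr κ .base)) {τ : Ty}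
    (c : Var X.sig τ) : encMc (X.embed.tryCon k c) = ((encTy τ).eq (encTy κ)).ite
      (.mkApp (encMc k) (.nt (.cons .nil (encNat c.index)))) .mcBot := by
  by_cases h : τ = κ
  · subst h
    rw [Data.eq_of_eq rfl, Embed.tryCon, dif_pos rfl, Data.ite_cons]
    exact congrArg (fun i => Data.mkApp (encMc k) (.nt (encNat i))) (X.index_con c)
  · rw [Data.eq_of_ne (fun e => h (encTy_inj.1 e)), Embed.tryCon, dif_neg h]
    rfl

theorem encMc_tryEnum {κ : Ty} (k : McTerm X.preds X.mcNts Γ (.arr κ .base)) {τ : Ty}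
    (x : Var X.spine τ) : encMc (X.embed.tryEnum k x) = ((encTy κ).eq (encTy τ).snd).ite
      (.mkApp (.nt (.cons .nil ((encNat X.sig.length).append (encNat x.index)))) (encMc k))
        .mcBot := by
  rw [← encTy_cod]
  by_cases h : κ = τ.cod
  · subst h
    rw [Data.eq_of_eq rfl, Embed.tryEnum, dif_pos rfl, Data.ite_cons, Data.append_encNat]
    exact congrArg (fun i => Data.mkApp (.nt (encNat i)) (encMc k)) (X.index_enum x)
  · rw [Data.eq_of_ne (fun e => h (encTy_inj.1 e)), Embed.tryEnum, dif_neg h]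
    rfl

theorem encMc_all (l : List (McTerm X.preds X.mcNts Γ .base)) : encMc (X.embed.all l) =
    (l.map encMc).foldr (fun x r => .mcNode (encNat 0) x r) .mcBot := by
  induction l with
  | nil => rfl
  | cons s l ih => rw [List.map_cons, List.foldr_cons, ← ih]; rfl

theorem encMc_forall {κ : Ty} (k : McTerm X.preds X.mcNts Γ (.arr κ .base)) :
    encMc (X.embed.forall k) = Data.mcForall X.param (encTy κ) (encMc k) := by
  rw [Embed.forall, encMc_all, Data.mcForall, Instance.param]
  simp only [Data.fst_cons, Data.snd_cons, Data.zipIdx_encList_map_encTy, Data.map_encList,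
    map_tabulate, Data.append_encList, Data.fold_encList, List.map_append, encMc_tryCon,
    encMc_tryEnum, Data.length_encList, List.length_map]

/-- The list of the subgoals of a goal, in the order of their nonterminals. -/
def goalNodes {n : ℕ} {sig : List Ty} : ∀ {Γ : List Ty}, Goal sig n Γ → Ty → List Data
  | Γ, .tt, τ => [.cons (encTy τ) (.cons (encGoal (.tt : Goal sig n Γ)) .nil)]
  | _, .atom P t, τ => [.cons (encTy τ) (.cons (encGoal (.atom P t)) .nil)]
  | _, .and G H, τ =>
    .cons (encTy τ) (.cons (encGoal (.and G H)) (encNat (goalNodes G τ).length)) ::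
      (goalNodes G τ ++ goalNodes H τ)
  | _, .ex κ G, τ =>
    .cons (encTy τ) (.cons (encGoal (.ex κ G)) .nil) ::
      .cons (encTy (τ.snoc κ)) (.cons (.cons (encNat 4) .nil) .nil) :: goalNodes G (.arr κ τ)

theorem enc_goalNodes {n : ℕ} {sig : List Ty} {Γ : List Ty} (G : Goal sig n Γ) : ∀ τ : Ty,
    Data.goalNodes (encTy τ) (encGoal G) = encList (goalNodes G τ) := by
  induction G with
  | tt => intro τ; simp [encGoal, Data.goalNodes, goalNodes, encNat]
  | atom P t => intro τ; rfl
  | and G H hG hH =>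
    intro τ
    rw [encGoal, Data.goalNodes, hG, hH, Data.append_encList, Data.length_encList]; rfl
  | ex κ G hG =>
    intro τ
    have := hG (.arr κ τ)
    rw [encTy] at this
    rw [encGoal, Data.goalNodes, this, ← encTy_snoc]; rfl

theorem map_fst_goalNodes {n : ℕ} {sig : List Ty} {Γ : List Ty} (G : Goal sig n Γ) : ∀ τ : Ty,
    (goalNodes G τ).map Data.fst = (goalSyms G τ).map encTy := by
  induction G with
  | tt => intro τ; rfl
  | atom P t => intro τ; rfl
  | and G H hG hH => intro τ; simp [goalNodes, goalSyms, hG, hH]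
  | ex κ G hG => intro τ; simp [goalNodes, goalSyms, hG]

theorem length_goalNodes {n : ℕ} {sig : List Ty} {Γ : List Ty} (G : Goal sig n Γ) (τ : Ty) :
    (goalNodes G τ).length = (goalSyms G τ).length := by
  simpa using congrArg List.length (map_fst_goalNodes G τ)

theorem index_goalRoot {n : ℕ} {sig : List Ty} {Γ : List Ty} (G : Goal sig n Γ) (τ : Ty) :
    (goalRoot G τ).index = 0 := by
  cases G <;> rfl

theorem enc_goalRules (G : Goal X.sig X.preds Γ) : ∀ (τ : Ty) (h : Γ = τ.args)
    (e : ∀ ⦃σ : Ty⦄, Var (goalSyms G τ) σ → Var X.mcNts σ) (o : ℕ)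
    (_ : ∀ ⦃σ : Ty⦄ (v : Var (goalSyms G τ) σ), (e v).index = o + v.index),
    tabulate (goalSyms G τ) (fun _ v => encMc (X.embed.goalRules G τ h e v)) =
      ((goalNodes G τ).zipIdx o).map (fun q => Data.goalRule X.param q.1 (encNat q.2)) := by
  induction G with
  | tt => rintro τ rfl e o he; rfl
  | atom P t =>
    rintro τ rfl e o he
    refine congrArg (fun u => [u]) ?_
    change encMc (mcNode (litLetter P) (X.embed.term _ t) _) = _
    rw [encMc_mcNode, encMc_term]
    rfl
  | and G H hG hH =>
    rintro τ rfl e o he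
    have h1 := hG τ rfl (fun _ v => e (.there v.inl)) (o + 1) (fun _ v =>
      (he (.there v.inl)).trans
        ((congrArg (fun i => o + (i + 1)) (Var.index_inl v)).trans (by omega)))
    have h2 := hH τ rfl (fun _ v => e (.there (Var.inr _ v))) (o + 1 + (goalSyms G τ).length)
      (fun _ v => (he (.there (Var.inr _ v))).trans
        ((congrArg (fun i => o + (i + 1)) (Var.index_inr v _)).trans (by omega)))
    rw [goalNodes, List.zipIdx_cons, List.map_cons, List.zipIdx_append, List.map_append, ← h1,
      length_goalNodes, ← h2]
    refine congrArg₂ List.cons ?_ ((tabulate_append _).trans (congrArg₂ _ ?_ ?_))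
    · change encMc (mcNode (andLetter _) _ _) = _
      have e1 : (e (.there (goalRoot G τ).inl)).index = o + 1 :=
        (he _).trans (congrArg (fun i => o + (i + 1)) ((Var.index_inl _).trans (index_goalRoot G τ)))
      have e2 : (e (.there (Var.inr _ (goalRoot H τ)))).index =
          o + 1 + (goalSyms G τ).length := (he _).trans
        ((congrArg (fun i => o + (i + 1)) (Var.index_inr _ _)).trans
          (by rw [index_goalRoot]; omega))
      rw [encMc_mcNode, encMc_spine, encMc_spine, e1, e2, ← Data.append_encNat (o + 1)]
      rfl
    · simp [Embed.goalRules, Var.consElim]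
    · simp [Embed.goalRules, Var.consElim]
  | ex κ G hG =>
    rintro τ rfl e o he
    have h1 := hG (.arr κ τ) rfl (fun _ v => e (.there (.there v))) (o + 1 + 1) (fun _ v =>
      (he (.there (.there v))).trans (by change o + (v.index + 1 + 1) = _; omega))
    rw [goalNodes, List.zipIdx_cons, List.zipIdx_cons, List.map_cons, List.map_cons, ← h1]
    refine congrArg₂ List.cons ?_ (congrArg₂ List.cons ?_ rfl)
    · refine (encMc_forall _).trans ?_
      rw [encMc, encTerm_appsSnoc]
      change Data.mcForall _ _ (List.foldl Data.mkApp _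
        (tabulate τ.args (fun _ x => Data.cons (encNat 0) (encNat x.index)))) = _
      rw [foldl_mkApp_tabulate, ← length_encTy]
      have e1 : encMc (Γ := τ.args) (n := X.preds) (.cst (.nonterminal (e (.there .here)))) =
          Data.nt (.cons .nil (encNat o)) :=
        congrArg (fun i => Data.nt (encNat i)) (he _)
      rw [← encMc, e1]
      rfl
    · refine (encTerm_apps (τ := .arr κ τ) _ _ _).trans ?_
      change List.foldl Data.mkApp (Data.mkApp _ (Data.cons (encNat 0) _))
        (tabulate τ.args (fun _ x => Data.cons (encNat 0) (encNat _))) = _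
      simp only [Var.index_snocWeak, Var.index_snocLast]
      rw [foldl_mkApp_tabulate]
      have e1 : encMc (Γ := (τ.snoc κ).args) (n := X.preds)
          (.cst (.nonterminal (e (.there (.there (goalRoot G (.arr κ τ))))))) =
          Data.nt (.cons .nil (encNat (o + 1))) :=
        congrArg (fun i => Data.nt (encNat i)) ((he (.there (.there (goalRoot G (.arr κ τ))))).trans
          (congrArg (fun i => o + (i + 1 + 1)) (index_goalRoot G (.arr κ τ))))
      rw [← encMc, e1, ← length_args_cod τ κ]
      rfl

end Rules

section Clauses

variable {n : ℕ} {sig : List Ty}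

theorem goalNodes_ne_nil {Γ : List Ty} (G : Goal sig n Γ) (τ : Ty) : goalNodes G τ ≠ [] := by
  cases G <;> simp [goalNodes]

/-- The list of the subgoals of a clause; the first is paired with the clause. -/
def clauseNodes (C : Clause sig n) : List Data :=
  match goalNodes C.body C.ty with
  | [] => []
  | e :: l => .cons (encClause C) e :: l.map (Data.cons .nil)

theorem nth_map_encTy {Γ : List Ty} {τ : Ty} (c : Var Γ τ) :
    (encList (Γ.map encTy)).nth (encNat c.index) = encTy τ := by
  have h : ∀ {Γ : List Ty} {τ : Ty} (c : Var Γ τ), (Γ.map encTy)[c.index]? = some (encTy τ) := by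
    intro Γ τ c
    induction c with
    | here => rfl
    | there c ih => simpa [Var.index] using ih
  have hc : c.index < (Γ.map encTy).length := by simpa using c.index_lt
  have := Data.nth_encList (Γ.map encTy) ⟨c.index, hc⟩
  rw [this]
  have h' := h c
  rw [List.getElem?_eq_getElem hc] at h'
  exact Option.some.inj h'

theorem enc_clauseNodes (C : Clause sig n) :
    Data.clauseNodes (encList (sig.map encTy)) (encClause C) = encList (clauseNodes C) := by
  have h1 : Data.clauseTy (encList (sig.map encTy)) (encClause C) = encTy C.ty := by
    cases C with
    | var P G => rfl
    | con P c G => exact nth_map_encTy c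
  have h2 : (encClause C).fst.ite (encClause C).snd.snd.snd (encClause C).snd.snd =
      encGoal C.body := by
    cases C <;> rfl
  rw [Data.clauseNodes, h1, h2, enc_goalNodes, clauseNodes]
  obtain ⟨e, l, h⟩ := List.exists_cons_of_ne_nil (goalNodes_ne_nil C.body C.ty)
  simp [h]

theorem map_snd_clauseNodes (C : Clause sig n) :
    (clauseNodes C).map Data.snd = goalNodes C.body C.ty := by
  rw [clauseNodes]
  obtain ⟨e, l, h⟩ := List.exists_cons_of_ne_nil (goalNodes_ne_nil C.body C.ty)
  simp [h, Function.comp_def]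

theorem map_fst_clauseNodes (l : List (Clause sig n)) :
    (l.flatMap clauseNodes).map (fun e => e.snd.fst) = (clauseSyms l).map encTy := by
  induction l with
  | nil => rfl
  | cons C l ih =>
    rw [List.flatMap_cons, List.map_append, ih, clauseSyms, List.map_append, ← map_fst_goalNodes,
      ← map_snd_clauseNodes, List.map_map]
    rfl

theorem length_flatMap_clauseNodes (l : List (Clause sig n)) :
    (l.flatMap clauseNodes).length = (clauseSyms l).length := by
  simpa only [List.length_map] using congrArg List.length (map_fst_clauseNodes l)

theorem length_clauseNodes (C : Clause sig n) :
    (clauseNodes C).length = (goalSyms C.body C.ty).length := by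
  rw [← length_goalNodes, ← map_snd_clauseNodes, List.length_map]

theorem enc_clauseRules {X : Instance} (l : List (Clause X.sig X.preds)) :
    ∀ (e : ∀ ⦃σ : Ty⦄, Var (clauseSyms l) σ → Var X.mcNts σ) (o : ℕ)
    (_ : ∀ ⦃σ : Ty⦄ (v : Var (clauseSyms l) σ), (e v).index = o + v.index),
    tabulate (clauseSyms l) (fun _ v => encMc (X.embed.clauseRules l e v)) =
      ((l.flatMap clauseNodes).zipIdx o).map
        (fun q => Data.goalRule X.param q.1.snd (encNat q.2)) := by
  induction l with
  | nil => intros; rfl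
  | cons C l ih =>
    intro e o he
    have h1 := enc_goalRules C.body C.ty rfl (fun _ v => e v.inl) o (fun _ v =>
      (he v.inl).trans (congrArg (o + ·) (Var.index_inl v)))
    have h2 := ih (fun _ v => e (Var.inr _ v)) (o + (goalSyms C.body C.ty).length) (fun _ v =>
      (he (Var.inr _ v)).trans ((congrArg (o + ·) (Var.index_inr v _)).trans (by omega)))
    rw [List.flatMap_cons, List.zipIdx_append, List.map_append, length_clauseNodes, ← h2]
    rw [← map_snd_clauseNodes, List.zipIdx_map, List.map_map] at h1
    refine (tabulate_append _).trans (congrArg₂ _ (Eq.trans ?_ h1) ?_)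
    · simp only [Embed.clauseRules, Var.appendElim_inl]
    · simp only [Embed.clauseRules, Var.appendElim_inr]

/-- The clause of a subgoal with its nonterminal, if the subgoal is the body of the clause. -/
def locateNode (B : ℕ) (q : Data × ℕ) : List Data :=
  match q.1.fst with
  | .nil => []
  | .cons a b => [.cons (.cons a b) (encNat (B + q.2))]

theorem data_locate (B : ℕ) (l : List Data) :
    Data.locate (encNat B) (encList l) = encList (l.zipIdx.flatMap (locateNode B)) := by
  rw [Data.locate, Data.zipIdx_encList, Data.flatMap_encList_map (locateNode B)]
  intro q
  simp only [Data.fst_cons, Data.snd_cons, Data.append_encNat, locateNode]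
  cases q.1.fst <;> rfl

theorem flatMap_locateNode_zipIdx_map_nil (B : ℕ) (l : List Data) :
    ∀ o : ℕ, ((l.map (Data.cons .nil)).zipIdx o).flatMap (locateNode B) = [] := by
  induction l with
  | nil => intro o; rfl
  | cons x l ih => intro o; simpa [locateNode] using ih (o + 1)

/-- The encoding of a clause with the nonterminal for its body. -/
def encLocated {nts : List Ty} (p : Σ C : Clause sig n, Var nts C.ty) : Data :=
  .cons (encClause p.1) (encNat p.2.index)

theorem enc_locate {nts : List Ty} (B : ℕ) (l : List (Clause sig n)) :
    ∀ (e : ∀ ⦃σ : Ty⦄, Var (clauseSyms l) σ → Var nts σ) (o : ℕ)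
    (_ : ∀ ⦃σ : Ty⦄ (v : Var (clauseSyms l) σ), (e v).index = B + (o + v.index)),
    ((l.flatMap clauseNodes).zipIdx o).flatMap (locateNode B) =
      (locate l e).map encLocated := by
  induction l with
  | nil => intros; rfl
  | cons C l ih =>
    intro e o he
    have h2 := ih (fun _ v => e (Var.inr _ v)) (o + (goalSyms C.body C.ty).length) (fun _ v =>
      (he (Var.inr _ v)).trans
        ((congrArg (fun i => B + (o + i)) (Var.index_inr v _)).trans (by omega)))
    rw [List.flatMap_cons, List.zipIdx_append, List.flatMap_append, length_clauseNodes, h2, locate,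
      List.map_cons, ← List.singleton_append]
    refine congrArg (· ++ _) ?_
    have h3 : (e (goalRoot C.body C.ty).inl).index = B + o :=
      (he _).trans (congrArg (fun i => B + (o + i)) ((Var.index_inl _).trans (index_goalRoot _ _)))
    obtain ⟨x, l', h⟩ := List.exists_cons_of_ne_nil (goalNodes_ne_nil C.body C.ty)
    have h4 : clauseNodes C = .cons (encClause C) x :: l'.map (Data.cons .nil) := by
      rw [clauseNodes, h]
    rw [h4, List.zipIdx_cons, List.flatMap_cons, flatMap_locateNode_zipIdx_map_nil,
      List.append_nil, encLocated, h3]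
    cases C <;> rfl

theorem encMc_tryClause {X : Instance} {τ : Ty} (c : Var X.sig τ)
    (p : Σ C : Clause X.sig X.preds, Var X.mcNts C.ty) : encMc (X.embed.tryClause c p) =
      Data.tryClause (.cons (encTy τ) (encNat c.index)) (encLocated p) := by
  obtain ⟨_ | @⟨P, σ, d, G⟩, F⟩ := p
  · refine congrArg (Data.mkApp _) ((encMc_spine _).trans ?_)
    rw [X.index_con]
    rfl
  · by_cases h : (⟨σ, d⟩ : Σ σ, Var X.sig σ) = ⟨τ, c⟩
    · cases h
      have h1 : X.embed.tryClause c ⟨.con P c G, F⟩ = (Term.cst (.nonterminal F)).apps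
        (fun _ x => .var x) := dif_pos rfl
      refine (congrArg encMc h1).trans ((encMc_spine _).trans ?_)
      simp [Data.tryClause, encLocated, encClause, Data.eq_of_eq, encNat]
      rfl
    · have h1 : X.embed.tryClause c ⟨.con P d G, F⟩ = X.embed.bot _ := dif_neg h
      refine (congrArg encMc h1).trans ?_
      have h2 : encNat d.index ≠ encNat c.index := fun e =>
        h (Var.index_injective d c (encNat_injective e))
      simp [Data.tryClause, encLocated, encClause, Data.eq_of_ne h2, encNat, encMc_bot]

theorem encMc_conRule {X : Instance} {τ : Ty} (c : Var X.sig τ)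
    (L : List (Σ C : Clause X.sig X.preds, Var X.mcNts C.ty)) : encMc (X.embed.conRule L c) =
      Data.conRule (encList (L.map encLocated)) (.cons (encTy τ) (encNat c.index)) := by
  rw [Data.conRule, Data.map_encList_map, Data.fold_encList]
  induction L with
  | nil => rfl
  | cons p L ih =>
    rw [List.map_cons, List.foldr_cons, ← ih, ← encMc_tryClause]
    obtain ⟨_ | _, F⟩ := p <;> rfl

end Clauses

section Scheme

variable (X : Instance)

/-- The number of the nonterminals that do not depend on the formulas. -/
def Instance.base : ℕ :=
  X.sig.length + (X.spine.length + (X.spine.length + X.spine.length)) + 1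

theorem Instance.mcBase_param : Data.mcBase X.param = encNat X.base := by
  simp [Data.mcBase, param, base, encNat]

theorem Instance.index_clauseEmb {σ : Ty} (v : Var (clauseSyms X.clauses) σ) :
    (X.clauseEmb v).index = X.base + v.index := by
  simp [clauseEmb, Var.index, base]; omega

theorem Instance.index_goalEmb {σ : Ty} (v : Var (goalSyms X.goal .base) σ) :
    (X.goalEmb v).index = X.base + (clauseSyms X.clauses).length + v.index := by
  simp [goalEmb, Var.index, base]; omega

theorem Instance.enc_located :
    Data.locate (encNat X.base) (encList (X.clauses.flatMap clauseNodes)) =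
      encList (X.located.map encLocated) := by
  rw [data_locate, enc_locate X.base X.clauses X.clauseEmb 0 (fun _ v => by
    rw [X.index_clauseEmb, Nat.zero_add])]
  rfl

theorem Instance.enc_mcNts : encList (X.mcNts.map encTy) = Data.mcNts X.param
    ((encList (X.clauses.flatMap clauseNodes)).append
      (encList ((goalNodes X.goal .base).map (Data.cons .nil)))) := by
  rw [Data.mcNts, param]
  simp only [Data.fst_cons, Data.snd_cons, Data.map_encList, Data.append_encList,
    List.map_append, List.map_map, map_fst_clauseNodes, List.map_cons, encList_cons]
  have h : (goalNodes X.goal .base).map ((fun e => e.snd.fst) ∘ Data.cons .nil) =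
      (goalSyms X.goal .base).map encTy := by
    rw [← map_fst_goalNodes]; rfl
  rw [h]
  simp only [Function.comp_def, enumTy, pushTy, pappTy, encTy, encTy_cod, encTy_dom]

theorem Instance.encMc_enumRule {τ : Ty} (x : Var X.spine τ) :
    encMc (X.embed.enumRule X.preds x) = Data.mcForall X.param (encTy τ)
      (.mkApp (.nt (.cons .nil (encNat (X.sig.length + (X.spine.length + x.index)))))
        (.mkVar (encNat 0))) :=
  (encMc_forall _).trans (congrArg (fun i => Data.mcForall _ _ (.mkApp (.nt (encNat i)) _))
    (X.index_push x))

theorem Instance.encMc_pushRule {τ : Ty} (x : Var X.spine τ) :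
    encMc (X.embed.pushRule X.preds x) = Data.mcForall X.param (encTy τ).fst
      (.mkApp (.mkApp (.nt (.cons .nil (encNat (X.sig.length + (X.spine.length +
        (X.spine.length + x.index)))))) (.mkVar (encNat 0))) (.mkVar (encNat 1))) := by
  rw [← encTy_dom]
  exact (encMc_forall _).trans (congrArg
    (fun i => Data.mcForall _ _ (.mkApp (.mkApp (.nt (encNat i)) _) _)) (X.index_papp x))

theorem Instance.encMc_pappRule {τ : Ty} (x : Var X.spine τ) :
    encMc (X.embed.pappRule X.preds x) = (encTy τ).ite (.mkApp (.mkVar (encNat 0))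
      (.mkApp (.mkVar (encNat 1)) (.mkVar (encNat 2)))) .mcBot := by
  cases τ <;> rfl

theorem Instance.enc_mcRules : encList (tabulate X.mcNts (fun _ F => encMc (X.mcRules F))) =
    Data.mcRules X.param (encList (X.clauses.flatMap clauseNodes))
      (encList ((goalNodes X.goal .base).map (Data.cons .nil))) := by
  have hC := enc_clauseRules X.clauses X.clauseEmb X.base (fun _ v => X.index_clauseEmb v)
  have hG := enc_goalRules X.goal .base rfl X.goalEmb _ (fun _ v => X.index_goalEmb v)
  have hN : ((encList (X.clauses.flatMap clauseNodes)).append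
      (encList ((goalNodes X.goal .base).map (Data.cons .nil)))).zipIdx.map (fun e =>
        .goalRule X.param e.fst.snd ((encNat X.base).append e.snd)) =
      encList (tabulate (clauseSyms X.clauses)
        (fun _ v => encMc (X.embed.clauseRules X.clauses X.clauseEmb v)) ++
          tabulate (goalSyms X.goal .base)
            (fun _ v => encMc (X.embed.goalRules X.goal .base rfl X.goalEmb v))) := by
    rw [hC, hG, Data.append_encList, Data.zipIdx_encList, Data.map_encList, List.map_map,
      List.zipIdx_append, List.map_append, List.zipIdx_map, List.map_map, Nat.zero_add,
      length_flatMap_clauseNodes]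
    have hz : ∀ (l : List Data) (k : ℕ),
        l.zipIdx (X.base + k) = (l.zipIdx k).map (Prod.map _root_.id (· + X.base)) :=
      fun l k => List.map_snd_add_zipIdx_eq_zipIdx.symm
    rw [hz, ← Nat.add_zero X.base, hz, List.map_map, List.map_map]
    simp [Function.comp_def, Nat.add_comm]
  rw [Data.mcRules, X.mcBase_param, hN, enc_located, param]
  simp only [Data.fst_cons, Data.snd_cons, Data.length_encList, List.length_map,
    Data.zipIdx_encList_map_encTy, Data.append_encNat, Data.map_encList, Data.append_encList,
    map_tabulate]
  change Data.cons _ (encList (tabulate (X.sig ++ (X.spine.map enumTy ++ (X.spine.map pushTy ++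
    (X.spine.map pappTy ++ (clauseSyms X.clauses ++ goalSyms X.goal .base)))))
    (fun _ v => encMc (X.mcRules (.there v))))) = _
  refine congrArg₂ Data.cons rfl (congrArg encList ?_)
  rw [tabulate_append, tabulate_append, tabulate_append, tabulate_append, tabulate_append]
  simp only [Instance.mcRules, Var.consElim, Var.appendElim_inl, Var.appendElim_inr]
  rw [tabulate_mapElim (M := fun σ => McTerm X.preds X.mcNts σ.args .base) (fun _ t => encMc t),
    tabulate_mapElim (M := fun σ => McTerm X.preds X.mcNts σ.args .base) (fun _ t => encMc t),
    tabulate_mapElim (M := fun σ => McTerm X.preds X.mcNts σ.args .base) (fun _ t => encMc t)]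
  simp only [encMc_conRule, X.encMc_enumRule, X.encMc_pushRule, X.encMc_pappRule,
    map_eq_tabulate, map_tabulate, Instance.param]

theorem ofFn_two {k : ℕ} (hk : k = 2) (a b : Data) :
    List.ofFn (fun i : Fin k => if i.val = 0 then a else b) = [a, b] := by
  subst hk; rfl

theorem enc_mcTransition {n : ℕ}
    (d : Fin (n + 2) × Fin (mcRanks n).length × Fin (n + 2) × Fin (n + 2)) :
    (mcTransition d).enc = Data.mcTransition (encNat d.1) (encNat d.2.1) (encNat d.2.2.1)
      (encNat d.2.2.2) := by
  have h : ∀ i, encNat ((mcTransition d).succ i) =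
      if i.val = 0 then encNat d.2.2.1 else encNat d.2.2.2 :=
    fun i => apply_ite (fun q : Fin (n + 2) => encNat q.val) _ _ _
  rw [Transition.enc, funext h, ofFn_two (by simp)]
  rfl

theorem enc_mcDelta (n : ℕ) : encList (((mcDelta n).map mcTransition).map Transition.enc) =
    Data.mcDelta (encNat n) := by
  rw [Data.mcDelta, Data.append_encNat, Data.range_encNat', Data.range_encNat',
    Data.map_encList_map, Data.map_encList_map,
    Data.flatMap_encList_map (fun P : Fin n => (List.finRange n).map fun P' : Fin n =>
      Data.mcTransition ((encNat 2).append (encNat P)) ((encNat 3).append (encNat P'))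
        (((encNat P').eq (encNat P)).ite (encNat 1) (encNat 0)) ((encNat 2).append (encNat P)))
      (fun P => Data.map_encList_map _ _ _),
    Data.append_encList, Data.append_encList, Data.append_encList]
  simp only [mcDelta, List.map_append, List.map_map, List.map_flatMap, Function.comp_def,
    enc_mcTransition, List.map_cons, List.map_nil]
  have h : ∀ P' P : Fin n, ((encNat P').eq (encNat P)).ite (encNat 1) (encNat 0) =
      encNat (Fin.val (if P' = P then goalState n else anyState n)) := fun P' P => by
    rw [Data.eq_ite (P := P' = P) ⟨fun e => Fin.ext (encNat_injective e), fun e => e ▸ rfl⟩]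
    split_ifs <;> rfl
  simp only [h]
  refine congrArg encList (congrArg₂ _ ?_ rfl)
  rw [← range_map_eq_finRange _ (fun a => Data.mcTransition (encNat 0) (encNat a) _ _)]
  refine (range_map_eq_finRange _
    (fun a => Data.mcTransition (encNat 0) (encNat a) (encNat 0) (encNat 0))).symm.trans ?_
  rw [List.length_replicate, Nat.add_comm]

theorem enc_toModelChecking : X.toModelChecking.enc = Data.toModelChecking X.enc := by
  have h1 : Data.cons X.enc.fst (X.enc.fst.flatMap .tails) = X.param := by
    simp only [Instance.enc, Data.fst_cons, Instance.param, Instance.spine]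
    rw [Data.flatMap_encList_map (fun τ => _) tails_encTy, List.map_flatMap]
  have h2 : X.enc.snd.snd.fst.flatMap (fun C => .clauseNodes X.enc.fst C) =
      encList (X.clauses.flatMap clauseNodes) :=
    Data.flatMap_encList_map clauseNodes enc_clauseNodes
  have h3 : (Data.goalNodes .nil X.enc.snd.snd.snd).map (fun e => .cons .nil e) =
      encList ((goalNodes X.goal .base).map (Data.cons .nil)) :=
    (congrArg (Data.map _) (enc_goalNodes X.goal .base)).trans (Data.map_encList _ _)
  rw [Data.toModelChecking, h1, h2, h3, Data.toModelCheckingAux, ← X.enc_mcNts, ← X.enc_mcRules,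
    X.mcBase_param, Data.length_encList, length_flatMap_clauseNodes, Data.append_encNat]
  have h4 : (X.toHORS.start).index = X.base + (clauseSyms X.clauses).length :=
    (X.index_goalEmb _).trans (congrArg (_ + ·) (index_goalRoot _ _))
  have h5 : encList ((mcRanks X.preds).map encNat) =
      ((encNat 3).append (encNat X.preds)).map fun _ => encNat 2 := by
    rw [Data.append_encNat, encNat_eq (3 + _), Data.map_encList, Nat.add_comm]
    simp
  have h6 : (encNat 2).append (encNat X.preds) = encNat (X.preds + 2) := by
    rw [Data.append_encNat, Nat.add_comm]
  have h7 : X.enc.snd.fst = encNat X.preds := rfl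
  rw [← h4, h7, ← h5, h6, ← enc_mcDelta]
  rfl

end Scheme

/-! ### Interreducibility -/

theorem PolyReduces.of_polyTime {A B : Problem} (f : A.Inst → B.Inst) {g : Data → Data}
    (hg : PolyTime g) (hf : ∀ X, A.Yes X ↔ B.Yes (f X)) (henc : ∀ X, B.enc (f X) = g (A.enc X)) :
    PolyReduces A B := by
  obtain ⟨p, b, h⟩ := hg
  exact ⟨f, hf, p, b, fun X => henc X ▸ h (A.enc X)⟩

theorem PolyReduces.trans {A B C : Problem} (h : PolyReduces A B) (h' : PolyReduces B C) :
    PolyReduces A C := by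
  obtain ⟨f, hf, p, b, hp⟩ := h
  obtain ⟨g, hg, q, c, hq⟩ := h'
  refine ⟨fun X => g (f X), fun X => (hf X).trans (hg (f X)), .seq p q, b + c.comp b + 1,
    fun X => ?_⟩
  obtain ⟨t, ht, hr⟩ := hp X
  obtain ⟨u, hu, hs⟩ := hq (f X)
  refine ⟨t + u + 1, ?_, .seq hr hs⟩
  have := hu.trans (eval_le_eval c (hr.size_le.trans ht))
  simp only [Polynomial.eval_add, Polynomial.eval_comp, Polynomial.eval_one]
  omega

theorem satisfiability_reduces_unprovability :
    PolyReduces mslSatisfiability mslUnprovability :=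
  .of_polyTime (fun X => X.1) .id
    (fun X => not_congr (entails_iff_provable X.2.1 X.2.2)) (fun _ => rfl)

theorem unprovability_reduces_modelChecking :
    PolyReduces mslUnprovability horsModelChecking :=
  .of_polyTime Instance.toModelChecking polyTime_toModelChecking
    Instance.not_provable_iff_accepts enc_toModelChecking

theorem modelChecking_reduces_typeability :
    PolyReduces horsModelChecking intersectionTypeability :=
  .of_polyTime (fun X => X) .id (fun X => X.typeable_iff_accepts.symm) (fun _ => rfl)

theorem typeability_reduces_satisfiability :
    PolyReduces intersectionTypeability mslSatisfiability :=
  .of_polyTime (fun X => ⟨X.toMSL, X.toMSL_existentialFree⟩) polyTime_toMSL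
    (fun X => X.typeable_iff_accepts.trans (X.accepts_iff_not_provable.trans
      (not_congr (entails_iff_provable X.toMSL_existentialFree.1
        X.toMSL_existentialFree.2)).symm)) enc_toMSL

end MSL

theorem mainTheorem11 :
    ∀ A ∈ [MSL.mslUnprovability, MSL.mslSatisfiability, MSL.horsModelChecking,
        MSL.intersectionTypeability],
      ∀ B ∈ [MSL.mslUnprovability, MSL.mslSatisfiability, MSL.horsModelChecking,
          MSL.intersectionTypeability],
        MSL.PolyReduces A B := by
  -- The four reductions form a cycle through all four problems.
  have hSU := MSL.satisfiability_reduces_unprovability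
  have hUH := MSL.unprovability_reduces_modelChecking
  have hHT := MSL.modelChecking_reduces_typeability
  have hTS := MSL.typeability_reduces_satisfiability
  have hSH := hSU.trans hUH
  have hHS := hHT.trans hTS
  have hUS := hUH.trans hHS
  have hTU := hTS.trans hSU
  intro A hA B hB
  simp only [List.mem_cons, List.not_mem_nil, or_false] at hA hB
  rcases hA with rfl | rfl | rfl | rfl <;> rcases hB with rfl | rfl | rfl | rfl
  · exact hUS.trans hSU
  · exact hUS
  · exact hUH
  · exact hUH.trans hHT
  · exact hSU
  · exact hSU.trans hUS
  · exact hSH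
  · exact hSH.trans hHT
  · exact hHS.trans hSU
  · exact hHS
  · exact hHS.trans hSH
  · exact hHT
  · exact hTU
  · exact hTS
  · exact hTS.trans hSH
  · exact hTS.trans (hSH.trans hHT)
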